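/- Setting. Let $(V,|\cdot|)$ be a separable real Hilbert space and let $A$ be an (unbounded) symmetric operator on $V$ such that $-A$ is strictly positive and has a compact inverse; let $S=(S(t))_{t\ge 0}$ be the strongly continuous semigroup on $V$ generated by $A$ (it is automatically analytic and exponentially decreasing). Let $L_2(V)$ be the Hilbert space of Hilbert–Schmidt operators on $V$, and let $G:V\to L_2(V)$ be twice continuously Fréchet differentiable with bounded first and second derivatives. Fix $1/2<\beta<\beta'<1$ and $1-\beta'<\alpha<\beta$. Let $\Omega$ be the set of paths $\omega:\mathbb R\to V$ with $\omega(0)=0$ which are $\beta'$-Hölder continuous on every compact interval, and let $\theta_t\omega=\omega(t+\cdot)-\omega(t)$, $t\in\mathbb R$, be the Wiener shifts on $\Omega$. For suitable $Z:[T_1,T_2]\to L_2(V)$ put $$\int_{T_1}^{T_2}Z\,d\omega=(-1)^\alpha\int_{T_1}^{T_2}D^{\alpha}_{T_1+}Z[r]\,D^{1-\alpha}_{T_2-}\omega_{T_2-}[r]\,dr ,$$ where, with $(-1)^{\alpha}(-1)^{1-\alpha}=-1$, $$D^{\alpha}_{T_1+}Z[r]=\frac1{\Gamma(1-\alpha)}\Big(\frac{Z(r)}{(r-T_1)^\alpha}+\alpha\int_{T_1}^r\frac{Z(r)-Z(q)}{(r-q)^{1+\alpha}}dq\Big),$$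 $$D^{1-\alpha}_{T_2-}\omega_{T_2-}[r]=\frac{(-1)^{1-\alpha}}{\Gamma(\alpha)}\Big(\frac{\omega(r)-\omega(T_2)}{(T_2-r)^{1-\alpha}}+(1-\alpha)\int_r^{T_2}\frac{\omega(r)-\omega(q)}{(q-r)^{2-\alpha}}dq\Big).$$ The integral is called well defined if the inner integrals converge absolutely for all $r\in(T_1,T_2)$, both fractional derivatives are measurable in $r$, and the product of their norms is integrable over $(T_1,T_2)$. Let $C^{\beta,\sim}([0,T];V)$ be the space of continuous $u:[0,T]\to V$ with $$\sup_{0<s<t\le T}s^\beta\,\frac{|u(t)-u(s)|}{|t-s|^\beta}<\infty .$$ Theorem. For every $\omega\in\Omega$, $u_0\in V$ and $T>0$ the equation $$u(t)=S(t)u_0+\int_0^tS(t-r)G(u(r))\,d\omega(r),\qquad t\in[0,T],$$ has a unique solution $u$ in $C^{\beta,\sim}([0,T];V)$, the integrals being well defined. The solutions for different $T$ agree on common intervals and define a map $\phi:\mathbb R^+\times\Omega\times V\to V$, $$\phi(t,\omega,u_0)=u(t)=S(t)u_0+\int_0^tS(t-r)G(u(r))\,d\omega(r),$$ and: 1. $\phi$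 is a non-autonomous dynamical system, i.e. a cocycle over the flow $\theta$: $\theta_0\omega=\omega$ and $\theta_t\theta_\tau\omega=\theta_{t+\tau}\omega$ for $t,\tau\in\mathbb R$; $\phi(0,\omega,u_0)=u_0$ and $\phi(t+\tau,\omega,u_0)=\phi(t,\theta_\tau\omega,\phi(\tau,\omega,u_0))$ for all $t,\tau\ge0$, $\omega\in\Omega$, $u_0\in V$; 2. for all $t\ge0$ and $\omega\in\Omega$ the map $u_0\mapsto\phi(t,\omega,u_0)$ is continuous on $V$; 3. for all $t>0$ and $\omega\in\Omega$ this map is compact, i.e. it maps bounded subsets of $V$ to relatively compact subsets of $V$. -/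

import Mathlib

open Set Filter Topology MeasureTheory
open scoped NNReal ENNReal InnerProductSpace

namespace PathwiseSPDE

/-! ## Hilbert-Schmidt operators -/

section HilbertSchmidt

lemma ofReal_norm_sq_eq_tsum {V : Type*} [NormedAddCommGroup V] [InnerProductSpace ℝ V]
    {ι : Type*} (b : HilbertBasis ι ℝ V) (x : V) :
    ENNReal.ofReal (‖x‖ ^ 2) = ∑' i, ENNReal.ofReal (⟪b i, x⟫_ℝ ^ 2) := by
  have h := b.hasSum_inner_mul_inner x x
  have h2 : (fun i => ⟪x, b i⟫_ℝ * ⟪b i, x⟫_ℝ) = fun i => ⟪b i, x⟫_ℝ ^ 2 := by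
    funext i
    rw [real_inner_comm x (b i), sq]
  rw [h2, real_inner_self_eq_norm_sq] at h
  rw [← h.tsum_eq]
  exact ENNReal.ofReal_tsum_of_nonneg (fun _ => sq_nonneg _) h.summable

variable (V : Type*) [NormedAddCommGroup V] [InnerProductSpace ℝ V] [CompleteSpace V]

/-- The index set of a fixed complete orthonormal basis of `V`. -/
def BasisIndex : Type _ := (exists_hilbertBasis ℝ V).choose

/-- A fixed complete orthonormal basis of `V`. It is only used to write down the Hilbert-Schmidt
norm, which does not depend on it: see `HS.hasSum_norm_sq`. -/
noncomputable def fixedBasis : HilbertBasis (BasisIndex V) ℝ V :=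
  (exists_hilbertBasis ℝ V).choose_spec.choose

/-- The linear space of the bounded operators `T` with `∑ i, ‖T (e i)‖ ^ 2 < ∞`. -/
noncomputable def hsSubmodule : Submodule ℝ (V →L[ℝ] V) where
  carrier := {T | Memℓp (fun i => T (fixedBasis V i)) 2}
  add_mem' := by
    intro S T hS hT
    simpa using! hS.add hT
  zero_mem' := by
    simpa using! (zero_memℓp : Memℓp (0 : BasisIndex V → V) 2)
  smul_mem' := by
    intro c T hT
    simpa using! hT.const_smul c

/-- The space `L₂(V)` of Hilbert-Schmidt operators on `V`. As a separate type it carries the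
Hilbert-Schmidt norm (below) and not the operator norm. -/
def HS : Type _ := hsSubmodule V

noncomputable instance : AddCommGroup (HS V) := inferInstanceAs (AddCommGroup (hsSubmodule V))

noncomputable instance : Module ℝ (HS V) := inferInstanceAs (Module ℝ (hsSubmodule V))

variable {V}

/-- A bounded operator with finite Hilbert-Schmidt norm as an element of `L₂(V)`. -/
def HS.mk (T : V →L[ℝ] V) (hT : T ∈ hsSubmodule V) : HS V := ⟨T, hT⟩

/-- A Hilbert-Schmidt operator as a bounded operator. -/
def HS.toCLM (T : HS V) : V →L[ℝ] V := T.1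

instance : CoeFun (HS V) (fun _ => V → V) := ⟨fun T => T.toCLM⟩

variable (V) in
/-- The family `(T (e i))` as an element of `ℓ²(V)`. -/
noncomputable def hsToLp : HS V →ₗ[ℝ] lp (fun _ : BasisIndex V => V) 2 where
  toFun T := ⟨fun i => T (fixedBasis V i), T.2⟩
  map_add' _ _ := rfl
  map_smul' _ _ := rfl

lemma hsToLp_apply (T : HS V) (i : BasisIndex V) : hsToLp V T i = T (fixedBasis V i) := rfl

lemma hasSum_apply (T : V →L[ℝ] V) (v : V) :
    HasSum (fun i => (fixedBasis V).repr v i • T (fixedBasis V i)) (T v) := by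
  have h := ((fixedBasis V).hasSum_repr v).mapL T
  simpa using h

lemma hsToLp_injective : Function.Injective (hsToLp V) := by
  intro S T h
  have h' : ∀ i, S (fixedBasis V i) = T (fixedBasis V i) := fun i => by
    rw [← hsToLp_apply, ← hsToLp_apply, h]
  apply Subtype.ext
  ext v
  refine (hasSum_apply S.toCLM v).unique ?_
  simp only [h']
  exact hasSum_apply T.toCLM v

/-- The Hilbert-Schmidt norm `‖T‖ = (∑ i, ‖T (e i)‖ ^ 2) ^ (1 / 2)`. -/
noncomputable instance : NormedAddCommGroup (HS V) :=
  NormedAddCommGroup.induced (HS V) (lp (fun _ : BasisIndex V => V) 2) (hsToLp V)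
    hsToLp_injective

noncomputable instance : NormedSpace ℝ (HS V) :=
  NormedSpace.induced ℝ (HS V) (lp (fun _ : BasisIndex V => V) 2) (hsToLp V)

lemma HS.norm_def (T : HS V) : ‖T‖ = ‖hsToLp V T‖ := rfl

lemma tsum_enorm_sq_adjoint (T : V →L[ℝ] V) {ι κ : Type*} (b : HilbertBasis ι ℝ V)
    (c : HilbertBasis κ ℝ V) :
    ∑' i, ENNReal.ofReal (‖T (b i)‖ ^ 2)
      = ∑' j, ENNReal.ofReal (‖(ContinuousLinearMap.adjoint T) (c j)‖ ^ 2) := by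
  simp_rw [fun i => ofReal_norm_sq_eq_tsum c (T (b i)),
    fun j => ofReal_norm_sq_eq_tsum b ((ContinuousLinearMap.adjoint T) (c j))]
  rw [ENNReal.tsum_comm]
  refine tsum_congr fun j => tsum_congr fun i => ?_
  rw [ContinuousLinearMap.adjoint_inner_right, real_inner_comm]

/-- The Hilbert-Schmidt norm can be computed in every complete orthonormal basis. -/
lemma HS.hasSum_norm_sq (T : HS V) {ι : Type*} (b : HilbertBasis ι ℝ V) :
    HasSum (fun i => ‖T (b i)‖ ^ 2) (‖T‖ ^ 2) := by
  have h0 : HasSum (fun i => ‖T (fixedBasis V i)‖ ^ 2) (‖T‖ ^ 2) := by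
    have := lp.hasSum_norm (p := 2) (by norm_num) (hsToLp V T)
    simpa [hsToLp_apply, HS.norm_def] using this
  have h1 : ∑' i, ENNReal.ofReal (‖T (b i)‖ ^ 2) = ENNReal.ofReal (‖T‖ ^ 2) := by
    rw [tsum_enorm_sq_adjoint T.toCLM b (fixedBasis V),
      ← tsum_enorm_sq_adjoint T.toCLM (fixedBasis V) (fixedBasis V), ← h0.tsum_eq]
    exact (ENNReal.ofReal_tsum_of_nonneg (fun _ => sq_nonneg _) h0.summable).symm
  have h2 : Summable fun i => ‖T (b i)‖ ^ 2 := by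
    have := ENNReal.summable_toReal (f := fun i => ENNReal.ofReal (‖T (b i)‖ ^ 2))
      (by rw [h1]; exact ENNReal.ofReal_ne_top)
    simpa using this
  have h3 : ∑' i, ‖T (b i)‖ ^ 2 = ‖T‖ ^ 2 := by
    rw [← ENNReal.ofReal_tsum_of_nonneg (fun _ => sq_nonneg _) h2] at h1
    exact (ENNReal.ofReal_eq_ofReal_iff (tsum_nonneg fun _ => sq_nonneg _) (sq_nonneg _)).1 h1
  exact h3 ▸ h2.hasSum

lemma HS.norm_apply_le (T : HS V) (v : V) : ‖T v‖ ≤ ‖T‖ * ‖v‖ := by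
  have hv : HasSum (fun i => ‖(fixedBasis V).repr v i‖ ^ (2 : ℝ)) (‖v‖ ^ (2 : ℝ)) := by
    have := lp.hasSum_norm (p := 2) (by norm_num) ((fixedBasis V).repr v)
    simpa using this
  have hT : HasSum (fun i => ‖T (fixedBasis V i)‖ ^ (2 : ℝ)) (‖T‖ ^ (2 : ℝ)) := by
    have := T.hasSum_norm_sq (fixedBasis V)
    exact_mod_cast this
  obtain ⟨C, -, hC, hs⟩ := Real.inner_le_Lp_mul_Lq_hasSum_of_nonneg
    (Real.HolderConjugate.two_two) (norm_nonneg T) (norm_nonneg v)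
    (fun i => norm_nonneg (T (fixedBasis V i))) (fun i => norm_nonneg ((fixedBasis V).repr v i))
    hT hv
  have h := hasSum_apply T.toCLM v
  rw [← h.tsum_eq]
  refine (tsum_of_norm_bounded hs fun i => ?_).trans hC
  rw [norm_smul, mul_comm]

instance : CompleteSpace (HS V) := by
  refine Metric.complete_of_cauchySeq_tendsto fun u hu => ?_
  have hiso : ∀ S T : HS V, dist (hsToLp V S) (hsToLp V T) = dist S T := fun _ _ => rfl
  have hu1 : CauchySeq fun n => hsToLp V (u n) := by
    rw [Metric.cauchySeq_iff] at hu ⊢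
    simpa [hiso] using hu
  have hu2 : CauchySeq fun n => (u n).toCLM := by
    rw [Metric.cauchySeq_iff] at hu ⊢
    intro ε hε
    obtain ⟨N, hN⟩ := hu ε hε
    refine ⟨N, fun m hm n hn => lt_of_le_of_lt ?_ (hN m hm n hn)⟩
    rw [dist_eq_norm, dist_eq_norm]
    exact ContinuousLinearMap.opNorm_le_bound _ (norm_nonneg _)
      fun v => (u m - u n).norm_apply_le v
  obtain ⟨g, hg⟩ := cauchySeq_tendsto_of_complete hu1
  obtain ⟨T, hT⟩ := cauchySeq_tendsto_of_complete hu2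
  have hgT : ∀ i, g i = T (fixedBasis V i) := by
    intro i
    have h1 : Tendsto (fun n => (u n).toCLM (fixedBasis V i)) atTop (𝓝 (T (fixedBasis V i))) :=
      ((ContinuousLinearMap.apply ℝ V (fixedBasis V i)).continuous.tendsto T).comp hT
    have h2 : Tendsto (fun n => hsToLp V (u n) i) atTop (𝓝 (g i)) := by
      rw [tendsto_iff_norm_sub_tendsto_zero] at hg ⊢
      refine squeeze_zero (fun _ => norm_nonneg _) (fun n => ?_) hg
      exact lp.norm_apply_le_norm (by norm_num) (hsToLp V (u n) - g) i
    exact tendsto_nhds_unique h2 h1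
  have hmem : T ∈ hsSubmodule V := by
    have := lp.memℓp g
    have h3 : (g : BasisIndex V → V) = fun i => T (fixedBasis V i) := funext hgT
    rw [h3] at this
    exact this
  have h4 : hsToLp V (HS.mk T hmem) = g := by
    apply lp.ext
    funext i
    exact (hgT i).symm
  refine ⟨HS.mk T hmem, ?_⟩
  rw [tendsto_iff_dist_tendsto_zero] at hg ⊢
  simp_rw [← hiso]
  rw [h4]
  exact hg

/-- The composition `L ∘ T` of a bounded operator and a Hilbert-Schmidt operator. -/
noncomputable def HS.compLeft (L : V →L[ℝ] V) (T : HS V) : HS V :=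
  HS.mk (L ∘L T.toCLM) <| by
    have h : Memℓp (fun i => T (fixedBasis V i)) 2 := T.2
    change Memℓp (fun i => L (T (fixedBasis V i))) 2
    rw [memℓp_gen_iff (by norm_num)] at h ⊢
    refine Summable.of_nonneg_of_le (fun _ => by positivity) (fun i => ?_)
      (h.mul_left (‖L‖ ^ (2 : ℝ≥0∞).toReal))
    rw [← Real.mul_rpow (norm_nonneg _) (norm_nonneg _)]
    gcongr
    exact L.le_opNorm _

lemma HS.compLeft_apply (L : V →L[ℝ] V) (T : HS V) (v : V) : T.compLeft L v = L (T v) := rfl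

end HilbertSchmidt

/-! ## Fractional derivatives and the pathwise integral -/

section Integral

variable {E : Type*} [NormedAddCommGroup E] [NormedSpace ℝ E]

/-- The left-sided Weyl fractional derivative `D_{a+}^α Z [r]`. -/
noncomputable def weylLeft (α a : ℝ) (Z : ℝ → E) (r : ℝ) : E :=
  (Real.Gamma (1 - α))⁻¹ • (((r - a) ^ α)⁻¹ • Z r
    + α • ∫ q in a..r, ((r - q) ^ (1 + α))⁻¹ • (Z r - Z q))

/-- The right-sided Weyl fractional derivative `D_{b-}^γ w_{b-} [r]` of `w_{b-} = w - w b`, for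
`w` continuous at `b`, without its constant factor `(-1) ^ γ`. -/
noncomputable def weylRight (γ b : ℝ) (w : ℝ → E) (r : ℝ) : E :=
  (Real.Gamma (1 - γ))⁻¹ • (((b - r) ^ γ)⁻¹ • (w r - w b)
    + γ • ∫ q in r..b, ((q - r) ^ (1 + γ))⁻¹ • (w r - w q))

variable {V : Type*} [NormedAddCommGroup V] [InnerProductSpace ℝ V] [CompleteSpace V]

/-- The integral of `Z` with respect to `w` over `[a, b]` is well defined: both fractional
derivatives exist and are measurable, and the product of their norms is integrable. -/
structure HasFracIntegral (α a b : ℝ) (Z : ℝ → HS V) (w : ℝ → V) : Prop where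
  left_integrable : ∀ r ∈ Ioo a b,
    IntervalIntegrable (fun q => ((r - q) ^ (1 + α))⁻¹ • (Z r - Z q)) volume a r
  right_integrable : ∀ r ∈ Ioo a b,
    IntervalIntegrable (fun q => ((q - r) ^ (1 + (1 - α)))⁻¹ • (w r - w q)) volume r b
  left_measurable : AEStronglyMeasurable (weylLeft α a Z) (volume.restrict (Ioo a b))
  right_measurable : AEStronglyMeasurable (weylRight (1 - α) b w) (volume.restrict (Ioo a b))
  integrable : IntervalIntegrable
    (fun r => ‖weylLeft α a Z r‖ * ‖weylRight (1 - α) b w r‖) volume a b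

/-- The integral `∫_a^b Z dw = (-1)^α ∫_a^b D_{a+}^α Z [r] D_{b-}^{1-α} w_{b-} [r] dr`. The two
constants `(-1)^α` and `(-1)^(1-α)` of the definition multiply to `-1`. -/
noncomputable def fracIntegral (α a b : ℝ) (Z : ℝ → HS V) (w : ℝ → V) : V :=
  -∫ r in a..b, (weylLeft α a Z r) (weylRight (1 - α) b w r)

end Integral

/-! ## Semigroups -/

section Semigroup

variable {V : Type*} [NormedAddCommGroup V] [NormedSpace ℝ V]

/-- Strongly continuous semigroups of bounded operators (the values at negative times do not
matter). -/
structure IsC0Semigroup (S : ℝ → V →L[ℝ] V) : Prop where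
  zero : S 0 = ContinuousLinearMap.id ℝ V
  add : ∀ s t, 0 ≤ s → 0 ≤ t → S (s + t) = S s ∘L S t
  continuousOn : ∀ x, ContinuousOn (fun t => S t x) (Ici 0)

/-- `A`, with its domain, is the infinitesimal generator of `S`. -/
def IsGenerator (S : ℝ → V →L[ℝ] V) (A : V →ₗ.[ℝ] V) : Prop :=
  ∀ x y : V, (x, y) ∈ A.graph ↔
    Tendsto (fun t : ℝ => t⁻¹ • (S t x - x)) (𝓝[>] 0) (𝓝 y)

/-- The unbounded operator `B` has an everywhere defined compact inverse. -/
def HasCompactInverse (B : V →ₗ.[ℝ] V) : Prop :=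
  ∃ K : V →L[ℝ] V, IsCompactOperator K ∧ (∀ x : V, (K x, x) ∈ B.graph) ∧
    ∀ x : B.domain, K (B x) = x

end Semigroup

/-! ## Paths and function spaces -/

section Paths

variable {V : Type*} [NormedAddCommGroup V]

variable (V) in
/-- The set `Ω` of the paths `ω : ℝ → V` with `ω 0 = 0` that are Hölder continuous with exponent
`β'` on every compact interval. -/
def PathSpace (β' : ℝ) : Type _ :=
  {ω : ℝ → V // ω 0 = 0 ∧
    ∀ a b : ℝ, ∃ C : ℝ, ∀ s ∈ Icc a b, ∀ t ∈ Icc a b, ‖ω t - ω s‖ ≤ C * |t - s| ^ β'}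

instance (β' : ℝ) : CoeFun (PathSpace V β') (fun _ => ℝ → V) := ⟨Subtype.val⟩

/-- The Wiener shift `θ_t ω = ω (t + ·) - ω t`. -/
def wienerShift {β' : ℝ} (t : ℝ) (ω : PathSpace V β') : PathSpace V β' :=
  ⟨fun r => ω (t + r) - ω t, by simp, fun a b => by
    obtain ⟨C, hC⟩ := ω.2.2 (t + a) (t + b)
    refine ⟨C, fun s hs r hr => ?_⟩
    have := hC (t + s) ⟨by linarith [hs.1], by linarith [hs.2]⟩ (t + r)
      ⟨by linarith [hr.1], by linarith [hr.2]⟩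
    simpa using this⟩

/-- `u` belongs to `C^{β,∼}([a, b]; V)`: it is continuous on `[a, b]`, and
`(s - a)^β ‖u t - u s‖ / (t - s)^β` is bounded over `a < s < t ≤ b`. -/
def MemHolderTilde (β a b : ℝ) (u : ℝ → V) : Prop :=
  ContinuousOn u (Icc a b) ∧
    ∃ C : ℝ, ∀ s t : ℝ, a < s → s < t → t ≤ b →
      (s - a) ^ β * (‖u t - u s‖ / (t - s) ^ β) ≤ C

end Paths

/-! ## Mild solutions, cocycles, compact maps -/

section Solutions

variable {V : Type*} [NormedAddCommGroup V] [InnerProductSpace ℝ V] [CompleteSpace V]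

/-- `u` is a (mild) solution on `[0, T]`, in `C^{β,∼}([0, T]; V)`, of
`u t = S t u₀ + ∫_0^t S (t - r) (G (u r)) dw`, the integrals being well defined. -/
structure IsMildSolution (S : ℝ → V →L[ℝ] V) (G : V → HS V) (α β T : ℝ) (w : ℝ → V) (u₀ : V)
    (u : ℝ → V) : Prop where
  mem : MemHolderTilde β 0 T u
  hasFracIntegral : ∀ t ∈ Icc 0 T,
    HasFracIntegral α 0 t (fun r => (G (u r)).compLeft (S (t - r))) w
  eq : ∀ t ∈ Icc 0 T,
    u t = S t u₀ + fracIntegral α 0 t (fun r => (G (u r)).compLeft (S (t - r))) w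

end Solutions

/-- `φ` is a cocycle over the flow `θ`, that is, a non-autonomous dynamical system. -/
structure IsNonautonomousDynamicalSystem {Ω V : Type*} (θ : ℝ → Ω → Ω) (φ : ℝ≥0 → Ω → V → V) :
    Prop where
  flow_zero : ∀ ω, θ 0 ω = ω
  flow_add : ∀ t τ ω, θ t (θ τ ω) = θ (t + τ) ω
  zero : ∀ ω u₀, φ 0 ω u₀ = u₀
  add : ∀ (t τ : ℝ≥0) ω u₀, φ (t + τ) ω u₀ = φ t (θ τ ω) (φ τ ω u₀)

/-- A (nonlinear) map is compact if it maps bounded sets to relatively compact sets. -/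
def IsCompactMap {V : Type*} [NormedAddCommGroup V] (f : V → V) : Prop :=
  ∀ B : Set V, Bornology.IsBounded B → IsCompact (closure (f '' B))

end PathwiseSPDE

open PathwiseSPDE

namespace PathwiseSPDE

/-! ## Beta integrals -/

section Beta

open ProbabilityTheory (beta)

/-! The proof rests on one estimate for the convolution $\int_0^tS(t-r)g(r)\,d\omega$. Since
$\omega$ is $\beta'$-Hölder, its right derivative of order $1-\alpha$ is
$O((t-r)^{\beta'+\alpha-1})$, so the integral tolerates integrands that blow up at the right end
like $(t-r)^{-\gamma}$ with $\gamma<\beta'+\alpha$. The semigroup causes just such a blow-up: a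
difference $S(t-q)-S(t-r)$ costs $((r-q)/(t-r))^\delta$. `SingularHolder` records these
singularities, and `SingularHolder.norm_fracIntegral_le` reduces the estimate to Beta integrals.

The integrand needs only a Hölder exponent $\delta$ slightly above $\alpha$, while the convolution
is $\beta$-Hölder. Because $\beta+\delta<\beta'+\alpha$, a margin $\eta>0$ remains. It is spent on
the weight: $e^{\rho r}\le 2e^{\rho t}\rho^{-\eta}(t-r)^{-\eta}$, so in the norm weighted by
$e^{-\rho t}$ the convolution has operator norm $O(\rho^{-\eta})$ (`WeightedHolder.mildConv`). As
$G$ is Lipschitz, a large $\rho$ yields an a priori bound. As $G'$ is Lipschitz too, on functions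
with a common bound another large $\rho$ makes the right hand side a contraction. Picard iteration
gives existence; the same two estimates give uniqueness, uniform bounds and Lipschitz dependence on
the initial value.

Splitting an integral at an intermediate time is not evident, because both fractional derivatives
depend on the end points. For differentiable paths, fractional integration by parts identifies the
integral with $\int Z\omega'\,dr$, which is additive. Averages carry this over to Hölder paths, and
limits in the end points to singular integrands (`SingularHolder.fracIntegral_add`). Additivity
gives both the increments of the convolution and the restart formula
$u(t)=S(t-s)u(s)+\int_s^tS(t-r)G(u(r))\,d\omega$. The latter, with translation invariance and
uniqueness, is the cocycle property. It also gives compactness: $u(T)$ is $S(d)u(T-d)$, which ranges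
in a relatively compact set, plus a remainder uniformly small with $d$.

The bounds on $S$ are scalar inequalities for $e^{-\lambda t}$: the eigenvectors of the compact
symmetric inverse of $-A$ span a dense subspace and diagonalise $S(t)$
(`isSmoothingSemigroup_of_compactInverse`). -/

lemma ofReal_beta_integrand (x y : ℝ) {r : ℝ} (hr : r ∈ Ioo (0 : ℝ) 1) :
    (r : ℂ) ^ (((x + 1 : ℝ) : ℂ) - 1) * (1 - (r : ℂ)) ^ (((y + 1 : ℝ) : ℂ) - 1)
      = ((r ^ x * (1 - r) ^ y : ℝ) : ℂ) := by
  have h0 : 0 ≤ 1 - r := by linarith [hr.2]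
  rw [Complex.ofReal_mul, Complex.ofReal_cpow hr.1.le, Complex.ofReal_cpow h0]
  push_cast
  simp

lemma intervalIntegrable_beta_zero_one {x y : ℝ} (hx : -1 < x) (hy : -1 < y) :
    IntervalIntegrable (fun r : ℝ => r ^ x * (1 - r) ^ y) volume 0 1 := by
  have h := Complex.betaIntegral_convergent (u := ((x + 1 : ℝ) : ℂ)) (v := ((y + 1 : ℝ) : ℂ))
    (by simp; linarith) (by simp; linarith)
  have h2 : IntervalIntegrable (fun r : ℝ => ((r ^ x * (1 - r) ^ y : ℝ) : ℂ)) volume 0 1 := by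
    refine h.congr_uIoo fun r hr => ?_
    rw [uIoo_of_le zero_le_one] at hr
    exact ofReal_beta_integrand x y hr
  rw [intervalIntegrable_iff] at h2 ⊢
  rw [uIoc_of_le zero_le_one] at h2 ⊢
  exact Integrable.re h2

lemma integral_beta_zero_one {x y : ℝ} (hx : -1 < x) (hy : -1 < y) :
    ∫ r in (0 : ℝ)..1, r ^ x * (1 - r) ^ y = beta (x + 1) (y + 1) := by
  rw [ProbabilityTheory.beta_eq_betaIntegralReal _ _ (by linarith) (by linarith),
    Complex.betaIntegral]
  have : ∫ r in (0 : ℝ)..1, (r : ℂ) ^ (((x + 1 : ℝ) : ℂ) - 1)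
      * (1 - (r : ℂ)) ^ (((y + 1 : ℝ) : ℂ) - 1)
      = ∫ r in (0 : ℝ)..1, ((r ^ x * (1 - r) ^ y : ℝ) : ℂ) := by
    refine intervalIntegral.integral_congr_uIoo fun r hr => ?_
    rw [uIoo_of_le zero_le_one] at hr
    exact ofReal_beta_integrand x y hr
  rw [this, intervalIntegral.integral_ofReal, Complex.ofReal_re]

lemma beta_integrand_comp {a b : ℝ} (hab : a < b) (x y : ℝ) {r : ℝ} (hr : r ∈ Ioo a b) :
    (r - a) ^ x * (b - r) ^ y = (b - a) ^ (x + y)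
      * ((r / (b - a) - a / (b - a)) ^ x * (1 - (r / (b - a) - a / (b - a))) ^ y) := by
  have h : 0 < b - a := sub_pos.2 hab
  have e1 : r / (b - a) - a / (b - a) = (r - a) / (b - a) := by ring
  have e2 : 1 - (r - a) / (b - a) = (b - r) / (b - a) := by field_simp; ring
  rw [e1, e2, Real.div_rpow (by linarith [hr.1]) h.le, Real.div_rpow (by linarith [hr.2]) h.le,
    Real.rpow_add h]
  have := (Real.rpow_pos_of_pos h x).ne'
  have := (Real.rpow_pos_of_pos h y).ne'
  field_simp

lemma intervalIntegrable_beta {x y : ℝ} (hx : -1 < x) (hy : -1 < y) {a b : ℝ} (hab : a ≤ b) :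
    IntervalIntegrable (fun r : ℝ => (r - a) ^ x * (b - r) ^ y) volume a b := by
  rcases hab.eq_or_lt with rfl | hab
  · exact IntervalIntegrable.refl
  have h : 0 < b - a := sub_pos.2 hab
  have h1 := (intervalIntegrable_beta_zero_one hx hy).comp_sub_right (a / (b - a))
  have h2 := (h1.comp_mul_left (c := (b - a)⁻¹)).const_mul ((b - a) ^ (x + y))
  have e1 : (0 + a / (b - a)) / (b - a)⁻¹ = a := by field_simp; ring
  have e2 : (1 + a / (b - a)) / (b - a)⁻¹ = b := by field_simp; ring
  rw [e1, e2] at h2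
  refine h2.congr_uIoo fun r hr => ?_
  rw [uIoo_of_le hab.le] at hr
  rw [beta_integrand_comp hab x y hr]
  simp only [div_eq_inv_mul]

lemma integral_beta {x y : ℝ} (hx : -1 < x) (hy : -1 < y) {a b : ℝ} (hab : a < b) :
    ∫ r in a..b, (r - a) ^ x * (b - r) ^ y = (b - a) ^ (x + y + 1) * beta (x + 1) (y + 1) := by
  have h : 0 < b - a := sub_pos.2 hab
  have : ∫ r in a..b, (r - a) ^ x * (b - r) ^ y = ∫ r in a..b, (b - a) ^ (x + y)
      * ((r / (b - a) - a / (b - a)) ^ x * (1 - (r / (b - a) - a / (b - a))) ^ y) := by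
    refine intervalIntegral.integral_congr_uIoo fun r hr => ?_
    rw [uIoo_of_le hab.le] at hr
    exact beta_integrand_comp hab x y hr
  rw [this, intervalIntegral.integral_const_mul,
    intervalIntegral.integral_comp_div_sub (fun s => s ^ x * (1 - s) ^ y) h.ne']
  rw [sub_self, ← sub_div, div_self h.ne', integral_beta_zero_one hx hy, smul_eq_mul,
    Real.rpow_add_one h.ne']
  ring

end Beta

/-! ## Hölder bounds -/

section Holder

variable {E : Type*} [NormedAddCommGroup E]

/-- `w` is Hölder continuous on `[a, b]` with exponent `θ` and constant `H`. -/
def HolderBoundOn (θ H a b : ℝ) (w : ℝ → E) : Prop :=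
  ∀ s ∈ Icc a b, ∀ t ∈ Icc a b, ‖w t - w s‖ ≤ H * |t - s| ^ θ

lemma HolderBoundOn.mono {θ H a b a' b' : ℝ} {w : ℝ → E} (h : HolderBoundOn θ H a b w)
    (ha : a ≤ a') (hb : b' ≤ b) : HolderBoundOn θ H a' b' w :=
  fun s hs t ht => h s ⟨ha.trans hs.1, hs.2.trans hb⟩ t ⟨ha.trans ht.1, ht.2.trans hb⟩

lemma HolderBoundOn.nonneg {θ H a b : ℝ} {w : ℝ → E} (h : HolderBoundOn θ H a b w)
    (hab : a < b) : 0 ≤ H := by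
  have h1 := (norm_nonneg _).trans (h a ⟨le_rfl, hab.le⟩ b ⟨hab.le, le_rfl⟩)
  exact nonneg_of_mul_nonneg_left h1 (Real.rpow_pos_of_pos (abs_pos.2 (sub_pos.2 hab).ne') _)

lemma HolderBoundOn.continuousOn {θ H a b : ℝ} {w : ℝ → E} (h : HolderBoundOn θ H a b w)
    (hθ : 0 < θ) : ContinuousOn w (Icc a b) := by
  intro s hs
  rw [ContinuousWithinAt, tendsto_iff_norm_sub_tendsto_zero]
  have h1 : Tendsto (fun t => H * |t - s| ^ θ) (𝓝[Icc a b] s) (𝓝 0) := by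
    have : Continuous fun t : ℝ => H * |t - s| ^ θ :=
      continuous_const.mul ((by fun_prop : Continuous fun t : ℝ => |t - s|).rpow_const
        fun _ => Or.inr hθ.le)
    have h2 := (this.tendsto s).mono_left (nhdsWithin_le_nhds (s := Icc a b))
    simpa [Real.zero_rpow hθ.ne'] using h2
  refine squeeze_zero' (.of_forall fun _ => norm_nonneg _) ?_ h1
  filter_upwards [self_mem_nhdsWithin] with t ht
  exact h s hs t ht

/-- The inserted factor $((r-a)/(q-a))^\theta$ is at least $1$. In this form paths and singular
integrands fall under the same bounds for the Weyl derivative. -/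
lemma HolderBoundOn.weighted {θ H a b : ℝ} {w : ℝ → E} (h : HolderBoundOn θ H a b w)
    (hθ : 0 ≤ θ) {q r : ℝ} (hq : q ∈ Ioo a r) (hr : r ≤ b) :
    ‖w r - w q‖ ≤ H * (r - a) ^ θ * ((r - q) ^ θ * (q - a) ^ (-θ)) := by
  have h1 := h q ⟨hq.1.le, hq.2.le.trans hr⟩ r ⟨(hq.1.trans hq.2).le, hr⟩
  have hH : 0 ≤ H := (h.mono le_rfl hr).nonneg (hq.1.trans hq.2)
  have p1 : 0 < r - q := sub_pos.2 hq.2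
  have p2 : 0 < q - a := sub_pos.2 hq.1
  rw [abs_of_pos p1] at h1
  have h2 : 1 ≤ (r - a) ^ θ * (q - a) ^ (-θ) := by
    rw [Real.rpow_neg p2.le, ← div_eq_mul_inv, one_le_div (Real.rpow_pos_of_pos p2 _)]
    exact Real.rpow_le_rpow p2.le (by linarith) hθ
  calc ‖w r - w q‖ ≤ H * (r - q) ^ θ * 1 := by simpa using h1
    _ ≤ H * (r - q) ^ θ * ((r - a) ^ θ * (q - a) ^ (-θ)) := by gcongr
    _ = _ := by ring

lemma HolderBoundOn.reflect {θ H a b : ℝ} {w : ℝ → E} (h : HolderBoundOn θ H a b w) (c : E) :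
    HolderBoundOn θ H (-b) (-a) (fun x => w (-x) - c) := by
  intro s hs t ht
  have := h (-s) ⟨by linarith [hs.2], by linarith [hs.1]⟩ (-t)
    ⟨by linarith [ht.2], by linarith [ht.1]⟩
  rw [abs_sub_comm] at this
  simpa [neg_add_eq_sub, abs_sub_comm] using this

end Holder

/-! ## Weyl derivatives -/

section Weyl

variable {E : Type*} [NormedAddCommGroup E] [NormedSpace ℝ E]

/-- The reflection $x\mapsto -x$ exchanges the two derivatives, so that facts about the right one
follow from the left one. -/
lemma weylRight_eq_weylLeft (γ b : ℝ) (w : ℝ → E) (r : ℝ) :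
    weylRight γ b w r = weylLeft γ (-b) (fun x => w (-x) - w b) (-r) := by
  have h := intervalIntegral.integral_comp_neg (a := r) (b := b)
    (fun q => ((-r - q) ^ (1 + γ))⁻¹ • (w r - w (-q)) : ℝ → E)
  have e (q : ℝ) : -r - -q = q - r := by ring
  simp only [e, neg_neg] at h
  simp only [weylRight, weylLeft, neg_neg, sub_sub_sub_cancel_right, e, ← h]

lemma weylLeft_congr {α a b : ℝ} {Z Z' : ℝ → E} (h : EqOn Z Z' (Ioo a b)) :
    EqOn (weylLeft α a Z) (weylLeft α a Z') (Ioo a b) := by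
  intro r hr
  simp only [weylLeft, h hr]
  congr 3
  refine intervalIntegral.integral_congr_uIoo fun q hq => ?_
  rw [uIoo_of_le hr.1.le] at hq
  simp only [h ⟨hq.1, hq.2.trans hr.2⟩]

/-- The kernel is continuous on the open triangle $a<q<r<b$, and partial integrals of a jointly
measurable function are measurable. -/
lemma aestronglyMeasurable_weylLeft {α a b : ℝ} {Z : ℝ → E} (hZ : ContinuousOn Z (Ioo a b)) :
    AEStronglyMeasurable (weylLeft α a Z) (volume.restrict (Ioo a b)) := by
  have hk : ContinuousOn (fun r : ℝ => ((r - a) ^ α)⁻¹) (Ioo a b) := by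
    refine ContinuousOn.inv₀ (ContinuousOn.rpow_const (by fun_prop) fun r hr => ?_) fun r hr => ?_
    · exact Or.inl (sub_pos.2 hr.1).ne'
    · exact (Real.rpow_pos_of_pos (sub_pos.2 hr.1) _).ne'
  set D : Set (ℝ × ℝ) := {p | a < p.2 ∧ p.2 < p.1 ∧ p.1 < b} with hD
  have hDo : IsOpen D := by
    refine (isOpen_lt continuous_const continuous_snd).inter
      ((isOpen_lt continuous_snd continuous_fst).inter (isOpen_lt continuous_fst continuous_const))
  set F : ℝ × ℝ → E := fun p => ((p.1 - p.2) ^ (1 + α))⁻¹ • (Z p.1 - Z p.2) with hF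
  have hFc : ContinuousOn F D := by
    refine ContinuousOn.smul (ContinuousOn.inv₀ (ContinuousOn.rpow_const (by fun_prop) ?_) ?_) ?_
    · intro p hp; exact Or.inl (sub_pos.2 hp.2.1).ne'
    · intro p hp; exact (Real.rpow_pos_of_pos (sub_pos.2 hp.2.1) _).ne'
    · refine ContinuousOn.sub (hZ.comp continuousOn_fst ?_) (hZ.comp continuousOn_snd ?_)
      · intro p hp; exact ⟨hp.1.trans hp.2.1, hp.2.2⟩
      · intro p hp; exact ⟨hp.1, hp.2.1.trans hp.2.2⟩
  have hm : AEStronglyMeasurable (D.indicator F) ((volume : Measure ℝ).prod volume) :=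
    (aestronglyMeasurable_indicator_iff hDo.measurableSet).2
      (hFc.aestronglyMeasurable hDo.measurableSet)
  have hi := hm.integral_prod_right'.mono_measure (Measure.restrict_le_self (s := Ioo a b))
  have hi2 : AEStronglyMeasurable (fun r => ∫ q in a..r, ((r - q) ^ (1 + α))⁻¹ • (Z r - Z q))
      (volume.restrict (Ioo a b)) := by
    refine hi.congr ?_
    filter_upwards [ae_restrict_mem measurableSet_Ioo] with r hr
    rw [intervalIntegral.integral_of_le hr.1.le, integral_Ioc_eq_integral_Ioo,
      ← integral_indicator measurableSet_Ioo]
    refine integral_congr_ae (.of_forall fun q => ?_)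
    by_cases hq : q ∈ Ioo a r
    · have : (r, q) ∈ D := ⟨hq.1, hq.2, hr.2⟩
      simp [this, hq, hF]
    · have : (r, q) ∉ D := fun h => hq ⟨h.1, h.2.1⟩
      simp [this, hq]
  exact (((hk.aestronglyMeasurable measurableSet_Ioo).smul
    (hZ.aestronglyMeasurable measurableSet_Ioo)).add (hi2.const_smul α)).const_smul _

lemma aestronglyMeasurable_weylRight {γ a b : ℝ} {w : ℝ → E} (hw : ContinuousOn w (Ioo a b)) :
    AEStronglyMeasurable (weylRight γ b w) (volume.restrict (Ioo a b)) := by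
  have h : ContinuousOn (fun x => w (-x) - w b) (Ioo (-b) (-a)) := by
    refine (hw.comp continuousOn_neg fun x hx => ?_).sub continuousOn_const
    exact ⟨by linarith [hx.2], by linarith [hx.1]⟩
  have h1 := aestronglyMeasurable_weylLeft (α := γ) h
  have h2 := (Measure.measurePreserving_neg (volume : Measure ℝ)).restrict_preimage
    (measurableSet_Ioo (a := -b) (b := -a))
  have h3 : Neg.neg ⁻¹' Ioo (-b) (-a) = Ioo a b := by
    ext x; simp
  rw [h3] at h2
  have h4 := h1.comp_quasiMeasurePreserving h2.quasiMeasurePreserving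
  exact h4.congr (.of_forall fun r => (weylRight_eq_weylLeft γ b w r).symm)

/-- The constant in the pointwise bound of the Weyl derivative of a weighted Hölder function. -/
noncomputable def weylConst (α δ : ℝ) : ℝ :=
  (Real.Gamma (1 - α))⁻¹ * (1 + α * ProbabilityTheory.beta (1 - δ) (δ - α))

lemma weylConst_pos {α δ : ℝ} (hα : 0 < α) (hαδ : α < δ) (hδ : δ < 1) : 0 < weylConst α δ := by
  have := ProbabilityTheory.beta_pos (sub_pos.2 hδ) (sub_pos.2 hαδ)
  have := Real.Gamma_pos_of_pos (s := 1 - α) (by linarith)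
  unfold weylConst
  positivity

lemma weylLeft_integrand_bound {α δ a r k : ℝ} {Z : ℝ → E}
    (hk : ∀ q ∈ Ioo a r, ‖Z r - Z q‖ ≤ k * ((r - q) ^ δ * (q - a) ^ (-δ))) {q : ℝ}
    (hq : q ∈ Ioo a r) :
    ‖((r - q) ^ (1 + α))⁻¹ • (Z r - Z q)‖ ≤ k * ((q - a) ^ (-δ) * (r - q) ^ (δ - α - 1)) := by
  have h : 0 < r - q := sub_pos.2 hq.2
  rw [norm_smul, norm_inv, Real.norm_of_nonneg (Real.rpow_nonneg h.le _), ← Real.rpow_neg h.le]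
  refine (mul_le_mul_of_nonneg_left (hk q hq) (Real.rpow_nonneg h.le _)).trans (le_of_eq ?_)
  have : δ - α - 1 = -(1 + α) + δ := by ring
  rw [this, Real.rpow_add h]
  ring

lemma weylLeft_intervalIntegrable {α δ a r k : ℝ} {Z : ℝ → E} (hαδ : α < δ)
    (hδ : δ < 1) (har : a ≤ r) (hZ : ContinuousOn Z (Ioo a r))
    (hk : ∀ q ∈ Ioo a r, ‖Z r - Z q‖ ≤ k * ((r - q) ^ δ * (q - a) ^ (-δ))) :
    IntervalIntegrable (fun q => ((r - q) ^ (1 + α))⁻¹ • (Z r - Z q)) volume a r := by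
  have hi := (intervalIntegrable_beta (x := -δ) (y := δ - α - 1) (by linarith) (by linarith)
    har).const_mul k
  rw [intervalIntegrable_iff_integrableOn_Ioo_of_le har] at hi ⊢
  refine hi.mono' (ContinuousOn.aestronglyMeasurable ?_ measurableSet_Ioo) ?_
  · refine ContinuousOn.smul (ContinuousOn.inv₀ (ContinuousOn.rpow_const (by fun_prop) ?_) ?_)
      (continuousOn_const.sub hZ)
    · intro p hp; exact Or.inl (sub_pos.2 hp.2).ne'
    · intro p hp; exact (Real.rpow_pos_of_pos (sub_pos.2 hp.2) _).ne'
  · filter_upwards [ae_restrict_mem measurableSet_Ioo] with q hq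
    exact weylLeft_integrand_bound hk hq

/-- The increment bound turns the inner integral into a Beta integral, finite because
$\alpha<\delta<1$. By scaling it is a multiple of $(r-a)^{-\alpha}$, just like the boundary term. -/
lemma norm_weylLeft_le {α δ a r k m : ℝ} {Z : ℝ → E} (hα : 0 < α) (hαδ : α < δ)
    (hδ : δ < 1) (har : a < r) (hm : ‖Z r‖ ≤ m)
    (hk : ∀ q ∈ Ioo a r, ‖Z r - Z q‖ ≤ k * ((r - q) ^ δ * (q - a) ^ (-δ))) :
    ‖weylLeft α a Z r‖ ≤ weylConst α δ * (m + k) * (r - a) ^ (-α) := by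
  have h : 0 < r - a := sub_pos.2 har
  have hk0 : 0 ≤ k := by
    have hq : (a + r) / 2 ∈ Ioo a r := ⟨by linarith, by linarith⟩
    have h1 := (norm_nonneg _).trans (hk _ hq)
    have h2 := Real.rpow_pos_of_pos (sub_pos.2 hq.2) δ
    have h3 := Real.rpow_pos_of_pos (sub_pos.2 hq.1) (-δ)
    exact nonneg_of_mul_nonneg_left h1 (by positivity)
  have hm0 : 0 ≤ m := (norm_nonneg _).trans hm
  have hΓ := Real.Gamma_pos_of_pos (s := 1 - α) (by linarith)
  have hB := ProbabilityTheory.beta_pos (sub_pos.2 hδ) (sub_pos.2 hαδ)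
  have hint : ‖∫ q in a..r, ((r - q) ^ (1 + α))⁻¹ • (Z r - Z q)‖
      ≤ k * ((r - a) ^ (-α) * ProbabilityTheory.beta (1 - δ) (δ - α)) := by
    have e := integral_beta (x := -δ) (y := δ - α - 1) (by linarith) (by linarith) har
    have e1 : -δ + (δ - α - 1) + 1 = -α := by ring
    have e2 : -δ + 1 = 1 - δ := by ring
    have e3 : δ - α - 1 + 1 = δ - α := by ring
    rw [e1, e2, e3] at e
    rw [← e, ← intervalIntegral.integral_const_mul, intervalIntegral.integral_of_le har.le,
      integral_Ioc_eq_integral_Ioo, intervalIntegral.integral_of_le har.le,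
      integral_Ioc_eq_integral_Ioo]
    have hi := (intervalIntegrable_beta (x := -δ) (y := δ - α - 1) (by linarith) (by linarith)
      har.le).const_mul k
    rw [intervalIntegrable_iff_integrableOn_Ioo_of_le har.le] at hi
    refine norm_integral_le_of_norm_le hi ?_
    filter_upwards [ae_restrict_mem measurableSet_Ioo] with q hq
    exact weylLeft_integrand_bound hk hq
  have hp : 0 < (r - a) ^ (-α) := Real.rpow_pos_of_pos h _
  rw [weylLeft, norm_smul, norm_inv, Real.norm_of_nonneg hΓ.le, weylConst, mul_assoc, mul_assoc]
  refine mul_le_mul_of_nonneg_left ?_ (by positivity)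
  refine (norm_add_le _ _).trans ?_
  rw [norm_smul, norm_smul, norm_inv, Real.norm_of_nonneg (Real.rpow_nonneg h.le _),
    ← Real.rpow_neg h.le, Real.norm_of_nonneg hα.le]
  have h1 : (r - a) ^ (-α) * ‖Z r‖ ≤ (r - a) ^ (-α) * m := by gcongr
  have h2 := mul_le_mul_of_nonneg_left hint hα.le
  have h3 : 0 ≤ k * (r - a) ^ (-α) := by positivity
  have h4 : 0 ≤ α * ProbabilityTheory.beta (1 - δ) (δ - α) * m * (r - a) ^ (-α) := by positivity
  -- The products in $(1+\alpha B)(m+k)$ that do not occur on the left are dropped; `h3` and `h4`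
  -- say that they are nonnegative.
  nlinarith

/-- After reflection both the value and the increment constant are $H(b-r)^\theta$, whence the
factor $2$. The derivative of order $\gamma$ thus vanishes at $b$ to order $\theta-\gamma$, and this
is what absorbs singular integrands. -/
lemma norm_weylRight_le {γ θ H a b : ℝ} {w : ℝ → E} (h : HolderBoundOn θ H a b w)
    (hγ : 0 < γ) (hγθ : γ < θ) (hθ : θ < 1) {r : ℝ} (hr : r ∈ Ico a b) :
    ‖weylRight γ b w r‖ ≤ 2 * weylConst γ θ * H * (b - r) ^ (θ - γ) := by
  have p : 0 < b - r := sub_pos.2 hr.2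
  rw [weylRight_eq_weylLeft]
  have h' := h.reflect (w b)
  have hm : ‖w (- -r) - w b‖ ≤ H * (b - r) ^ θ := by
    rw [neg_neg]
    have := h b ⟨hr.1.trans hr.2.le, le_rfl⟩ r ⟨hr.1, hr.2.le⟩
    rwa [abs_sub_comm, abs_of_pos p] at this
  refine (norm_weylLeft_le (a := -b) (r := -r) (k := H * (-r - -b) ^ θ) hγ hγθ hθ
    (neg_lt_neg hr.2) hm
    fun q hq => h'.weighted (hγ.trans hγθ).le hq (neg_le_neg hr.1)).trans (le_of_eq ?_)
  have e : -r - -b = b - r := by ring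
  rw [e, sub_eq_add_neg θ γ, Real.rpow_add p]
  ring

lemma weylRight_intervalIntegrable {γ θ H a b : ℝ} {w : ℝ → E} (h : HolderBoundOn θ H a b w)
    (hγ : 0 < γ) (hγθ : γ < θ) (hθ : θ < 1) {r : ℝ} (hr : r ∈ Ico a b) :
    IntervalIntegrable (fun q => ((q - r) ^ (1 + γ))⁻¹ • (w r - w q)) volume r b := by
  have h' := (h.mono hr.1 le_rfl).reflect (w b)
  have hθ0 : 0 < θ := hγ.trans hγθ
  have := weylLeft_intervalIntegrable (α := γ) (δ := θ) (Z := fun x => w (-x) - w b)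
    (k := H * (-r - -b) ^ θ) hγθ hθ (neg_le_neg hr.2.le)
    ((h'.continuousOn hθ0).mono Ioo_subset_Icc_self) fun q hq => h'.weighted hθ0.le hq le_rfl
  rw [IntervalIntegrable.iff_comp_neg] at this
  simp only [neg_neg] at this
  refine this.symm.congr_uIoo fun q _ => ?_
  simp only [sub_sub_sub_cancel_right, neg_add_eq_sub, sub_neg_eq_add]

end Weyl

/-! ## Integrands with weighted Hölder bounds -/

section SingularHolder

variable {E : Type*} [NormedAddCommGroup E]

/-- `Z` is bounded and Hölder continuous on `(a, b)` up to weights that are singular at the end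
points. -/
structure SingularHolder (δ γ κ a b M K : ℝ) (Z : ℝ → E) : Prop where
  norm_le : ∀ r ∈ Ioo a b, ‖Z r‖ ≤ M * (b - r) ^ (-γ)
  sub_le : ∀ q r, a < q → q < r → r < b →
    ‖Z r - Z q‖ ≤ K * (b - r) ^ (-κ) * ((r - q) ^ δ * (q - a) ^ (-δ))

variable {δ γ κ a b M K : ℝ} {Z : ℝ → E}

lemma SingularHolder.nonneg_left (h : SingularHolder δ γ κ a b M K Z) (hab : a < b) : 0 ≤ M := by
  have hr : (a + b) / 2 ∈ Ioo a b := ⟨by linarith, by linarith⟩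
  exact nonneg_of_mul_nonneg_left ((norm_nonneg _).trans (h.norm_le _ hr))
    (Real.rpow_pos_of_pos (sub_pos.2 hr.2) _)

lemma SingularHolder.nonneg_right (h : SingularHolder δ γ κ a b M K Z) (hab : a < b) :
    0 ≤ K := by
  have h1 : a < (2 * a + b) / 3 := by linarith
  have h2 : (2 * a + b) / 3 < (a + 2 * b) / 3 := by linarith
  have h3 : (a + 2 * b) / 3 < b := by linarith
  have h4 := (norm_nonneg _).trans (h.sub_le _ _ h1 h2 h3)
  rw [mul_assoc] at h4
  refine nonneg_of_mul_nonneg_left h4 ?_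
  have := Real.rpow_pos_of_pos (sub_pos.2 h1) (-δ)
  have := Real.rpow_pos_of_pos (sub_pos.2 h2) δ
  have := Real.rpow_pos_of_pos (sub_pos.2 h3) (-κ)
  positivity

lemma SingularHolder.mono_right (h : SingularHolder δ γ κ a b M K Z) (hγ : 0 ≤ γ) (hκ : 0 ≤ κ)
    {c : ℝ} (hac : a < c) (hcb : c ≤ b) : SingularHolder δ γ κ a c M K Z := by
  have hM := h.nonneg_left (hac.trans_le hcb)
  have hK := h.nonneg_right (hac.trans_le hcb)
  refine ⟨fun r hr => (h.norm_le r ⟨hr.1, hr.2.trans_le hcb⟩).trans ?_,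
    fun q r hq hqr hr => (h.sub_le q r hq hqr (hr.trans_le hcb)).trans ?_⟩
  · exact mul_le_mul_of_nonneg_left (Real.rpow_le_rpow_of_nonpos (sub_pos.2 hr.2)
      (by linarith) (by linarith)) hM
  · have h1 : (b - r) ^ (-κ) ≤ (c - r) ^ (-κ) :=
      Real.rpow_le_rpow_of_nonpos (sub_pos.2 hr) (by linarith) (by linarith)
    have := Real.rpow_pos_of_pos (sub_pos.2 hq) (-δ)
    have := Real.rpow_pos_of_pos (sub_pos.2 hqr) δ
    gcongr

lemma SingularHolder.mono_left (h : SingularHolder δ γ κ a b M K Z) (hδ : 0 ≤ δ)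
    {c : ℝ} (hac : a ≤ c) (hcb : c < b) : SingularHolder δ γ κ c b M K Z := by
  have hK := h.nonneg_right (hac.trans_lt hcb)
  refine ⟨fun r hr => h.norm_le r ⟨hac.trans_lt hr.1, hr.2⟩,
    fun q r hq hqr hr => (h.sub_le q r (hac.trans_lt hq) hqr hr).trans ?_⟩
  have h1 : (q - a) ^ (-δ) ≤ (q - c) ^ (-δ) :=
    Real.rpow_le_rpow_of_nonpos (sub_pos.2 hq) (by linarith) (by linarith)
  have := Real.rpow_pos_of_pos (sub_pos.2 hqr) δ
  have := Real.rpow_pos_of_pos (sub_pos.2 hr) (-κ)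
  gcongr

/-- Away from the end points both weights are bounded, so the function is Hölder in the ordinary
sense. -/
lemma SingularHolder.holderBoundOn (h : SingularHolder δ γ κ a b M K Z) (hδ : 0 < δ)
    (hκ : 0 ≤ κ) {a' b' : ℝ} (ha : a < a') (hab : a' ≤ b') (hb : b' < b) :
    HolderBoundOn δ (K * (b - b') ^ (-κ) * (a' - a) ^ (-δ)) a' b' Z := by
  have hK := h.nonneg_right ((ha.trans_le hab).trans hb)
  have key : ∀ s ∈ Icc a' b', ∀ t ∈ Icc a' b', s < t →
      ‖Z t - Z s‖ ≤ K * (b - b') ^ (-κ) * (a' - a) ^ (-δ) * |t - s| ^ δ := by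
    intro s hs t ht hst
    rw [abs_of_pos (sub_pos.2 hst)]
    refine (h.sub_le s t (ha.trans_le hs.1) hst (ht.2.trans_lt hb)).trans ?_
    have h1 : (b - t) ^ (-κ) ≤ (b - b') ^ (-κ) :=
      Real.rpow_le_rpow_of_nonpos (sub_pos.2 hb) (by linarith [ht.2]) (by linarith)
    have h2 : (s - a) ^ (-δ) ≤ (a' - a) ^ (-δ) :=
      Real.rpow_le_rpow_of_nonpos (sub_pos.2 ha) (by linarith [hs.1]) (by linarith)
    have h3 := Real.rpow_pos_of_pos (sub_pos.2 hst) δ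
    have h4 := Real.rpow_pos_of_pos (sub_pos.2 hb) (-κ)
    have h5 := Real.rpow_pos_of_pos (sub_pos.2 (ha.trans_le hs.1)) (-δ)
    calc K * (b - t) ^ (-κ) * ((t - s) ^ δ * (s - a) ^ (-δ))
        ≤ K * (b - b') ^ (-κ) * ((t - s) ^ δ * (a' - a) ^ (-δ)) := by gcongr
      _ = _ := by ring
  intro s hs t ht
  rcases lt_trichotomy s t with hst | rfl | hst
  · exact key s hs t ht hst
  · simp [Real.zero_rpow hδ.ne']
  · rw [norm_sub_rev, abs_sub_comm]
    exact key t ht s hs hst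

lemma SingularHolder.continuousOn (h : SingularHolder δ γ κ a b M K Z) (hδ : 0 < δ)
    (hκ : 0 ≤ κ) : ContinuousOn Z (Ioo a b) := by
  intro r hr
  have h1 : a < (a + r) / 2 := by linarith [hr.1]
  have h2 : (a + r) / 2 < r := by linarith [hr.1]
  have h3 : r < (b + r) / 2 := by linarith [hr.2]
  have h4 : (b + r) / 2 < b := by linarith [hr.2]
  have := (h.holderBoundOn hδ hκ h1 (h2.trans h3).le h4).continuousOn hδ
  exact (this.continuousAt (Icc_mem_nhds h2 h3)).continuousWithinAt

lemma SingularHolder.weylLeft_bound (h : SingularHolder δ γ κ a b M K Z) [NormedSpace ℝ E]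
    {α : ℝ} (hα : 0 < α) (hαδ : α < δ) (hδ : δ < 1) {r : ℝ} (hr : r ∈ Ioo a b) :
    ‖weylLeft α a Z r‖
      ≤ weylConst α δ * (M * (b - r) ^ (-γ) + K * (b - r) ^ (-κ)) * (r - a) ^ (-α) :=
  norm_weylLeft_le hα hαδ hδ hr.1 (h.norm_le r hr) fun q hq => h.sub_le q r hq.1 hq.2 hr.2

end SingularHolder

/-- The exponents for which the integral of a weighted Hölder function is well defined. -/
structure Admissible (α δ θ γ κ : ℝ) : Prop where
  α_pos : 0 < α
  α_lt : α < δ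
  δ_lt : δ < 1
  θ_gt : 1 - α < θ
  θ_lt : θ < 1
  γ_nonneg : 0 ≤ γ
  γ_lt : γ < θ + α
  κ_nonneg : 0 ≤ κ
  κ_lt : κ < θ + α

/-! ### Estimates of the integral for singular Hölder integrands -/

section HS

variable {V : Type*} [NormedAddCommGroup V] [InnerProductSpace ℝ V] [CompleteSpace V]

/-- Evaluation of Hilbert-Schmidt operators as a bounded bilinear map. -/
noncomputable def HS.evalL : HS V →L[ℝ] V →L[ℝ] V :=
  LinearMap.mkContinuous₂
    (LinearMap.mk₂ ℝ (fun (T : HS V) v => T v) (fun _ _ _ => rfl) (fun _ _ _ => rfl)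
      (fun T => T.toCLM.map_add) (fun c T v => T.toCLM.map_smul c v)) 1
    (fun T v => (T.norm_apply_le v).trans_eq (by rw [one_mul]))

@[simp] lemma HS.evalL_apply (T : HS V) (v : V) : HS.evalL T v = T v := rfl

lemma HS.norm_compLeft_le (L : V →L[ℝ] V) (T : HS V) : ‖T.compLeft L‖ ≤ ‖L‖ * ‖T‖ := by
  refine le_of_sq_le_sq ?_ (by positivity)
  rw [mul_pow]
  refine hasSum_le (fun i => ?_) ((T.compLeft L).hasSum_norm_sq (fixedBasis V))
    ((T.hasSum_norm_sq (fixedBasis V)).mul_left (‖L‖ ^ 2))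
  rw [← mul_pow, HS.compLeft_apply]
  gcongr
  exact L.le_opNorm _

/-- Composition with a bounded operator as a bounded operator on the Hilbert-Schmidt operators. -/
noncomputable def HS.compLeftL (L : V →L[ℝ] V) : HS V →L[ℝ] HS V :=
  LinearMap.mkContinuous
    { toFun := HS.compLeft L
      map_add' := fun _ _ => Subtype.ext (ContinuousLinearMap.ext fun _ => L.map_add _ _)
      map_smul' := fun _ _ => Subtype.ext (ContinuousLinearMap.ext fun _ => L.map_smul _ _) }
    ‖L‖ (HS.norm_compLeft_le L)

lemma HS.compLeftL_apply (L : V →L[ℝ] V) (T : HS V) : HS.compLeftL L T = T.compLeft L := rfl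

lemma HS.compLeft_sub_right (L : V →L[ℝ] V) (T T' : HS V) :
    (T - T').compLeft L = T.compLeft L - T'.compLeft L :=
  (HS.compLeftL L).map_sub T T'

lemma HS.compLeft_sub_left (L L' : V →L[ℝ] V) (T : HS V) :
    T.compLeft (L - L') = T.compLeft L - T.compLeft L' := rfl

lemma HS.compLeft_compLeft (L L' : V →L[ℝ] V) (T : HS V) :
    (T.compLeft L').compLeft L = T.compLeft (L ∘L L') := rfl

variable {α δ θ γ κ a b M K H : ℝ} {Z Z' : ℝ → HS V} {w : ℝ → V}

/-- The bound is stated in the distance to $b$ although the path is differentiated up to $b'\le b$.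
One integrable function therefore dominates all integrals with right end point $b'$. -/
lemma SingularHolder.product_bound_of_le (h : SingularHolder δ γ κ a b M K Z)
    (hw : HolderBoundOn θ H a b w) (he : Admissible α δ θ γ κ) {b' : ℝ} (hb : b' ≤ b) {r : ℝ}
    (hr : r ∈ Ioo a b') :
    ‖weylLeft α a Z r‖ * ‖weylRight (1 - α) b' w r‖
      ≤ weylConst α δ * (2 * weylConst (1 - α) θ * H)
        * (M * ((r - a) ^ (-α) * (b - r) ^ (θ + α - 1 - γ))
          + K * ((r - a) ^ (-α) * (b - r) ^ (θ + α - 1 - κ))) := by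
  have hα : 0 < 1 - α := by linarith [he.α_lt, he.δ_lt]
  have hrb : r < b := hr.2.trans_le hb
  have h1 := h.weylLeft_bound he.α_pos he.α_lt he.δ_lt ⟨hr.1, hrb⟩
  have h2 := norm_weylRight_le (hw.mono le_rfl hb) hα he.θ_gt he.θ_lt (Ioo_subset_Ico_self hr)
  have h3 : (b' - r) ^ (θ - (1 - α)) ≤ (b - r) ^ (θ - (1 - α)) :=
    Real.rpow_le_rpow (sub_pos.2 hr.2).le (by linarith) (sub_pos.2 he.θ_gt).le
  have hH := hw.nonneg (hr.1.trans hrb)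
  have hc := weylConst_pos hα he.θ_gt he.θ_lt
  have p : 0 < b - r := sub_pos.2 hrb
  refine (mul_le_mul h1 (h2.trans (mul_le_mul_of_nonneg_left h3 (by positivity)))
    (norm_nonneg _) ((norm_nonneg _).trans h1)).trans (le_of_eq ?_)
  have e1 : θ + α - 1 - γ = -γ + (θ - (1 - α)) := by ring
  have e2 : θ + α - 1 - κ = -κ + (θ - (1 - α)) := by ring
  rw [e1, e2, Real.rpow_add p, Real.rpow_add p]
  ring

lemma SingularHolder.product_bound (h : SingularHolder δ γ κ a b M K Z)
    (hw : HolderBoundOn θ H a b w) (he : Admissible α δ θ γ κ) {r : ℝ} (hr : r ∈ Ioo a b) :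
    ‖weylLeft α a Z r‖ * ‖weylRight (1 - α) b w r‖
      ≤ weylConst α δ * (2 * weylConst (1 - α) θ * H)
        * (M * ((r - a) ^ (-α) * (b - r) ^ (θ + α - 1 - γ))
          + K * ((r - a) ^ (-α) * (b - r) ^ (θ + α - 1 - κ))) :=
  h.product_bound_of_le hw he le_rfl hr

lemma product_bound_intervalIntegrable (he : Admissible α δ θ γ κ) (hab : a ≤ b) (c M K : ℝ) :
    IntervalIntegrable (fun r => c * (M * ((r - a) ^ (-α) * (b - r) ^ (θ + α - 1 - γ))
          + K * ((r - a) ^ (-α) * (b - r) ^ (θ + α - 1 - κ)))) volume a b := by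
  have := he.α_lt; have := he.δ_lt; have := he.γ_lt; have := he.κ_lt
  exact (((intervalIntegrable_beta (by linarith) (by linarith) hab).const_mul M).add
    ((intervalIntegrable_beta (by linarith) (by linarith) hab).const_mul K)).const_mul c

lemma SingularHolder.hasFracIntegral (h : SingularHolder δ γ κ a b M K Z)
    (hw : HolderBoundOn θ H a b w) (he : Admissible α δ θ γ κ) (hab : a < b) :
    HasFracIntegral α a b Z w := by
  have hδ := he.α_pos.trans he.α_lt
  have hα : 0 < 1 - α := by linarith [he.α_lt, he.δ_lt]
  have hZ := h.continuousOn hδ he.κ_nonneg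
  have hl := aestronglyMeasurable_weylLeft (α := α) hZ
  have hr := aestronglyMeasurable_weylRight (γ := 1 - α)
    ((hw.continuousOn (hα.trans he.θ_gt)).mono Ioo_subset_Icc_self)
  refine ⟨fun r hr => ?_, fun r hr => ?_, hl, hr, ?_⟩
  · exact weylLeft_intervalIntegrable he.α_lt he.δ_lt hr.1.le
      (hZ.mono (Ioo_subset_Ioo le_rfl hr.2.le)) fun q hq => h.sub_le q r hq.1 hq.2 hr.2
  · exact weylRight_intervalIntegrable hw hα he.θ_gt he.θ_lt (Ioo_subset_Ico_self hr)
  · have hi := product_bound_intervalIntegrable he hab.le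
      (weylConst α δ * (2 * weylConst (1 - α) θ * H)) M K
    rw [intervalIntegrable_iff_integrableOn_Ioo_of_le hab.le] at hi ⊢
    refine hi.mono' (hl.norm.mul hr.norm) ?_
    filter_upwards [ae_restrict_mem measurableSet_Ioo] with r hr
    rw [Real.norm_of_nonneg (by positivity)]
    exact h.product_bound hw he hr

lemma hasFracIntegral_self (α a : ℝ) (Z : ℝ → HS V) (w : ℝ → V) : HasFracIntegral α a a Z w :=
  ⟨by simp, by simp, by simp, by simp, IntervalIntegrable.refl⟩

lemma HasFracIntegral.intervalIntegrable (h : HasFracIntegral α a b Z w) (hab : a ≤ b) :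
    IntervalIntegrable (fun r => weylLeft α a Z r (weylRight (1 - α) b w r)) volume a b := by
  have hi := h.integrable
  rw [intervalIntegrable_iff_integrableOn_Ioo_of_le hab] at hi ⊢
  refine hi.mono' (HS.evalL.aestronglyMeasurable_comp₂ h.left_measurable h.right_measurable)
    (.of_forall fun r => HS.norm_apply_le _ _)

/-- The constant in the bound of the integral of a weighted Hölder function. -/
noncomputable def fracConst (α δ θ γ κ : ℝ) : ℝ :=
  weylConst α δ * (2 * weylConst (1 - α) θ)
    * (ProbabilityTheory.beta (1 - α) (θ + α - γ) + ProbabilityTheory.beta (1 - α) (θ + α - κ))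

lemma fracConst_pos (he : Admissible α δ θ γ κ) : 0 < fracConst α δ θ γ κ := by
  have hα : 0 < 1 - α := by linarith [he.α_lt, he.δ_lt]
  have := weylConst_pos he.α_pos he.α_lt he.δ_lt
  have := weylConst_pos hα he.θ_gt he.θ_lt
  have := ProbabilityTheory.beta_pos hα (sub_pos.2 he.γ_lt)
  have := ProbabilityTheory.beta_pos hα (sub_pos.2 he.κ_lt)
  unfold fracConst
  positivity

/-- The singularities $(r-a)^{-\alpha}$ and $(b-r)^{\theta+\alpha-1-\gamma}$ combine to a Beta
integral in which $\alpha$ cancels, leaving $(b-a)^{\theta-\gamma}$, and likewise for $\kappa$. -/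
lemma SingularHolder.norm_fracIntegral_le (h : SingularHolder δ γ κ a b M K Z)
    (hw : HolderBoundOn θ H a b w) (he : Admissible α δ θ γ κ) (hab : a < b) :
    ‖fracIntegral α a b Z w‖
      ≤ fracConst α δ θ γ κ * H * (M * (b - a) ^ (θ - γ) + K * (b - a) ^ (θ - κ)) := by
  have hα : 0 < 1 - α := by linarith [he.α_lt, he.δ_lt]
  have hM := h.nonneg_left hab
  have hK := h.nonneg_right hab
  have hH := hw.nonneg hab
  have hi := product_bound_intervalIntegrable he hab.le
      (weylConst α δ * (2 * weylConst (1 - α) θ * H)) M K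
  have h1 : ‖fracIntegral α a b Z w‖ ≤ ∫ r in a..b,
      weylConst α δ * (2 * weylConst (1 - α) θ * H)
        * (M * ((r - a) ^ (-α) * (b - r) ^ (θ + α - 1 - γ))
          + K * ((r - a) ^ (-α) * (b - r) ^ (θ + α - 1 - κ))) := by
    rw [intervalIntegrable_iff_integrableOn_Ioo_of_le hab.le] at hi
    rw [fracIntegral, norm_neg, intervalIntegral.integral_of_le hab.le,
      intervalIntegral.integral_of_le hab.le, integral_Ioc_eq_integral_Ioo,
      integral_Ioc_eq_integral_Ioo]
    refine norm_integral_le_of_norm_le hi ?_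
    filter_upwards [ae_restrict_mem measurableSet_Ioo] with r hr
    exact (HS.norm_apply_le _ _).trans (h.product_bound hw he hr)
  refine h1.trans ?_
  have := he.γ_lt; have := he.κ_lt
  rw [intervalIntegral.integral_const_mul, intervalIntegral.integral_add
    ((intervalIntegrable_beta (by linarith) (by linarith) hab.le).const_mul M)
    ((intervalIntegrable_beta (by linarith) (by linarith) hab.le).const_mul K),
    intervalIntegral.integral_const_mul, intervalIntegral.integral_const_mul,
    integral_beta (by linarith) (by linarith) hab, integral_beta (by linarith) (by linarith) hab]
  have e1 : -α + (θ + α - 1 - γ) + 1 = θ - γ := by ring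
  have e2 : -α + (θ + α - 1 - κ) + 1 = θ - κ := by ring
  have e3 : -α + 1 = 1 - α := by ring
  have e4 : θ + α - 1 - γ + 1 = θ + α - γ := by ring
  have e5 : θ + α - 1 - κ + 1 = θ + α - κ := by ring
  rw [e1, e2, e3, e4, e5, fracConst]
  have c1 := weylConst_pos he.α_pos he.α_lt he.δ_lt
  have c2 := weylConst_pos hα he.θ_gt he.θ_lt
  have b1 := ProbabilityTheory.beta_pos hα (sub_pos.2 he.γ_lt)
  have b2 := ProbabilityTheory.beta_pos hα (sub_pos.2 he.κ_lt)
  have p1 := Real.rpow_pos_of_pos (sub_pos.2 hab) (θ - γ)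
  have p2 := Real.rpow_pos_of_pos (sub_pos.2 hab) (θ - κ)
  generalize ProbabilityTheory.beta (1 - α) (θ + α - γ) = B₁ at *
  generalize ProbabilityTheory.beta (1 - α) (θ + α - κ) = B₂ at *
  calc _ = weylConst α δ * (2 * weylConst (1 - α) θ) * H
        * (B₁ * (M * (b - a) ^ (θ - γ)) + B₂ * (K * (b - a) ^ (θ - κ))) := by ring
    _ ≤ weylConst α δ * (2 * weylConst (1 - α) θ) * H
        * ((B₁ + B₂) * (M * (b - a) ^ (θ - γ)) + (B₁ + B₂) * (K * (b - a) ^ (θ - κ))) := by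
        gcongr <;> linarith
    _ = _ := by ring

/-! ## Algebraic properties of the integral -/

lemma fracIntegral_self (α a : ℝ) (Z : ℝ → HS V) (w : ℝ → V) : fracIntegral α a a Z w = 0 := by
  simp [fracIntegral]

lemma HasFracIntegral.congr (h : HasFracIntegral α a b Z w) (hab : a ≤ b)
    (hZ : EqOn Z Z' (Ioo a b)) : HasFracIntegral α a b Z' w := by
  have hW := weylLeft_congr (α := α) hZ
  refine ⟨fun r hr => (h.left_integrable r hr).congr_uIoo fun q hq => ?_, h.right_integrable,
    h.left_measurable.congr ?_, h.right_measurable, h.integrable.congr_uIoo fun r hr => ?_⟩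
  · rw [uIoo_of_le hr.1.le] at hq
    simp only [hZ hr, hZ ⟨hq.1, hq.2.trans hr.2⟩]
  · filter_upwards [ae_restrict_mem measurableSet_Ioo] with r hr using hW hr
  · rw [uIoo_of_le hab] at hr
    simp only [hW hr]

lemma fracIntegral_congr (hab : a ≤ b) (hZ : EqOn Z Z' (Ioo a b)) :
    fracIntegral α a b Z w = fracIntegral α a b Z' w := by
  rw [fracIntegral, fracIntegral]
  congr 1
  refine intervalIntegral.integral_congr_uIoo fun r hr => ?_
  rw [uIoo_of_le hab] at hr
  simp only [weylLeft_congr hZ hr]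

lemma fracIntegral_congr_right {w' : ℝ → V} (hab : a ≤ b) (hw : EqOn w w' (Ioc a b)) :
    fracIntegral α a b Z w = fracIntegral α a b Z w' := by
  rw [fracIntegral, fracIntegral]
  congr 1
  refine intervalIntegral.integral_congr_uIoo fun r hr => ?_
  rw [uIoo_of_le hab] at hr
  have : weylRight (1 - α) b w r = weylRight (1 - α) b w' r := by
    simp only [weylRight, hw (Ioo_subset_Ioc_self hr), hw ⟨hr.1.trans hr.2, le_rfl⟩]
    congr 3
    refine intervalIntegral.integral_congr_uIoo fun q hq => ?_
    rw [uIoo_of_le hr.2.le] at hq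
    simp only [hw ⟨hr.1.trans hq.1, hq.2.le⟩]
  simp only [this]

lemma HasFracIntegral.fracIntegral_sub (h : HasFracIntegral α a b Z w)
    (h' : HasFracIntegral α a b Z' w) (hab : a ≤ b) :
    fracIntegral α a b (fun r => Z r - Z' r) w
      = fracIntegral α a b Z w - fracIntegral α a b Z' w := by
  rw [fracIntegral, fracIntegral, fracIntegral, ← neg_sub', ← intervalIntegral.integral_sub
    (h.intervalIntegrable hab) (h'.intervalIntegrable hab)]
  congr 1
  refine intervalIntegral.integral_congr_uIoo fun r hr => ?_
  rw [uIoo_of_le hab] at hr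
  have : weylLeft α a (fun r => Z r - Z' r) r = weylLeft α a Z r - weylLeft α a Z' r := by
    have e := intervalIntegral.integral_sub (h.left_integrable r hr) (h'.left_integrable r hr)
    simp only [← smul_sub] at e
    simp only [weylLeft, ← smul_sub, add_sub_add_comm, ← e]
    simp only [sub_sub_sub_comm]
  simp only [this]
  rfl

lemma HasFracIntegral.fracIntegral_compLeft (h : HasFracIntegral α a b Z w) (hab : a ≤ b)
    (L : V →L[ℝ] V) :
    fracIntegral α a b (fun r => (Z r).compLeft L) w = L (fracIntegral α a b Z w) := by
  rw [fracIntegral, fracIntegral, map_neg,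
    ← L.intervalIntegral_comp_comm (h.intervalIntegrable hab)]
  congr 1
  refine intervalIntegral.integral_congr_uIoo fun r hr => ?_
  rw [uIoo_of_le hab] at hr
  have : weylLeft α a (fun r => (Z r).compLeft L) r = (weylLeft α a Z r).compLeft L := by
    have e := (HS.compLeftL L).intervalIntegral_comp_comm (h.left_integrable r hr)
    simp only [map_smul, map_sub] at e
    simp only [weylLeft, ← HS.compLeftL_apply, map_smul, map_add, e]
  simp only [this]
  rfl

/-- Only increments of the path enter, so the constant $v$ drops out. This is the invariance under
Wiener shifts. -/
lemma fracIntegral_shift (α a b c : ℝ) (Z : ℝ → HS V) (w : ℝ → V) (v : V) :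
    fracIntegral α a b (fun r => Z (c + r)) (fun r => w (c + r) - v)
      = fracIntegral α (c + a) (c + b) Z w := by
  rw [fracIntegral, fracIntegral, ← intervalIntegral.integral_comp_add_left _ c]
  congr 1
  refine intervalIntegral.integral_congr fun r _ => ?_
  have h1 : weylLeft α a (fun r => Z (c + r)) r = weylLeft α (c + a) Z (c + r) := by
    have e := intervalIntegral.integral_comp_add_left (a := a) (b := r)
      (fun q => ((c + r - q) ^ (1 + α))⁻¹ • (Z (c + r) - Z q)) c
    simp only [weylLeft, ← e, add_sub_add_left_eq_sub]
  have h2 : weylRight (1 - α) b (fun r => w (c + r) - v) r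
      = weylRight (1 - α) (c + b) w (c + r) := by
    have e := intervalIntegral.integral_comp_add_left (a := r) (b := b)
      (fun q => ((q - (c + r)) ^ (1 + (1 - α)))⁻¹ • (w (c + r) - w q)) c
    simp only [weylRight, ← e, add_sub_add_left_eq_sub, sub_sub_sub_cancel_right]
  simp only [h1, h2]

end HS

/-! ## Fubini on a triangle -/

section Fubini

variable {E : Type*} [NormedAddCommGroup E] [NormedSpace ℝ E]

lemma isOpen_triangle (a b : ℝ) : IsOpen {p : ℝ × ℝ | a < p.1 ∧ p.1 < p.2 ∧ p.2 < b} :=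
  (isOpen_lt continuous_const continuous_fst).inter
    ((isOpen_lt continuous_fst continuous_snd).inter (isOpen_lt continuous_snd continuous_const))

lemma integral_triangle_swap {a b : ℝ} (hab : a ≤ b) {F : ℝ × ℝ → E} {G : ℝ × ℝ → ℝ}
    (hF : AEStronglyMeasurable F
      ((volume.prod volume).restrict {p : ℝ × ℝ | a < p.1 ∧ p.1 < p.2 ∧ p.2 < b}))
    (hG : Integrable G (volume.prod volume))
    (hFG : ∀ p : ℝ × ℝ, a < p.1 → p.1 < p.2 → p.2 < b → ‖F p‖ ≤ G p) :
    IntervalIntegrable (fun q => ∫ r in a..q, F (r, q)) volume a b ∧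
      ∫ r in a..b, ∫ q in r..b, F (r, q) = ∫ q in a..b, ∫ r in a..q, F (r, q) := by
  set D : Set (ℝ × ℝ) := {p | a < p.1 ∧ p.1 < p.2 ∧ p.2 < b} with hD
  have hDm : MeasurableSet D := (isOpen_triangle a b).measurableSet
  have hi : Integrable (D.indicator F) (volume.prod volume) := by
    rw [integrable_indicator_iff hDm]
    refine hG.integrableOn.mono' hF ?_
    filter_upwards [ae_restrict_mem hDm] with p hp
    exact hFG p hp.1 hp.2.1 hp.2.2
  have h := integral_integral_swap (f := fun r q => D.indicator F (r, q)) hi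
  have e1 : ∀ r, ∫ q, D.indicator F (r, q)
      = (Ioo a b).indicator (fun r => ∫ q in r..b, F (r, q)) r := by
    intro r
    by_cases hr : r ∈ Ioo a b
    · rw [indicator_of_mem hr, intervalIntegral.integral_of_le hr.2.le,
        integral_Ioc_eq_integral_Ioo, ← integral_indicator measurableSet_Ioo]
      refine integral_congr_ae (.of_forall fun q => ?_)
      by_cases hq : q ∈ Ioo r b
      · have : (r, q) ∈ D := ⟨hr.1, hq.1, hq.2⟩
        simp [this, hq]
      · have : (r, q) ∉ D := fun h => hq ⟨h.2.1, h.2.2⟩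
        simp [this, hq]
    · rw [indicator_of_notMem hr]
      refine integral_eq_zero_of_ae (.of_forall fun q => ?_)
      have : (r, q) ∉ D := fun h => hr ⟨h.1, h.2.1.trans h.2.2⟩
      simp [this]
  have e2 : ∀ q, ∫ r, D.indicator F (r, q)
      = (Ioo a b).indicator (fun q => ∫ r in a..q, F (r, q)) q := by
    intro q
    by_cases hq : q ∈ Ioo a b
    · rw [indicator_of_mem hq, intervalIntegral.integral_of_le hq.1.le,
        integral_Ioc_eq_integral_Ioo, ← integral_indicator measurableSet_Ioo]
      refine integral_congr_ae (.of_forall fun r => ?_)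
      by_cases hr : r ∈ Ioo a q
      · have : (r, q) ∈ D := ⟨hr.1, hr.2, hq.2⟩
        simp [this, hr]
      · have : (r, q) ∉ D := fun h => hr ⟨h.1, h.2.1⟩
        simp [this, hr]
    · rw [indicator_of_notMem hq]
      refine integral_eq_zero_of_ae (.of_forall fun r => ?_)
      have : (r, q) ∉ D := fun h => hq ⟨h.1.trans h.2.1, h.2.2⟩
      simp [this]
  simp only [e1, e2] at h
  refine ⟨?_, ?_⟩
  · have h2 := hi.integral_prod_right
    simp only [e2] at h2
    rwa [integrable_indicator_iff measurableSet_Ioo,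
      ← intervalIntegrable_iff_integrableOn_Ioo_of_le hab] at h2
  rwa [integral_indicator measurableSet_Ioo, integral_indicator measurableSet_Ioo,
    ← integral_Ioc_eq_integral_Ioo, ← integral_Ioc_eq_integral_Ioo,
    ← intervalIntegral.integral_of_le hab, ← intervalIntegral.integral_of_le hab] at h

lemma integrableOn_rpow_sub_left {x : ℝ} (hx : -1 < x) (a b : ℝ) :
    IntegrableOn (fun r : ℝ => (r - a) ^ x) (Ioo a b) := by
  rcases le_or_gt b a with h | h
  · simp [Ioo_eq_empty (not_lt.2 h)]
  · have := intervalIntegrable_beta hx (by norm_num : (-1 : ℝ) < 0) h.le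
    rw [intervalIntegrable_iff_integrableOn_Ioo_of_le h.le] at this
    simpa using this

lemma integrableOn_rpow_sub_right {x : ℝ} (hx : -1 < x) (a b : ℝ) :
    IntegrableOn (fun r : ℝ => (b - r) ^ x) (Ioo a b) := by
  rcases le_or_gt b a with h | h
  · simp [Ioo_eq_empty (not_lt.2 h)]
  · have := intervalIntegrable_beta (by norm_num : (-1 : ℝ) < 0) hx h.le
    rw [intervalIntegrable_iff_integrableOn_Ioo_of_le h.le] at this
    simpa using this

/-- On the triangle the function is the integrand of a convolution of two integrable functions, and
such an integrand is integrable on the plane. It serves to dominate the weakly singular kernels in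
Fubini's theorem. -/
lemma exists_integrable_bound_fst {x : ℝ} (hx : -1 < x) {a b : ℝ} {p : ℝ → ℝ}
    (hp : IntegrableOn p (Ioo a b)) :
    ∃ G : ℝ × ℝ → ℝ, Integrable G (volume.prod volume) ∧
      ∀ u : ℝ × ℝ, a < u.1 → u.1 < u.2 → u.2 < b → p u.1 * (u.2 - u.1) ^ x = G u := by
  have h1 : Integrable ((Ioo a b).indicator p) := hp.integrable_indicator measurableSet_Ioo
  have h2 : Integrable ((Ioo 0 (b - a)).indicator fun s : ℝ => (s - 0) ^ x) :=
    (integrableOn_rpow_sub_left hx 0 (b - a)).integrable_indicator measurableSet_Ioo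
  refine ⟨_, (h1.convolution_integrand (ContinuousLinearMap.mul ℝ ℝ) h2).swap,
    fun u h3 h4 h5 => ?_⟩
  have m1 : u.1 ∈ Ioo a b := ⟨h3, h4.trans h5⟩
  have m2 : u.2 - u.1 ∈ Ioo 0 (b - a) := ⟨by linarith, by linarith⟩
  simp only [Function.comp, Prod.snd_swap, Prod.fst_swap, ContinuousLinearMap.mul_apply',
    indicator_of_mem m1, indicator_of_mem m2, sub_zero]

lemma exists_integrable_bound_snd {x : ℝ} (hx : -1 < x) {a b : ℝ} {p : ℝ → ℝ}
    (hp : IntegrableOn p (Ioo a b)) :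
    ∃ G : ℝ × ℝ → ℝ, Integrable G (volume.prod volume) ∧
      ∀ u : ℝ × ℝ, a < u.1 → u.1 < u.2 → u.2 < b → p u.2 * (u.2 - u.1) ^ x = G u := by
  have h1 : Integrable ((Ioo a b).indicator p) := hp.integrable_indicator measurableSet_Ioo
  have h2 : Integrable ((Ioo (-(b - a)) 0).indicator fun s : ℝ => (0 - s) ^ x) :=
    (integrableOn_rpow_sub_right hx (-(b - a)) 0).integrable_indicator measurableSet_Ioo
  refine ⟨_, (h1.convolution_integrand (ContinuousLinearMap.mul ℝ ℝ) h2),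
    fun u h3 h4 h5 => ?_⟩
  have m1 : u.2 ∈ Ioo a b := ⟨h3.trans h4, h5⟩
  have m2 : u.1 - u.2 ∈ Ioo (-(b - a)) 0 := ⟨by linarith, by linarith⟩
  simp only [ContinuousLinearMap.mul_apply', indicator_of_mem m1]
  rw [indicator_of_mem m2, zero_sub, neg_sub]

end Fubini

/-! ## Inversion of the Weyl derivative -/

section Inversion

variable {E : Type*} [NormedAddCommGroup E] [NormedSpace ℝ E] [CompleteSpace E]

lemma hasDerivAt_sub_rpow_neg (α : ℝ) {r q : ℝ} (p : 0 < r - q) :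
    HasDerivAt (fun q => (r - q) ^ (-α)) (α * ((r - q) ^ (1 + α))⁻¹) q := by
  have := ((hasDerivAt_id q).const_sub r).rpow_const (p := -α) (Or.inl p.ne')
  refine this.congr_deriv ?_
  have e : -α - 1 = -(1 + α) := by ring
  rw [id_eq, e, Real.rpow_neg p.le]
  ring

/-- Integration by parts: $\alpha(r-q)^{-1-\alpha}$ is the derivative of $(r-q)^{-\alpha}$ in $q$,
and the boundary term at $a$ changes $f(r)$ into $f(a)$. -/
lemma weylLeft_of_hasDerivAt {α a r : ℝ} (hα1 : α < 1) (har : a < r) {f f' : ℝ → E}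
    (hf : ∀ x, HasDerivAt f (f' x) x) (hf' : Continuous f') :
    weylLeft α a f r = (Real.Gamma (1 - α))⁻¹ • ((r - a) ^ (-α) • f a
      + ∫ q in a..r, (r - q) ^ (-α) • f' q) := by
  obtain ⟨C, hC⟩ := isCompact_Icc.exists_bound_of_continuousOn (s := Icc a r) hf'.continuousOn
  have hlip : ∀ q ∈ Icc a r, ‖f r - f q‖ ≤ C * (r - q) := by
    intro q hq
    have := (convex_Icc a r).norm_image_sub_le_of_norm_hasDerivWithin_le (𝕜 := ℝ)
      (fun x _ => (hf x).hasDerivWithinAt) hC hq ⟨har.le, le_rfl⟩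
    rwa [Real.norm_of_nonneg (by linarith [hq.2])] at this
  have hfc : Continuous f := continuous_iff_continuousAt.2 fun x => (hf x).continuousAt
  have hi1 : IntervalIntegrable (fun q => ((r - q) ^ (1 + α))⁻¹ • (f r - f q)) volume a r := by
    have hb := (integrableOn_rpow_sub_right (x := -α) (by linarith) a r).const_mul C
    rw [intervalIntegrable_iff_integrableOn_Ioo_of_le har.le]
    refine hb.mono' (ContinuousOn.aestronglyMeasurable ?_ measurableSet_Ioo) ?_
    · refine ContinuousOn.smul (ContinuousOn.inv₀ (ContinuousOn.rpow_const (by fun_prop) ?_) ?_)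
        (by fun_prop)
      · intro p hp; exact Or.inl (sub_pos.2 hp.2).ne'
      · intro p hp; exact (Real.rpow_pos_of_pos (sub_pos.2 hp.2) _).ne'
    · filter_upwards [ae_restrict_mem measurableSet_Ioo] with q hq
      have p : 0 < r - q := sub_pos.2 hq.2
      rw [norm_smul, norm_inv, Real.norm_of_nonneg (Real.rpow_nonneg p.le _)]
      calc ((r - q) ^ (1 + α))⁻¹ * ‖f r - f q‖ ≤ ((r - q) ^ (1 + α))⁻¹ * (C * (r - q)) := by
            gcongr
            exact hlip q (Ioo_subset_Icc_self hq)
        _ = C * (r - q) ^ (-α) := by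
            rw [Real.rpow_add p, Real.rpow_one, Real.rpow_neg p.le]
            field_simp
  have hi2 : IntervalIntegrable (fun q => (r - q) ^ (-α) • f' q) volume a r := by
    have hb := (integrableOn_rpow_sub_right (x := -α) (by linarith) a r)
    rw [← intervalIntegrable_iff_integrableOn_Ioo_of_le har.le] at hb
    exact hb.smul_continuousOn hf'.continuousOn
  have hi1' : IntervalIntegrable (fun q => α • ((r - q) ^ (1 + α))⁻¹ • (f r - f q)) volume a r :=
    hi1.smul α
  have hftc : ∫ q in a..r, (α • ((r - q) ^ (1 + α))⁻¹ • (f r - f q) - (r - q) ^ (-α) • f' q)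
      = (r - r) ^ (-α) • (f r - f r) - (r - a) ^ (-α) • (f r - f a) := by
    refine intervalIntegral.integral_eq_sub_of_hasDerivAt_of_le har.le
      (f := fun q => (r - q) ^ (-α) • (f r - f q)) ?_ ?_ (hi1'.sub hi2)
    · intro q hq
      -- At the right end the power takes a default value, but its factor $f(r)-f(q)$ vanishes
      -- there. The Lipschitz bound makes the product $O((r-q)^{1-\alpha})$, hence continuous.
      rcases hq.2.eq_or_lt with rfl | hqr
      · rw [ContinuousWithinAt, sub_self (f q), smul_zero, tendsto_zero_iff_norm_tendsto_zero]
        have hl : Tendsto (fun x : ℝ => C * (q - x) ^ (1 - α)) (𝓝[Icc a q] q) (𝓝 0) := by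
          have : Continuous fun x : ℝ => C * (q - x) ^ (1 - α) :=
            continuous_const.mul ((by fun_prop : Continuous fun x : ℝ => q - x).rpow_const
              fun _ => Or.inr (by linarith))
          have h2 := (this.tendsto q).mono_left (nhdsWithin_le_nhds (s := Icc a q))
          simpa [Real.zero_rpow (by linarith : (1 : ℝ) - α ≠ 0)] using h2
        refine squeeze_zero' (.of_forall fun _ => norm_nonneg _) ?_ hl
        filter_upwards [self_mem_nhdsWithin] with x hx
        rcases hx.2.eq_or_lt with rfl | hxq
        · simp [Real.zero_rpow (by linarith : (1 : ℝ) - α ≠ 0)]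
        · have p : 0 < q - x := sub_pos.2 hxq
          rw [norm_smul, Real.norm_of_nonneg (Real.rpow_nonneg p.le _)]
          calc (q - x) ^ (-α) * ‖f q - f x‖ ≤ (q - x) ^ (-α) * (C * (q - x)) := by
                gcongr
                exact hlip x hx
            _ = C * (q - x) ^ (1 - α) := by
                rw [sub_eq_add_neg 1 α, Real.rpow_add p, Real.rpow_one]; ring
      · refine ContinuousAt.continuousWithinAt (ContinuousAt.smul
          (ContinuousAt.rpow_const (by fun_prop) (Or.inl (sub_pos.2 hqr).ne')) (by fun_prop))
    · intro q hq
      have p : 0 < r - q := sub_pos.2 hq.2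
      have := (hasDerivAt_sub_rpow_neg α p).smul ((hf q).const_sub (f r))
      refine this.congr_deriv ?_
      rw [smul_neg, mul_smul]
      abel
  rw [sub_self (f r), smul_zero, zero_sub, intervalIntegral.integral_sub hi1' hi2,
    intervalIntegral.integral_smul] at hftc
  rw [weylLeft, ← Real.rpow_neg (by linarith), eq_add_of_sub_eq hftc, smul_sub]
  congr 1
  abel

lemma integral_beta_kernel {α a b : ℝ} (hα : 0 < α) (hα1 : α < 1) (hab : a < b) :
    ∫ r in a..b, (r - a) ^ (-α) * (b - r) ^ (α - 1) = Real.Gamma (1 - α) * Real.Gamma α := by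
  rw [integral_beta (by linarith) (by linarith) hab]
  have e1 : -α + (α - 1) + 1 = 0 := by ring
  have e2 : -α + 1 = 1 - α := by ring
  rw [e1, e2, ProbabilityTheory.beta]
  simp

/-- The fractional integral of order $\alpha$ inverts the Weyl derivative. After Fubini the inner
integral $\int_q^s(r-q)^{-\alpha}(s-r)^{\alpha-1}dr=\Gamma(1-\alpha)\Gamma(\alpha)$ does not depend
on $q$, and $f(a)+\int_a^sf'=f(s)$ remains. -/
lemma integral_weylLeft_of_hasDerivAt {α a s : ℝ} (hα : 0 < α) (hα1 : α < 1) (has : a < s)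
    {f f' : ℝ → E} (hf : ∀ x, HasDerivAt f (f' x) x) (hf' : Continuous f') :
    ∫ r in a..s, (s - r) ^ (α - 1) • weylLeft α a f r = Real.Gamma α • f s := by
  have hΓ := (Real.Gamma_pos_of_pos (s := 1 - α) (by linarith)).ne'
  obtain ⟨C, hC⟩ := isCompact_Icc.exists_bound_of_continuousOn (s := Icc a s) hf'.continuousOn
  obtain ⟨G, hG, hG2⟩ := exists_integrable_bound_snd (x := -α) (by linarith)
    ((integrableOn_rpow_sub_right (x := α - 1) (by linarith) a s).const_mul C)
  obtain ⟨hi2, hsw⟩ := integral_triangle_swap has.le (G := G)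
    (F := fun p : ℝ × ℝ => ((p.2 - p.1) ^ (-α) * (s - p.2) ^ (α - 1)) • f' p.1) (by
      refine ContinuousOn.aestronglyMeasurable ?_ (isOpen_triangle a s).measurableSet
      refine ContinuousOn.smul (ContinuousOn.mul ?_ ?_) (by fun_prop)
      · exact ContinuousOn.rpow_const (by fun_prop) fun p hp => Or.inl (sub_pos.2 hp.2.1).ne'
      · exact ContinuousOn.rpow_const (by fun_prop) fun p hp => Or.inl (sub_pos.2 hp.2.2).ne')
    hG (fun p h1 h2 h3 => by
      rw [← hG2 p h1 h2 h3, norm_smul, Real.norm_of_nonneg (mul_nonneg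
        (Real.rpow_nonneg (sub_pos.2 h2).le _) (Real.rpow_nonneg (sub_pos.2 h3).le _))]
      have := hC p.1 ⟨h1.le, (h2.trans h3).le⟩
      have := Real.rpow_nonneg (sub_pos.2 h2).le (-α)
      have := Real.rpow_nonneg (sub_pos.2 h3).le (α - 1)
      calc _ ≤ (p.2 - p.1) ^ (-α) * (s - p.2) ^ (α - 1) * C := by gcongr
        _ = _ := by ring)
  have hL : ∫ q in a..s, ∫ r in q..s, ((r - q) ^ (-α) * (s - r) ^ (α - 1)) • f' q
      = (Real.Gamma (1 - α) * Real.Gamma α) • (f s - f a) := by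
    have : ∀ q ∈ Ioo a s, ∫ r in q..s, ((r - q) ^ (-α) * (s - r) ^ (α - 1)) • f' q
        = (Real.Gamma (1 - α) * Real.Gamma α) • f' q := by
      intro q hq
      rw [intervalIntegral.integral_smul_const, integral_beta_kernel hα hα1 hq.2]
    rw [intervalIntegral.integral_congr_uIoo (g := fun q =>
        (Real.Gamma (1 - α) * Real.Gamma α) • f' q) (by rwa [uIoo_of_le has.le]),
      intervalIntegral.integral_smul, intervalIntegral.integral_eq_sub_of_hasDerivAt
        (fun x _ => hf x) (hf'.intervalIntegrable _ _)]
  have hi1 : IntervalIntegrable (fun r => ((r - a) ^ (-α) * (s - r) ^ (α - 1)) • f a) volume a s :=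
    (intervalIntegrable_beta (by linarith) (by linarith) has.le).smul_continuousOn
      continuousOn_const
  have hval : ∀ r ∈ Ioo a s, (s - r) ^ (α - 1) • weylLeft α a f r = (Real.Gamma (1 - α))⁻¹ •
      (((r - a) ^ (-α) * (s - r) ^ (α - 1)) • f a
        + ∫ q in a..r, ((r - q) ^ (-α) * (s - r) ^ (α - 1)) • f' q) := by
    intro r hr
    rw [weylLeft_of_hasDerivAt hα1 hr.1 hf hf', smul_comm, smul_add, smul_smul,
      ← intervalIntegral.integral_smul, mul_comm]
    simp only [smul_smul, mul_comm]
  rw [intervalIntegral.integral_congr_uIoo (g := fun r => (Real.Gamma (1 - α))⁻¹ •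
      (((r - a) ^ (-α) * (s - r) ^ (α - 1)) • f a
        + ∫ q in a..r, ((r - q) ^ (-α) * (s - r) ^ (α - 1)) • f' q))
      (by rwa [uIoo_of_le has.le]), intervalIntegral.integral_smul,
    intervalIntegral.integral_add hi1 hi2, ← hsw, hL, intervalIntegral.integral_smul_const,
    integral_beta_kernel hα hα1 has, ← smul_add, add_sub_cancel, smul_smul, ← mul_assoc,
    inv_mul_cancel₀ hΓ, one_mul]

end Inversion

/-! ## Approximation by averages -/

section Average

variable {E : Type*} [NormedAddCommGroup E]

lemma continuous_of_holder {θ H : ℝ} (hθ : 0 < θ) {f : ℝ → E}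
    (hf : ∀ s t, ‖f t - f s‖ ≤ H * |t - s| ^ θ) : Continuous f :=
  continuous_iff_continuousAt.2 fun x =>
    ((show HolderBoundOn θ H (x - 1) (x + 1) f from fun s _ t _ => hf s t).continuousOn
      hθ).continuousAt (Icc_mem_nhds (by linarith) (by linarith))

lemma HolderBoundOn.singularHolder {δ H a b : ℝ} {f : ℝ → E} (h : HolderBoundOn δ H a b f)
    (hδ : 0 ≤ δ) {M : ℝ} (hM : ∀ x ∈ Icc a b, ‖f x‖ ≤ M) :
    SingularHolder δ 0 0 a b M (H * (b - a) ^ δ) f := by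
  refine ⟨fun r hr => by simpa using hM r (Ioo_subset_Icc_self hr), fun q r h1 h2 h3 => ?_⟩
  have hH := h.nonneg ((h1.trans h2).trans h3)
  refine (h.weighted hδ ⟨h1, h2⟩ h3.le).trans ?_
  have p1 := Real.rpow_nonneg (sub_pos.2 h2).le δ
  have p2 := Real.rpow_nonneg (sub_pos.2 h1).le (-δ)
  have p3 : 0 ≤ r - a := by linarith
  rw [neg_zero, Real.rpow_zero, mul_one]
  gcongr

variable [NormedSpace ℝ E]

/-- The average of `f` over `[x, x + h]`. -/
noncomputable def forwardAverage (h : ℝ) (f : ℝ → E) (x : ℝ) : E := ∫ y in (0 : ℝ)..1, f (x + h * y)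

variable {θ H h : ℝ} {f : ℝ → E}

lemma forwardAverage_holder (hθ : 0 < θ) (hf : ∀ s t, ‖f t - f s‖ ≤ H * |t - s| ^ θ)
    (h s t : ℝ) : ‖forwardAverage h f t - forwardAverage h f s‖ ≤ H * |t - s| ^ θ := by
  have hc := continuous_of_holder hθ hf
  rw [forwardAverage, forwardAverage, ← intervalIntegral.integral_sub
    ((by fun_prop : Continuous _).intervalIntegrable _ _)
    ((by fun_prop : Continuous _).intervalIntegrable _ _)]
  refine (intervalIntegral.norm_integral_le_of_norm_le_const
    (C := H * |t - s| ^ θ) fun y _ => ?_).trans (by simp)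
  simpa using hf (s + h * y) (t + h * y)

lemma norm_forwardAverage_sub_le (hθ : 0 < θ) (hf : ∀ s t, ‖f t - f s‖ ≤ H * |t - s| ^ θ)
    [CompleteSpace E] (hh : 0 ≤ h) (x : ℝ) : ‖forwardAverage h f x - f x‖ ≤ H * h ^ θ := by
  have hc := continuous_of_holder hθ hf
  have hH : 0 ≤ H := by simpa using (norm_nonneg _).trans (hf 0 1)
  have e : f x = ∫ _ in (0 : ℝ)..1, f x := by simp
  rw [forwardAverage, e, ← intervalIntegral.integral_sub
    ((by fun_prop : Continuous _).intervalIntegrable _ _)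
    (continuous_const.intervalIntegrable _ _)]
  refine (intervalIntegral.norm_integral_le_of_norm_le_const
    (C := H * h ^ θ) fun y hy => ?_).trans (by simp)
  rw [uIoc_of_le zero_le_one] at hy
  refine (hf x (x + h * y)).trans ?_
  have h0 := mul_nonneg hh hy.1.le
  rw [add_sub_cancel_left, abs_of_nonneg h0]
  gcongr
  nlinarith [hy.2]

lemma hasDerivAt_forwardAverage [CompleteSpace E] (hc : Continuous f) (hh : 0 < h) (x : ℝ) :
    HasDerivAt (forwardAverage h f) (h⁻¹ • (f (x + h) - f x)) x := by
  have e : forwardAverage h f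
      = fun x => h⁻¹ • ((∫ y in (0 : ℝ)..(x + h), f y) - ∫ y in (0 : ℝ)..x, f y) := by
    funext x
    rw [forwardAverage, intervalIntegral.integral_interval_sub_left
      (hc.intervalIntegrable _ _) (hc.intervalIntegrable _ _),
      intervalIntegral.integral_comp_add_mul f hh.ne']
    simp
  rw [e]
  have h1 (x : ℝ) : HasDerivAt (fun x => ∫ y in (0 : ℝ)..x, f y) (f x) x :=
    intervalIntegral.integral_hasDerivAt_right (hc.intervalIntegrable _ _)
      (hc.stronglyMeasurableAtFilter _ _) hc.continuousAt
  exact (((h1 (x + h)).comp_add_const x h).sub (h1 x)).const_smul h⁻¹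

/-- A sequence of continuously differentiable functions with the Hölder constant of `f` that
converges to `f`. -/
lemma exists_smooth_approx [CompleteSpace E] (hθ : 0 < θ)
    (hf : ∀ s t, ‖f t - f s‖ ≤ H * |t - s| ^ θ) :
    ∃ g g' : ℕ → ℝ → E, (∀ n x, HasDerivAt (g n) (g' n x) x) ∧ (∀ n, Continuous (g' n)) ∧
      (∀ n s t, ‖g n t - g n s‖ ≤ H * |t - s| ^ θ) ∧ (∀ n x, ‖g n x‖ ≤ ‖f x‖ + H) ∧
      ∀ x, Tendsto (fun n => g n x) atTop (𝓝 (f x)) := by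
  have hc := continuous_of_holder hθ hf
  have hH : 0 ≤ H := by simpa using (norm_nonneg _).trans (hf 0 1)
  have hpos (n : ℕ) : (0 : ℝ) < 1 / (n + 1) := by positivity
  refine ⟨fun n => forwardAverage (1 / (n + 1)) f, _,
    fun n x => hasDerivAt_forwardAverage hc (hpos n) x, fun n => by fun_prop,
    fun n => forwardAverage_holder hθ hf _, fun n x => ?_, fun x => ?_⟩
  · have h1 := norm_forwardAverage_sub_le hθ hf (hpos n).le x
    have h2 : ((1 : ℝ) / (n + 1)) ^ θ ≤ 1 :=
      Real.rpow_le_one (hpos n).le (by rw [div_le_one (by positivity)]; simp) hθ.le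
    have h3 := norm_le_norm_add_norm_sub' (forwardAverage (1 / (n + 1)) f x) (f x)
    nlinarith
  · rw [tendsto_iff_norm_sub_tendsto_zero]
    refine squeeze_zero (fun _ => norm_nonneg _)
      (fun n => norm_forwardAverage_sub_le hθ hf (hpos n).le x) ?_
    have h1 := (tendsto_one_div_add_atTop_nhds_zero_nat (𝕜 := ℝ)).rpow_const
      (p := θ) (Or.inr hθ.le)
    simpa [Real.zero_rpow hθ.ne'] using h1.const_mul H

end Average

/-! ### Weyl derivatives under pointwise limits with a common Hölder constant -/

section Limit

variable {E : Type*} [NormedAddCommGroup E] [NormedSpace ℝ E]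

/-- A common Hölder constant gives a common integrable majorant, so pointwise convergence is enough.
Convergence in a Hölder norm, which averages need not provide, is avoided. -/
lemma tendsto_weylLeft {α θ H a r : ℝ} (hα : 0 < α) (hαθ : α < θ) (hθ : θ < 1) (har : a < r)
    {g : ℕ → ℝ → E} {f : ℝ → E} (hg : ∀ n, HolderBoundOn θ H a r (g n))
    (hgf : ∀ x, Tendsto (fun n => g n x) atTop (𝓝 (f x))) :
    Tendsto (fun n => weylLeft α a (g n) r) atTop (𝓝 (weylLeft α a f r)) := by
  have hθ0 := hα.trans hαθ
  refine Tendsto.const_smul (((hgf r).const_smul _).add (Tendsto.const_smul ?_ α)) _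
  have hb := (intervalIntegrable_beta (x := -θ) (y := θ - α - 1) (by linarith) (by linarith)
    har.le).const_mul (H * (r - a) ^ θ)
  rw [intervalIntegrable_iff_integrableOn_Ioo_of_le har.le] at hb
  simp only [intervalIntegral.integral_of_le har.le, integral_Ioc_eq_integral_Ioo]
  refine tendsto_integral_of_dominated_convergence _ (fun n => ?_) hb (fun n => ?_) ?_
  · have := weylLeft_intervalIntegrable hαθ hθ har.le
      (((hg n).continuousOn hθ0).mono Ioo_subset_Icc_self)
      fun q hq => (hg n).weighted hθ0.le hq le_rfl
    rw [intervalIntegrable_iff_integrableOn_Ioo_of_le har.le] at this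
    exact this.aestronglyMeasurable
  · filter_upwards [ae_restrict_mem measurableSet_Ioo] with q hq
    exact weylLeft_integrand_bound (fun q hq => (hg n).weighted hθ0.le hq le_rfl) hq
  · exact .of_forall fun q => ((hgf r).sub (hgf q)).const_smul _

lemma tendsto_weylRight {γ θ H b r : ℝ} (hγ : 0 < γ) (hγθ : γ < θ) (hθ : θ < 1) (hrb : r < b)
    {g : ℕ → ℝ → E} {f : ℝ → E} (hg : ∀ n, HolderBoundOn θ H r b (g n))
    (hgf : ∀ x, Tendsto (fun n => g n x) atTop (𝓝 (f x))) :
    Tendsto (fun n => weylRight γ b (g n) r) atTop (𝓝 (weylRight γ b f r)) := by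
  simp only [weylRight_eq_weylLeft]
  exact tendsto_weylLeft hγ hγθ hθ (neg_lt_neg hrb) (fun n => (hg n).reflect _)
    fun x => (hgf (-x)).sub (hgf b)

variable [CompleteSpace E]

lemma integral_weylLeft_of_holder {α θ H a s : ℝ} (hα : 0 < α) (hαθ : α < θ) (hθ : θ < 1)
    (has : a < s) {f : ℝ → E} (hf : ∀ s t, ‖f t - f s‖ ≤ H * |t - s| ^ θ) :
    ∫ r in a..s, (s - r) ^ (α - 1) • weylLeft α a f r = Real.Gamma α • f s := by
  have hθ0 := hα.trans hαθ
  obtain ⟨g, g', hd, hc, hh, hb, ht⟩ := exists_smooth_approx hθ0 hf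
  have hgH (n : ℕ) : HolderBoundOn θ H a s (g n) := fun s _ t _ => hh n s t
  obtain ⟨M, hM⟩ := isCompact_Icc.exists_bound_of_continuousOn (s := Icc a s)
    (continuous_of_holder hθ0 hf).continuousOn
  have hS (n : ℕ) := (hgH n).singularHolder hθ0.le (M := M + H)
    fun x hx => (hb n x).trans (by linarith [hM x hx])
  have h1 (n : ℕ) : ∫ r in a..s, (s - r) ^ (α - 1) • weylLeft α a (g n) r
      = Real.Gamma α • g n s :=
    integral_weylLeft_of_hasDerivAt hα (hαθ.trans hθ) has (hd n) (hc n)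
  have h2 : Tendsto (fun n => ∫ r in a..s, (s - r) ^ (α - 1) • weylLeft α a (g n) r) atTop
      (𝓝 (Real.Gamma α • f s)) := by
    simp only [h1]
    exact (ht s).const_smul _
  refine tendsto_nhds_unique ?_ h2
  have hbd := (intervalIntegrable_beta (x := -α) (y := α - 1) (by linarith) (by linarith)
    has.le).const_mul (weylConst α θ * (M + H + H * (s - a) ^ θ))
  rw [intervalIntegrable_iff_integrableOn_Ioo_of_le has.le] at hbd
  simp only [intervalIntegral.integral_of_le has.le, integral_Ioc_eq_integral_Ioo]
  refine tendsto_integral_of_dominated_convergence _ (fun n => ?_) hbd (fun n => ?_) ?_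
  · refine (ContinuousOn.aestronglyMeasurable ?_ measurableSet_Ioo).smul
      (aestronglyMeasurable_weylLeft ((hS n).continuousOn hθ0 le_rfl))
    exact ContinuousOn.rpow_const (by fun_prop) fun p hp => Or.inl (sub_pos.2 hp.2).ne'
  · filter_upwards [ae_restrict_mem measurableSet_Ioo] with r hr
    have p1 := Real.rpow_nonneg (sub_pos.2 hr.2).le (α - 1)
    rw [norm_smul, Real.norm_of_nonneg p1]
    refine (mul_le_mul_of_nonneg_left ((hS n).weylLeft_bound hα hαθ hθ hr) p1).trans (le_of_eq ?_)
    simp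
    ring
  · filter_upwards [ae_restrict_mem measurableSet_Ioo] with r hr
    exact (tendsto_weylLeft hα hαθ hθ hr.1 (fun n => (hgH n).mono le_rfl hr.2.le) ht).const_smul _

/-- The boundary term is absent because $w-w(b)$ vanishes at $b$: the derivative is minus a
fractional integral of $w'$. -/
lemma weylRight_of_hasDerivAt {γ b r : ℝ} (hγ1 : γ < 1) (hrb : r < b) {w w' : ℝ → E}
    (hw : ∀ x, HasDerivAt w (w' x) x) (hw' : Continuous w') :
    weylRight γ b w r = -(Real.Gamma (1 - γ))⁻¹ • ∫ q in r..b, (q - r) ^ (-γ) • w' q := by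
  rw [weylRight_eq_weylLeft, weylLeft_of_hasDerivAt (f' := fun x => -w' (-x)) hγ1
    (neg_lt_neg hrb) (fun x => ?_) (by fun_prop)]
  · have e := intervalIntegral.integral_comp_neg (a := r) (b := b)
      (fun q => (-r - q) ^ (-γ) • -w' (-q))
    have e2 (q : ℝ) : -r - -q = q - r := by ring
    simp only [e2, neg_neg, smul_neg, intervalIntegral.integral_neg] at e
    simp only [neg_neg, sub_self, smul_zero, zero_add, smul_neg, intervalIntegral.integral_neg,
      ← e, neg_smul]
  · have := ((hw (-x)).scomp x (hasDerivAt_neg x)).sub_const (w b)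
    simpa [Function.comp_def] using this

end Limit

/-! ## Additivity of the integral -/

section Additivity

variable {V : Type*} [NormedAddCommGroup V] [InnerProductSpace ℝ V] [CompleteSpace V]

variable {α δ θ γ κ a b c M K H D : ℝ} {Z : ℝ → HS V} {w : ℝ → V}

/-- Fractional integration by parts. For differentiable $w$ the right derivative is a fractional
integral of $w'$; Fubini moves that integral onto the Weyl derivative of $Z$, where it is inverted.
The resulting expression no longer depends on $\alpha$ and is additive in the interval. -/
lemma fracIntegral_eq_integral_deriv (hα : 0 < α) (hαδ : α < δ) (hδ : δ < 1) (hab : a ≤ b)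
    (hZ : ∀ s t, ‖Z t - Z s‖ ≤ D * |t - s| ^ δ) {w' : ℝ → V}
    (hw : ∀ x, HasDerivAt w (w' x) x) (hw' : Continuous w') :
    fracIntegral α a b Z w = ∫ r in a..b, Z r (w' r) := by
  have hδ0 := hα.trans hαδ
  have hZc := continuous_of_holder hδ0 hZ
  obtain ⟨M, hM⟩ := isCompact_Icc.exists_bound_of_continuousOn (s := Icc a b) hZc.continuousOn
  obtain ⟨C, hC⟩ := isCompact_Icc.exists_bound_of_continuousOn (s := Icc a b) hw'.continuousOn
  have hS := (show HolderBoundOn δ D a b Z from fun s _ t _ => hZ s t).singularHolder hδ0.le hM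
  obtain ⟨G, hG, hG2⟩ := exists_integrable_bound_fst (x := α - 1) (by linarith)
    ((integrableOn_rpow_sub_left (x := -α) (by linarith) a b).const_mul
      (weylConst α δ * (M + D * (b - a) ^ δ) * C))
  have hmZ := aestronglyMeasurable_weylLeft (α := α) (hS.continuousOn hδ0 le_rfl)
  obtain ⟨-, hsw⟩ := integral_triangle_swap hab (G := G)
    (F := fun p : ℝ × ℝ => (p.2 - p.1) ^ (α - 1) • weylLeft α a Z p.1 (w' p.2)) (by
      refine AEStronglyMeasurable.smul (ContinuousOn.aestronglyMeasurable ?_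
        (isOpen_triangle a b).measurableSet) ?_
      · exact ContinuousOn.rpow_const (by fun_prop) fun p hp => Or.inl (sub_pos.2 hp.2.1).ne'
      · refine HS.evalL.aestronglyMeasurable_comp₂ (?_ : AEStronglyMeasurable
          (fun p : ℝ × ℝ => weylLeft α a Z p.1) _) (by fun_prop)
        have h1 : AEStronglyMeasurable (fun p : ℝ × ℝ => weylLeft α a Z p.1)
            ((volume.restrict (Ioo a b)).prod (volume.restrict univ)) := hmZ.comp_fst
        rw [Measure.prod_restrict] at h1
        refine h1.mono_measure (Measure.restrict_mono (fun p hp => ?_) le_rfl)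
        exact ⟨⟨hp.1, hp.2.1.trans hp.2.2⟩, mem_univ _⟩)
    hG (fun p h1 h2 h3 => by
      have p1 := Real.rpow_nonneg (sub_pos.2 h2).le (α - 1)
      have h4 := hS.weylLeft_bound hα hαδ hδ ⟨h1, h2.trans h3⟩
      have h5 := hC p.2 ⟨(h1.trans h2).le, h3.le⟩
      simp only [neg_zero, Real.rpow_zero, mul_one] at h4
      rw [← hG2 p h1 h2 h3, norm_smul, Real.norm_of_nonneg p1]
      calc _ ≤ (p.2 - p.1) ^ (α - 1) * (‖weylLeft α a Z p.1‖ * ‖w' p.2‖) := by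
            gcongr; exact HS.norm_apply_le _ _
        _ ≤ (p.2 - p.1) ^ (α - 1)
            * (weylConst α δ * (M + D * (b - a) ^ δ) * (p.1 - a) ^ (-α) * C) := by
            gcongr; exact (norm_nonneg _).trans h4
        _ = _ := by ring)
  have hΓ := (Real.Gamma_pos_of_pos hα).ne'
  have e1 : ∀ r ∈ Ioo a b, weylLeft α a Z r (weylRight (1 - α) b w r)
      = -(Real.Gamma α)⁻¹ • ∫ q in r..b, (q - r) ^ (α - 1) • weylLeft α a Z r (w' q) := by
    intro r hr
    have hi : IntervalIntegrable (fun q => (q - r) ^ (α - 1) • w' q) volume r b := by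
      have := integrableOn_rpow_sub_left (x := α - 1) (by linarith) r b
      rw [← intervalIntegrable_iff_integrableOn_Ioo_of_le hr.2.le] at this
      exact this.smul_continuousOn hw'.continuousOn
    have e3 := (weylLeft α a Z r).toCLM.intervalIntegral_comp_comm hi
    simp only [map_smul] at e3
    rw [weylRight_of_hasDerivAt (by linarith) hr.2 hw hw', sub_sub_cancel, neg_sub,
      map_smul, e3]
  have e2 : ∀ q ∈ Ioo a b, ∫ r in a..q, (q - r) ^ (α - 1) • weylLeft α a Z r (w' q)
      = Real.Gamma α • Z q (w' q) := by
    intro q hq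
    have hi : IntervalIntegrable (fun r => (q - r) ^ (α - 1) • weylLeft α a Z r) volume a q := by
      have hbd := (intervalIntegrable_beta (x := -α) (y := α - 1) (by linarith) (by linarith)
        hq.1.le).const_mul (weylConst α δ * (M + D * (b - a) ^ δ))
      rw [intervalIntegrable_iff_integrableOn_Ioo_of_le hq.1.le] at hbd ⊢
      have hm : AEStronglyMeasurable (fun r => (q - r) ^ (α - 1)) (volume.restrict (Ioo a q)) :=
        (ContinuousOn.rpow_const (by fun_prop) fun p hp =>
          Or.inl (sub_pos.2 hp.2).ne').aestronglyMeasurable measurableSet_Ioo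
      refine hbd.mono' (hm.smul
        (hmZ.mono_measure (Measure.restrict_mono (Ioo_subset_Ioo le_rfl hq.2.le) le_rfl))) ?_
      · filter_upwards [ae_restrict_mem measurableSet_Ioo] with r hr
        have p1 := Real.rpow_nonneg (sub_pos.2 hr.2).le (α - 1)
        have h4 := hS.weylLeft_bound hα hαδ hδ ⟨hr.1, hr.2.trans hq.2⟩
        simp only [neg_zero, Real.rpow_zero, mul_one] at h4
        rw [norm_smul, Real.norm_of_nonneg p1]
        exact (mul_le_mul_of_nonneg_left h4 p1).trans (le_of_eq (by ring))
    have e3 := (HS.evalL.flip (w' q)).intervalIntegral_comp_comm hi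
    simp only [map_smul, ContinuousLinearMap.flip_apply, HS.evalL_apply] at e3
    rw [e3, integral_weylLeft_of_holder hα hαδ hδ hq.1 hZ]
    rfl
  rw [fracIntegral, intervalIntegral.integral_congr_uIoo (by rwa [uIoo_of_le hab]),
    intervalIntegral.integral_smul, neg_smul, neg_neg, hsw,
    intervalIntegral.integral_congr_uIoo (by rwa [uIoo_of_le hab]),
    intervalIntegral.integral_smul, smul_smul, inv_mul_cancel₀ hΓ, one_smul]

end Additivity

/-! ### From differentiable paths to Hölder paths and singular integrands -/

section Additivity

variable {V : Type*} [NormedAddCommGroup V] [InnerProductSpace ℝ V] [CompleteSpace V]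

variable {α δ θ γ κ a b c M K H D : ℝ} {Z : ℝ → HS V} {w : ℝ → V}

lemma tendsto_fracIntegral_path (he : Admissible α δ θ 0 0) (hab : a ≤ b)
    (hZ : ∀ s t, ‖Z t - Z s‖ ≤ D * |t - s| ^ δ) {g : ℕ → ℝ → V}
    (hg : ∀ n s t, ‖g n t - g n s‖ ≤ H * |t - s| ^ θ)
    (hgw : ∀ x, Tendsto (fun n => g n x) atTop (𝓝 (w x))) :
    Tendsto (fun n => fracIntegral α a b Z (g n)) atTop (𝓝 (fracIntegral α a b Z w)) := by
  have hδ0 := he.α_pos.trans he.α_lt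
  have hα : 0 < 1 - α := by linarith [he.α_lt, he.δ_lt]
  have hZc := continuous_of_holder hδ0 hZ
  obtain ⟨M, hM⟩ := isCompact_Icc.exists_bound_of_continuousOn (s := Icc a b) hZc.continuousOn
  have hS := (show HolderBoundOn δ D a b Z from fun s _ t _ => hZ s t).singularHolder hδ0.le hM
  have hgH (n : ℕ) (a b : ℝ) : HolderBoundOn θ H a b (g n) := fun s _ t _ => hg n s t
  have hbd := product_bound_intervalIntegrable he hab
    (weylConst α δ * (2 * weylConst (1 - α) θ * H)) M (D * (b - a) ^ δ)
  rw [intervalIntegrable_iff_integrableOn_Ioo_of_le hab] at hbd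
  refine Tendsto.neg ?_
  simp only [intervalIntegral.integral_of_le hab, integral_Ioc_eq_integral_Ioo]
  refine tendsto_integral_of_dominated_convergence _ (fun n => ?_) hbd (fun n => ?_) ?_
  · exact HS.evalL.aestronglyMeasurable_comp₂
      (aestronglyMeasurable_weylLeft (hS.continuousOn hδ0 le_rfl))
      (aestronglyMeasurable_weylRight
        (((hgH n a b).continuousOn (hα.trans he.θ_gt)).mono Ioo_subset_Icc_self))
  · filter_upwards [ae_restrict_mem measurableSet_Ioo] with r hr
    exact (HS.norm_apply_le _ _).trans (hS.product_bound (hgH n a b) he hr)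
  · filter_upwards [ae_restrict_mem measurableSet_Ioo] with r hr
    exact ((weylLeft α a Z r).toCLM.continuous.tendsto _).comp
      (tendsto_weylRight hα he.θ_gt he.θ_lt hr.2 (fun n => hgH n r b) hgw)

/-- Additivity is clear for the averages of the path, whose integrals are $\int Zw'\,dr$, and it
passes to the limit. -/
lemma fracIntegral_add_of_holder (he : Admissible α δ θ 0 0) (hac : a ≤ c) (hcb : c ≤ b)
    (hZ : ∀ s t, ‖Z t - Z s‖ ≤ D * |t - s| ^ δ) (hw : ∀ s t, ‖w t - w s‖ ≤ H * |t - s| ^ θ) :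
    fracIntegral α a b Z w = fracIntegral α a c Z w + fracIntegral α c b Z w := by
  have hα : 0 < 1 - α := by linarith [he.α_lt, he.δ_lt]
  obtain ⟨g, g', hd, hc, hh, -, ht⟩ := exists_smooth_approx (hα.trans he.θ_gt) hw
  have hZc := continuous_of_holder (he.α_pos.trans he.α_lt) hZ
  have h1 := (tendsto_fracIntegral_path he hac hZ hh ht).add
    (tendsto_fracIntegral_path he hcb hZ hh ht)
  refine tendsto_nhds_unique (tendsto_fracIntegral_path he (hac.trans hcb) hZ hh ht)
    (h1.congr fun n => ?_)
  have hi (a b : ℝ) : IntervalIntegrable (fun r => Z r (g' n r)) volume a b :=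
    Continuous.intervalIntegrable (HS.evalL.continuous₂.comp (hZc.prodMk (hc n))) _ _
  rw [fracIntegral_eq_integral_deriv he.α_pos he.α_lt he.δ_lt hac hZ (hd n) (hc n),
    fracIntegral_eq_integral_deriv he.α_pos he.α_lt he.δ_lt hcb hZ (hd n) (hc n),
    fracIntegral_eq_integral_deriv he.α_pos he.α_lt he.δ_lt (hac.trans hcb) hZ (hd n) (hc n),
    intervalIntegral.integral_add_adjacent_intervals (hi _ _) (hi _ _)]

/-- Hölder functions on an interval extend to the real line. -/
lemma HolderBoundOn.exists_extension {E : Type*} [NormedAddCommGroup E] {f : ℝ → E}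
    (h : HolderBoundOn δ H a b f) (hδ : 0 ≤ δ) (hab : a < b) :
    ∃ g : ℝ → E, EqOn f g (Icc a b) ∧ ∀ s t, ‖g t - g s‖ ≤ H * |t - s| ^ δ := by
  have hH := h.nonneg hab
  have hmem (x : ℝ) : max (min x b) a ∈ Icc a b :=
    ⟨le_max_right _ _, max_le (min_le_right _ _) hab.le⟩
  -- Clamping to the interval is $1$-Lipschitz, so the Hölder constant is preserved.
  refine ⟨fun x => f (max (min x b) a), fun x hx => ?_, fun s t => ?_⟩
  · simp [min_eq_left hx.2, max_eq_left hx.1]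
  · refine (h _ (hmem s) _ (hmem t)).trans ?_
    refine mul_le_mul_of_nonneg_left (Real.rpow_le_rpow (abs_nonneg _) ?_ hδ) hH
    have h1 : |min t b - min s b| ≤ |t - s| := by simpa using abs_min_sub_min_le_max t b s b
    exact (abs_max_sub_max_le_abs _ _ _).trans h1

lemma fracIntegral_add_of_holderBoundOn (he : Admissible α δ θ 0 0) (hac : a < c) (hcb : c < b)
    (hZ : HolderBoundOn δ D a b Z) (hw : HolderBoundOn θ H a b w) :
    fracIntegral α a b Z w = fracIntegral α a c Z w + fracIntegral α c b Z w := by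
  have hα : 0 < 1 - α := by linarith [he.α_lt, he.δ_lt]
  obtain ⟨Z', hZ1, hZ2⟩ := hZ.exists_extension (he.α_pos.trans he.α_lt).le (hac.trans hcb)
  obtain ⟨w', hw1, hw2⟩ := hw.exists_extension (hα.trans he.θ_gt).le (hac.trans hcb)
  have key : ∀ s t, a ≤ s → s ≤ t → t ≤ b → fracIntegral α s t Z w = fracIntegral α s t Z' w' :=
    fun s t h1 h2 h3 => (fracIntegral_congr h2 (hZ1.mono (Ioo_subset_Icc_self.trans
      (Icc_subset_Icc h1 h3)))).trans (fracIntegral_congr_right h2 (hw1.mono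
        (Ioc_subset_Icc_self.trans (Icc_subset_Icc h1 h3))))
  rw [key a b le_rfl (hac.trans hcb).le le_rfl, key a c le_rfl hac.le hcb.le,
    key c b hac.le hcb.le le_rfl]
  exact fracIntegral_add_of_holder he hac.le hcb.le hZ2 hw2

lemma tendsto_weylRight_endpoint {E : Type*} [NormedAddCommGroup E] [NormedSpace ℝ E]
    {w : ℝ → E} {r : ℝ} (hw : HolderBoundOn θ H r b w) (hγ : 0 < γ) (hγθ : γ < θ) (hθ : θ < 1)
    (hrb : r < b) :
    Tendsto (fun b' => weylRight γ b' w r) (𝓝[<] b) (𝓝 (weylRight γ b w r)) := by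
  have hwb : Tendsto w (𝓝[<] b) (𝓝 (w b)) := by
    have h1 := hw.continuousOn (hγ.trans hγθ) b ⟨hrb.le, le_rfl⟩
    refine h1.mono_left ?_
    rw [nhdsWithin_Icc_eq_nhdsLE hrb]
    exact nhdsWithin_mono _ Iio_subset_Iic_self
  have hk : Tendsto (fun b' : ℝ => ((b' - r) ^ γ)⁻¹) (𝓝[<] b) (𝓝 ((b - r) ^ γ)⁻¹) := by
    have : ContinuousAt (fun b' : ℝ => ((b' - r) ^ γ)⁻¹) b :=
      ((by fun_prop : ContinuousAt (fun b' : ℝ => b' - r) b).rpow_const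
        (Or.inl (sub_pos.2 hrb).ne')).inv₀ (Real.rpow_pos_of_pos (sub_pos.2 hrb) _).ne'
    exact this.mono_left nhdsWithin_le_nhds
  refine Tendsto.const_smul ((hk.smul (tendsto_const_nhds.sub hwb)).add (Tendsto.const_smul ?_ γ)) _
  have hi := weylRight_intervalIntegrable hw hγ hγθ hθ ⟨le_rfl, hrb⟩
  have hc := intervalIntegral.continuousOn_primitive_interval' hi left_mem_uIcc
  rw [uIcc_of_le hrb.le] at hc
  refine (hc b ⟨hrb.le, le_rfl⟩).mono_left ?_
  rw [nhdsWithin_Icc_eq_nhdsLE hrb]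
  exact nhdsWithin_mono _ Iio_subset_Iic_self

/-- The left derivative does not involve the right end point, and the right derivatives converge
pointwise. `SingularHolder.product_bound_of_le` supplies the majorant. -/
lemma SingularHolder.tendsto_fracIntegral_right (h : SingularHolder δ γ κ a b M K Z)
    (hw : HolderBoundOn θ H a b w) (he : Admissible α δ θ γ κ) (hab : a < b) :
    Tendsto (fun b' => fracIntegral α a b' Z w) (𝓝[<] b) (𝓝 (fracIntegral α a b Z w)) := by
  have hα : 0 < 1 - α := by linarith [he.α_lt, he.δ_lt]
  have hZ := h.continuousOn (he.α_pos.trans he.α_lt) he.κ_nonneg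
  have hbd := product_bound_intervalIntegrable he hab.le
    (weylConst α δ * (2 * weylConst (1 - α) θ * H)) M K
  rw [intervalIntegrable_iff_integrableOn_Ioo_of_le hab.le] at hbd
  have hmem : Ioo a b ∈ 𝓝[<] b := Ioo_mem_nhdsLT hab
  have e (b' : ℝ) (hb' : b' ∈ Ioc a b) : fracIntegral α a b' Z w = -∫ r in Ioo a b,
      (Iio b').indicator (fun r => weylLeft α a Z r (weylRight (1 - α) b' w r)) r := by
    rw [fracIntegral, intervalIntegral.integral_of_le hb'.1.le, integral_Ioc_eq_integral_Ioo,
      integral_indicator measurableSet_Iio, Measure.restrict_restrict measurableSet_Iio]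
    congr 3
    ext x
    simp only [mem_Ioo, mem_inter_iff, mem_Iio]
    exact ⟨fun h => ⟨h.2, h.1, h.2.trans_le hb'.2⟩, fun h => ⟨h.2.1, h.1⟩⟩
  rw [e b ⟨hab, le_rfl⟩]
  refine Tendsto.congr' (f₁ := fun b' => -∫ r in Ioo a b,
      (Iio b').indicator (fun r => weylLeft α a Z r (weylRight (1 - α) b' w r)) r)
    (by filter_upwards [hmem] with b' hb' using (e b' (Ioo_subset_Ioc_self hb')).symm) (Tendsto.neg ?_)
  refine tendsto_integral_filter_of_dominated_convergence _ ?_ ?_ hbd ?_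
  · filter_upwards [hmem] with b' hb'
    rw [aestronglyMeasurable_indicator_iff measurableSet_Iio,
      Measure.restrict_restrict measurableSet_Iio]
    have : Iio b' ∩ Ioo a b = Ioo a b' := by
      ext x
      simp only [mem_Ioo, mem_inter_iff, mem_Iio]
      exact ⟨fun h => ⟨h.2.1, h.1⟩, fun h => ⟨h.2, h.1, h.2.trans hb'.2⟩⟩
    rw [this]
    exact HS.evalL.aestronglyMeasurable_comp₂
      (aestronglyMeasurable_weylLeft (hZ.mono (Ioo_subset_Ioo le_rfl hb'.2.le)))
      (aestronglyMeasurable_weylRight ((hw.continuousOn (hα.trans he.θ_gt)).mono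
        (Ioo_subset_Icc_self.trans (Icc_subset_Icc le_rfl hb'.2.le))))
  · filter_upwards [hmem] with b' hb'
    filter_upwards [ae_restrict_mem measurableSet_Ioo] with r hr
    by_cases hrb : r < b'
    · rw [indicator_of_mem (mem_Iio.2 hrb)]
      exact (HS.norm_apply_le _ _).trans (h.product_bound_of_le hw he hb'.2.le ⟨hr.1, hrb⟩)
    · rw [indicator_of_notMem (by rwa [mem_Iio]), norm_zero]
      exact (by positivity : (0 : ℝ) ≤ _).trans (h.product_bound hw he hr)
  · filter_upwards [ae_restrict_mem measurableSet_Ioo] with r hr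
    rw [indicator_of_mem (mem_Iio.2 hr.2)]
    have h1 := ((weylLeft α a Z r).toCLM.continuous.tendsto _).comp
      (tendsto_weylRight_endpoint (hw.mono hr.1.le le_rfl) hα he.θ_gt he.θ_lt hr.2)
    refine h1.congr' ?_
    filter_upwards [Ioo_mem_nhdsLT hr.2] with b' hb'
    rw [indicator_of_mem (mem_Iio.2 hb'.1)]
    rfl

lemma integral_kernel_left {α r : ℝ} (hac : a ≤ c) (hcr : c < r) :
    ∫ q in a..c, α * ((r - q) ^ (1 + α))⁻¹ = (r - c) ^ (-α) - (r - a) ^ (-α) := by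
  refine intervalIntegral.integral_eq_sub_of_hasDerivAt (f := fun q => (r - q) ^ (-α))
    (fun q hq => ?_) (ContinuousOn.intervalIntegrable ?_) <;> rw [uIcc_of_le hac] at *
  · exact hasDerivAt_sub_rpow_neg α (by linarith [hq.2])
  · refine continuousOn_const.mul (ContinuousOn.inv₀ (ContinuousOn.rpow_const (by fun_prop) ?_) ?_)
    · exact fun q hq => Or.inl (by linarith [hq.2])
    · exact fun q hq => (Real.rpow_pos_of_pos (by linarith [hq.2]) _).ne'

/-- The terms with $Z(r)$ cancel, because the kernel integrates over $[a,c]$ to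
$(r-c)^{-\alpha}-(r-a)^{-\alpha}$. Only the values of $Z$ on the discarded piece remain, so no
Hölder bound enters the estimate. -/
lemma norm_weylLeft_sub_le {E : Type*} [NormedAddCommGroup E] [NormedSpace ℝ E] [CompleteSpace E]
    {Z : ℝ → E} {r m : ℝ} (hα : 0 < α) (hα1 : α < 1) (hac : a ≤ c) (hcr : c < r)
    (hi : IntervalIntegrable (fun q => ((r - q) ^ (1 + α))⁻¹ • (Z r - Z q)) volume a r)
    (hm : ∀ q ∈ Ioo a c, ‖Z q‖ ≤ m) :
    ‖weylLeft α a Z r - weylLeft α c Z r‖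
      ≤ (Real.Gamma (1 - α))⁻¹ * (m * ((r - c) ^ (-α) - (r - a) ^ (-α))) := by
  have hΓ := Real.Gamma_pos_of_pos (s := 1 - α) (by linarith)
  have hsub1 : uIcc a c ⊆ uIcc a r := by
    rw [uIcc_of_le hac, uIcc_of_le (hac.trans hcr.le)]; exact Icc_subset_Icc le_rfl hcr.le
  have hsub2 : uIcc c r ⊆ uIcc a r := by
    rw [uIcc_of_le hcr.le, uIcc_of_le (hac.trans hcr.le)]; exact Icc_subset_Icc hac le_rfl
  have hi1 := hi.mono_set hsub1
  have hi2 := hi.mono_set hsub2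
  have hker : IntervalIntegrable (fun q => α * ((r - q) ^ (1 + α))⁻¹) volume a c := by
    refine ContinuousOn.intervalIntegrable ?_
    rw [uIcc_of_le hac]
    refine continuousOn_const.mul (ContinuousOn.inv₀ (ContinuousOn.rpow_const (by fun_prop) ?_) ?_)
    · exact fun q hq => Or.inl (by linarith [hq.2])
    · exact fun q hq => (Real.rpow_pos_of_pos (by linarith [hq.2]) _).ne'
  have hk := integral_kernel_left (α := α) hac hcr
  have hconst : ∫ q in a..c, (α * ((r - q) ^ (1 + α))⁻¹) • Z r
      = ((r - c) ^ (-α) - (r - a) ^ (-α)) • Z r := by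
    rw [intervalIntegral.integral_smul_const, hk]
  have e : weylLeft α a Z r - weylLeft α c Z r
      = -((Real.Gamma (1 - α))⁻¹ • ∫ q in a..c, (α * ((r - q) ^ (1 + α))⁻¹) • Z q) := by
    have e1 := intervalIntegral.integral_add_adjacent_intervals hi1 hi2
    have hi3 : IntervalIntegrable (fun q => (α * ((r - q) ^ (1 + α))⁻¹) • (Z r - Z q))
        volume a c := by
      simp only [mul_smul]
      exact hi1.smul α
    have e2 : ∫ q in a..c, (α * ((r - q) ^ (1 + α))⁻¹) • Z q
        = ((r - c) ^ (-α) - (r - a) ^ (-α)) • Z r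
          - α • ∫ q in a..c, ((r - q) ^ (1 + α))⁻¹ • (Z r - Z q) := by
      rw [← hconst, ← intervalIntegral.integral_smul]
      simp only [smul_smul]
      rw [← intervalIntegral.integral_sub (hker.smul_continuousOn continuousOn_const) hi3]
      simp only [smul_sub, sub_sub_cancel]
    rw [weylLeft, weylLeft, ← smul_sub, ← e1, e2, ← Real.rpow_neg (by linarith),
      ← Real.rpow_neg (by linarith), ← smul_neg]
    congr 1
    rw [smul_add, sub_smul]
    abel
  rw [e, norm_neg, norm_smul, norm_inv, Real.norm_of_nonneg hΓ.le]
  gcongr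
  rw [← hk, ← intervalIntegral.integral_const_mul, intervalIntegral.integral_of_le hac,
    intervalIntegral.integral_of_le hac, integral_Ioc_eq_integral_Ioo, integral_Ioc_eq_integral_Ioo]
  have hb := hker.const_mul m
  rw [intervalIntegrable_iff_integrableOn_Ioo_of_le hac] at hb
  refine norm_integral_le_of_norm_le hb ?_
  filter_upwards [ae_restrict_mem measurableSet_Ioo] with q hq
  have p : 0 < α * ((r - q) ^ (1 + α))⁻¹ :=
    mul_pos hα (inv_pos.2 (Real.rpow_pos_of_pos (by linarith [hq.2]) _))
  rw [norm_smul, Real.norm_of_nonneg p.le, mul_comm]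
  gcongr
  exact hm q hq

lemma integral_kernel_diff_le {α : ℝ} (hα1 : α < 1) (hac : a ≤ c) (hcb : c ≤ b) :
    ∫ r in c..b, ((r - c) ^ (-α) - (r - a) ^ (-α)) ≤ (c - a) ^ (1 - α) / (1 - α) := by
  have hi (a c : ℝ) (x : ℝ) : IntervalIntegrable (fun r : ℝ => (r - x) ^ (-α)) volume a c := by
    have := (intervalIntegral.intervalIntegrable_rpow' (a := a - x) (b := c - x) (r := -α)
      (by linarith)).comp_sub_right x
    simpa using this
  have hv (x : ℝ) : ∫ r in c..b, (r - x) ^ (-α)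
      = ((b - x) ^ (1 - α) - (c - x) ^ (1 - α)) / (1 - α) := by
    rw [intervalIntegral.integral_comp_sub_right (fun r => r ^ (-α)), integral_rpow
      (Or.inl (by linarith)), neg_add_eq_sub]
  rw [intervalIntegral.integral_sub (hi _ _ _) (hi _ _ _), hv, hv, sub_self,
    Real.zero_rpow (by linarith), ← sub_div]
  have h1 : (b - c) ^ (1 - α) ≤ (b - a) ^ (1 - α) :=
    Real.rpow_le_rpow (by linarith) (by linarith) (by linarith)
  exact div_le_div_of_nonneg_right (by linarith) (by linarith)

/-- Here the left derivative itself changes with the end point. Its change is controlled by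
`norm_weylLeft_sub_le` and contributes $O((a'-a)^{1-\alpha})$; what is left is the continuity of a
primitive. -/
lemma SingularHolder.tendsto_fracIntegral_left (h : SingularHolder δ γ κ a b M K Z)
    (hw : HolderBoundOn θ H a b w) (he : Admissible α δ θ γ κ) (hab : a < b) :
    Tendsto (fun a' => fracIntegral α a' b Z w) (𝓝[>] a) (𝓝 (fracIntegral α a b Z w)) := by
  have hα : 0 < 1 - α := by linarith [he.α_lt, he.δ_lt]
  have hδ0 := he.α_pos.trans he.α_lt
  have hH := hw.nonneg hab
  have hM := h.nonneg_left hab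
  have hf := h.hasFracIntegral hw he hab
  have hi := hf.intervalIntegrable hab.le
  -- With $a'<c$ the discarded piece stays away from $b$, so $Z$ is bounded on it despite its
  -- weight.
  set c := (a + b) / 2 with hc
  have hac : a < c := by rw [hc]; linarith
  have hcb : c < b := by rw [hc]; linarith
  have hΓ := Real.Gamma_pos_of_pos hα
  have hcw := weylConst_pos hα he.θ_gt he.θ_lt
  set R := 2 * weylConst (1 - α) θ * H * (b - a) ^ (θ - (1 - α)) with hR
  have hR0 : 0 ≤ R := by
    have := Real.rpow_nonneg (sub_pos.2 hab).le (θ - (1 - α))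
    positivity
  have hWR : ∀ r ∈ Ioo a b, ‖weylRight (1 - α) b w r‖ ≤ R := by
    intro r hr
    refine (norm_weylRight_le hw hα he.θ_gt he.θ_lt (Ioo_subset_Ico_self hr)).trans ?_
    rw [hR]
    gcongr
    · linarith [hr.2]
    · linarith [he.θ_gt]
    · exact hr.1.le
  have hm : ∀ q ∈ Ioo a c, ‖Z q‖ ≤ M * (b - c) ^ (-γ) := by
    intro q hq
    refine (h.norm_le q ⟨hq.1, hq.2.trans hcb⟩).trans ?_
    gcongr ?_ * ?_
    exact Real.rpow_le_rpow_of_nonpos (sub_pos.2 hcb) (by linarith [hq.2])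
      (by linarith [he.γ_nonneg])
  have hest : ∀ a' ∈ Ioo a c, ‖-(∫ r in a'..b, weylLeft α a Z r (weylRight (1 - α) b w r))
        - fracIntegral α a' b Z w‖
      ≤ (Real.Gamma (1 - α))⁻¹ * (M * (b - c) ^ (-γ)) * R / (1 - α) * (a' - a) ^ (1 - α) := by
    intro a' ha'
    have hab' : a' < b := ha'.2.trans hcb
    have hi' := ((h.mono_left hδ0.le ha'.1.le hab').hasFracIntegral
      (hw.mono ha'.1.le le_rfl) he hab').intervalIntegrable hab'.le
    have hi'' := hi.mono_set (c := a') (d := b) (by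
      rw [uIcc_of_le hab'.le, uIcc_of_le hab.le]; exact Icc_subset_Icc ha'.1.le le_rfl)
    rw [fracIntegral, ← neg_sub', norm_neg, ← intervalIntegral.integral_sub hi'' hi']
    have hb : IntervalIntegrable (fun r => (Real.Gamma (1 - α))⁻¹ * (M * (b - c) ^ (-γ)) * R
        * ((r - a') ^ (-α) - (r - a) ^ (-α))) volume a' b := by
      have hi (x : ℝ) : IntervalIntegrable (fun r : ℝ => (r - x) ^ (-α)) volume a' b := by
        have := (intervalIntegral.intervalIntegrable_rpow' (a := a' - x) (b := b - x) (r := -α)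
          (by linarith)).comp_sub_right x
        simpa using this
      exact ((hi a').sub (hi a)).const_mul _
    have h1 : ‖∫ r in a'..b, (weylLeft α a Z r (weylRight (1 - α) b w r)
        - weylLeft α a' Z r (weylRight (1 - α) b w r))‖
        ≤ ∫ r in a'..b, (Real.Gamma (1 - α))⁻¹ * (M * (b - c) ^ (-γ)) * R
        * ((r - a') ^ (-α) - (r - a) ^ (-α)) := by
      rw [intervalIntegrable_iff_integrableOn_Ioo_of_le hab'.le] at hb
      rw [intervalIntegral.integral_of_le hab'.le, intervalIntegral.integral_of_le hab'.le,
        integral_Ioc_eq_integral_Ioo, integral_Ioc_eq_integral_Ioo]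
      refine norm_integral_le_of_norm_le hb ?_
      filter_upwards [ae_restrict_mem measurableSet_Ioo] with r hr
      have hr' : r ∈ Ioo a b := ⟨ha'.1.trans hr.1, hr.2⟩
      have h2 := norm_weylLeft_sub_le he.α_pos (by linarith) ha'.1.le hr.1
        (hf.left_integrable r hr') fun q hq => hm q ⟨hq.1, hq.2.trans ha'.2⟩
      have h3 : ‖(weylLeft α a Z r - weylLeft α a' Z r) (weylRight (1 - α) b w r)‖ ≤ _ :=
        HS.norm_apply_le _ _
      refine h3.trans ((mul_le_mul h2 (hWR r hr') (norm_nonneg _)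
        ((norm_nonneg _).trans h2)).trans (le_of_eq (by ring)))
    refine h1.trans ?_
    rw [intervalIntegral.integral_const_mul]
    have h4 := integral_kernel_diff_le (α := α) (b := b) (by linarith) ha'.1.le hab'.le
    have h5 := Real.rpow_pos_of_pos (sub_pos.2 hcb) (-γ)
    refine (mul_le_mul_of_nonneg_left h4 (by positivity)).trans (le_of_eq (by ring))
  have hprim : Tendsto (fun a' => -∫ r in a'..b, weylLeft α a Z r (weylRight (1 - α) b w r))
      (𝓝[>] a) (𝓝 (fracIntegral α a b Z w)) := by
    have hi0 := (intervalIntegrable_iff_integrableOn_Icc_of_le hab.le).1 hi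
    rw [← uIcc_of_le hab.le] at hi0
    have hcont := intervalIntegral.continuousOn_primitive_interval_left hi0
    rw [uIcc_of_le hab.le] at hcont
    refine ((hcont a ⟨le_rfl, hab.le⟩).neg).mono_left ?_
    rw [nhdsWithin_Icc_eq_nhdsGE hab]
    exact nhdsWithin_mono _ Ioi_subset_Ici_self
  have hzero : Tendsto (fun a' => (Real.Gamma (1 - α))⁻¹ * (M * (b - c) ^ (-γ)) * R / (1 - α)
      * (a' - a) ^ (1 - α)) (𝓝[>] a) (𝓝 0) := by
    have : Continuous fun a' : ℝ => (Real.Gamma (1 - α))⁻¹ * (M * (b - c) ^ (-γ)) * R / (1 - α)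
        * (a' - a) ^ (1 - α) :=
      continuous_const.mul ((by fun_prop : Continuous fun x : ℝ => x - a).rpow_const
        fun _ => Or.inr hα.le)
    have h2 := (this.tendsto a).mono_left (nhdsWithin_le_nhds (s := Ioi a))
    simpa [Real.zero_rpow hα.ne'] using h2
  have hdiff := squeeze_zero_norm' (by
    filter_upwards [Ioo_mem_nhdsGT hac] with a' ha' using hest a' ha') hzero
  simpa using hprim.sub hdiff

/-- On $[a',b']$ strictly inside $(a,b)$ the integrand is Hölder and additivity is known. First
$b'\to b$, then $a'\to a$. -/
theorem SingularHolder.fracIntegral_add (h : SingularHolder δ γ κ a b M K Z)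
    (hw : HolderBoundOn θ H a b w) (he : Admissible α δ θ γ κ) (hac : a < c) (hcb : c < b) :
    fracIntegral α a b Z w = fracIntegral α a c Z w + fracIntegral α c b Z w := by
  have hδ0 := he.α_pos.trans he.α_lt
  have hab := hac.trans hcb
  have he0 : Admissible α δ θ 0 0 :=
    { he with
      γ_nonneg := le_rfl
      γ_lt := he.γ_nonneg.trans_lt he.γ_lt
      κ_nonneg := le_rfl
      κ_lt := he.κ_nonneg.trans_lt he.κ_lt }
  have h1 : ∀ a' ∈ Ioo a c, ∀ b' ∈ Ioo c b,
      fracIntegral α a' b' Z w = fracIntegral α a' c Z w + fracIntegral α c b' Z w :=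
    fun a' ha' b' hb' => fracIntegral_add_of_holderBoundOn he0 ha'.2 hb'.1
      (h.holderBoundOn hδ0 he.κ_nonneg ha'.1 (ha'.2.trans hb'.1).le hb'.2)
      (hw.mono ha'.1.le hb'.2.le)
  have h2 : ∀ a' ∈ Ioo a c,
      fracIntegral α a' b Z w = fracIntegral α a' c Z w + fracIntegral α c b Z w := by
    intro a' ha'
    have t1 := (h.mono_left hδ0.le ha'.1.le (ha'.2.trans hcb)).tendsto_fracIntegral_right
      (hw.mono ha'.1.le le_rfl) he (ha'.2.trans hcb)
    have t2 := ((h.mono_left hδ0.le hac.le hcb).tendsto_fracIntegral_right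
      (hw.mono hac.le le_rfl) he hcb).const_add (fracIntegral α a' c Z w)
    refine tendsto_nhds_unique t1 (t2.congr' ?_)
    filter_upwards [Ioo_mem_nhdsLT hcb] with b' hb' using (h1 a' ha' b' hb').symm
  have t1 := h.tendsto_fracIntegral_left hw he hab
  have t2 := ((h.mono_right he.γ_nonneg he.κ_nonneg hac hcb.le).tendsto_fracIntegral_left
    (hw.mono le_rfl hcb.le) he hac).add_const (fracIntegral α c b Z w)
  refine tendsto_nhds_unique t1 (t2.congr' ?_)
  filter_upwards [Ioo_mem_nhdsGT hac] with a' ha' using (h2 a' ha').symm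

end Additivity

/-! ## Smoothing estimates for the semigroup -/

section Scalar

/-- For $x\ge1$ this is $x^p\le x^2\le 2e^x$. Exponents up to $2$ are needed for second differences
of the semigroup, where two exponents of at most $1$ add up. -/
lemma rpow_mul_exp_neg_le {x p : ℝ} (hx : 0 ≤ x) (hp : 0 ≤ p) (hp2 : p ≤ 2) :
    x ^ p * Real.exp (-x) ≤ 2 := by
  rcases le_total x 1 with h | h
  · have h1 := Real.rpow_le_one hx h hp
    have h2 : Real.exp (-x) ≤ 1 := Real.exp_le_one_iff.2 (by linarith)
    nlinarith [Real.exp_pos (-x)]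
  · have h1 : x ^ p ≤ x ^ (2 : ℝ) := Real.rpow_le_rpow_of_exponent_le h hp2
    have h2 := Real.quadratic_le_exp_of_nonneg hx
    rw [Real.rpow_two] at h1
    rw [Real.exp_neg, mul_inv_le_iff₀ (Real.exp_pos x)]
    linarith

lemma one_sub_exp_neg_le_rpow {x γ : ℝ} (hx : 0 ≤ x) (hγ : 0 ≤ γ) (hγ1 : γ ≤ 1) :
    1 - Real.exp (-x) ≤ x ^ γ := by
  rcases le_total x 1 with h | h
  · rcases hx.eq_or_lt with rfl | hx
    · simpa using Real.rpow_nonneg le_rfl γ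
    · have h1 := Real.add_one_le_exp (-x)
      have h2 := Real.rpow_le_rpow_of_exponent_ge hx h hγ1
      rw [Real.rpow_one] at h2
      linarith
  · have h1 := Real.one_le_rpow h hγ
    linarith [Real.exp_pos (-x)]

end Scalar

section Semigroup

variable {V : Type*} [NormedAddCommGroup V] [InnerProductSpace ℝ V]

/-- The function $e^{\nu r}S(r)x$ has right derivative zero, hence is constant. The generator
provides one-sided derivatives only, and those suffice. -/
lemma IsC0Semigroup.apply_eigenvector {S : ℝ → V →L[ℝ] V} (hS : IsC0Semigroup S)
    {A : V →ₗ.[ℝ] V} (hSA : IsGenerator S A) {x : V} {ν : ℝ} (hx : (x, -(ν • x)) ∈ A.graph)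
    {t : ℝ} (ht : 0 ≤ t) : S t x = Real.exp (-(ν * t)) • x := by
  have hgen := (hSA x (-(ν • x))).1 hx
  have hconst := constant_of_has_deriv_right_zero (a := 0) (b := t)
    (f := fun r => Real.exp (ν * r) • S r x) ?_ ?_ t ⟨ht, le_rfl⟩
  · simp only [mul_zero, Real.exp_zero, one_smul, hS.zero, ContinuousLinearMap.id_apply] at hconst
    conv_rhs => rw [← hconst]
    rw [smul_smul, ← Real.exp_add]
    simp
  · exact ContinuousOn.smul (by fun_prop) ((hS.continuousOn x).mono Icc_subset_Ici_self)
  · intro r hr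
    have h1 : HasDerivWithinAt (fun r => S r x) (-(ν • S r x)) (Ici r) r := by
      rw [← hasDerivWithinAt_Ioi_iff_Ici, hasDerivWithinAt_iff_tendsto_slope' (by simp)]
      have h2 : Tendsto (fun y : ℝ => y - r) (𝓝[>] r) (𝓝[>] 0) := by
        refine tendsto_nhdsWithin_iff.2 ⟨?_, ?_⟩
        · have : Tendsto (fun y : ℝ => y - r) (𝓝 r) (𝓝 (r - r)) :=
            (continuous_sub_right r).tendsto r
          rw [sub_self] at this
          exact this.mono_left nhdsWithin_le_nhds
        · filter_upwards [self_mem_nhdsWithin] with y hy using sub_pos.2 (mem_Ioi.1 hy)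
      have h3 := ((S r).continuous.tendsto _).comp (hgen.comp h2)
      rw [map_neg, map_smul] at h3
      refine h3.congr' ?_
      filter_upwards [self_mem_nhdsWithin] with y hy
      have hy' : 0 ≤ y - r := (sub_pos.2 (mem_Ioi.1 hy)).le
      have e : S y = S r ∘L S (y - r) := by
        rw [← hS.add r (y - r) hr.1 hy', add_sub_cancel]
      simp only [Function.comp, slope_def_module, e, ContinuousLinearMap.comp_apply, map_smul,
        map_sub]
    have h2 : HasDerivWithinAt (fun r => Real.exp (ν * r)) (Real.exp (ν * r) * (ν * 1)) (Ici r) r :=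
      (((hasDerivAt_id r).const_mul ν).exp).hasDerivWithinAt
    have h3 := h2.smul h1
    refine h3.congr_deriv ?_
    rw [smul_neg, smul_smul, mul_one]
    abel

variable [CompleteSpace V]

open Module.End in
/-- A symmetric compact operator bounds every operator that is diagonal along with it. -/
lemma norm_le_of_diagonal {K B : V →L[ℝ] V} (hK : IsCompactOperator K)
    (hKs : K.toLinearMap.IsSymmetric) {C : ℝ} (hC : 0 ≤ C)
    (hB : ∀ (μ : ℝ) (x : V), K x = μ • x → x ≠ 0 → ∃ c : ℝ, |c| ≤ C ∧ B x = c • x) :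
    ‖B‖ ≤ C := by
  -- By the spectral theorem for $K$ it is enough to bound $B$ on finite sums of eigenvectors, where
  -- Pythagoras applies.
  have hd : Dense ((⨆ μ, eigenspace (K : Module.End ℝ V) μ : Submodule ℝ V) : Set V) := by
    rw [Submodule.dense_iff_topologicalClosure_eq_top, Submodule.topologicalClosure_eq_top_iff]
    exact K.orthogonalComplement_iSup_eigenspaces_eq_bot hK hKs
  refine B.opNorm_le_bound hC fun x => ?_
  have hcl : IsClosed {x : V | ‖B x‖ ≤ C * ‖x‖} :=
    isClosed_le (by fun_prop) (by fun_prop)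
  refine hcl.closure_subset_iff.2 ?_ (hd x)
  intro x hx
  obtain ⟨f, hf, rfl⟩ := (Submodule.mem_iSup_iff_exists_finsupp _ _).1 hx
  have hB' : ∀ μ, ∃ c : ℝ, |c| ≤ C ∧ B (f μ) = c • f μ := by
    intro μ
    by_cases h0 : f μ = 0
    · exact ⟨0, by simpa using hC, by simp [h0]⟩
    · exact hB μ (f μ) (mem_eigenspace_iff.1 (hf μ)) h0
  choose c hc1 hc2 using hB'
  have horth := hKs.orthogonalFamily_eigenspaces
  have e1 := horth.norm_sum (fun μ => ⟨f μ, hf μ⟩) f.support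
  have e2 := horth.norm_sum (fun μ => c μ • ⟨f μ, hf μ⟩) f.support
  change ‖∑ μ ∈ f.support, f μ‖ ^ 2 = ∑ μ ∈ f.support, ‖f μ‖ ^ 2 at e1
  change ‖∑ μ ∈ f.support, c μ • f μ‖ ^ 2 = ∑ μ ∈ f.support, ‖c μ • f μ‖ ^ 2 at e2
  change ‖B (f.sum fun _ xi => xi)‖ ≤ C * ‖f.sum fun _ xi => xi‖
  refine le_of_sq_le_sq ?_ (by positivity)
  rw [Finsupp.sum, map_sum, mul_pow, e1, Finset.sum_congr rfl fun μ _ => hc2 μ, e2, Finset.mul_sum]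
  refine Finset.sum_le_sum fun μ _ => ?_
  rw [norm_smul, mul_pow, Real.norm_eq_abs]
  gcongr
  exact hc1 μ

/-- Strongly continuous contraction semigroups of compact operators with the smoothing estimates
of an analytic semigroup. -/
structure IsSmoothingSemigroup (S : ℝ → V →L[ℝ] V) : Prop extends IsC0Semigroup S where
  norm_le_one : ∀ t, 0 ≤ t → ‖S t‖ ≤ 1
  norm_sub_le : ∀ s t γ : ℝ, 0 < s → s ≤ t → 0 ≤ γ → γ ≤ 1 →
    ‖S t - S s‖ ≤ 2 * ((t - s) / s) ^ γ
  norm_sub_sub_le : ∀ s h k γ δ : ℝ, 0 < s → 0 ≤ h → 0 ≤ k → 0 ≤ γ → γ ≤ 1 → 0 ≤ δ → δ ≤ 1 →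
    ‖(S (s + h) - S s) - (S (s + h + k) - S (s + k))‖ ≤ 2 * ((h / s) ^ γ * (k / s) ^ δ)
  compact : ∀ t, 0 < t → IsCompactOperator (S t)

/-- If $Kx=\mu x$ with $K=(-A)^{-1}$ and $x\ne0$, then $\mu>0$ and $S(t)x=e^{-t/\mu}x$. All claims
become bounds on functions of $\lambda=\mu^{-1}$, uniform in $\lambda>0$, by `norm_le_of_diagonal`.
-/
theorem isSmoothingSemigroup_of_compactInverse (A : V →ₗ.[ℝ] V) (hA_symm : A.IsFormalAdjoint A)
    (hA_pos : ∀ x : A.domain, (x : V) ≠ 0 → 0 < ⟪-(A x), (x : V)⟫_ℝ)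
    (hA_inv : HasCompactInverse (-A)) (S : ℝ → V →L[ℝ] V) (hS : IsC0Semigroup S)
    (hSA : IsGenerator S A) : IsSmoothingSemigroup S := by
  obtain ⟨K, hK, hK1, -⟩ := hA_inv
  have hgr : ∀ x, ∃ z : A.domain, (z : V) = K x ∧ -(A z) = x := by
    intro x
    obtain ⟨z, hz1, hz2⟩ := (LinearPMap.mem_graph_iff _).1 (hK1 x)
    exact ⟨z, hz1, by rw [← LinearPMap.neg_apply]; exact hz2⟩
  have hKs : K.toLinearMap.IsSymmetric := by
    intro x y
    obtain ⟨z, hz1, hz2⟩ := hgr x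
    obtain ⟨z', hz1', hz2'⟩ := hgr y
    have h := hA_symm z z'
    change ⟪K x, y⟫_ℝ = ⟪x, K y⟫_ℝ
    rw [← hz1, ← hz1']
    conv_lhs => rw [← hz2']
    conv_rhs => rw [← hz2]
    rw [inner_neg_right, inner_neg_left, h]
  have hpos : ∀ (μ : ℝ) (x : V), K x = μ • x → x ≠ 0 → 0 < μ := by
    intro μ x hx hx0
    obtain ⟨z, hz1, hz2⟩ := hgr x
    have hz0 : (z : V) ≠ 0 := by
      intro h0
      have : z = 0 := Subtype.ext h0
      rw [this, LinearPMap.map_zero, neg_zero] at hz2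
      exact hx0 hz2.symm
    have h := hA_pos z hz0
    rw [hz2, hz1, hx, inner_smul_right, real_inner_self_eq_norm_sq] at h
    exact pos_of_mul_pos_left h (by positivity)
  have happ : ∀ (μ : ℝ) (x : V), K x = μ • x → x ≠ 0 → ∀ t, 0 ≤ t →
      S t x = Real.exp (-(μ⁻¹ * t)) • x := by
    intro μ x hx hx0 t ht
    have hμ := hpos μ x hx hx0
    refine hS.apply_eigenvector hSA ?_ ht
    obtain ⟨z, hz1, hz2⟩ := hgr x
    have h1 : (K x, -x) ∈ A.graph := by
      have := A.mem_graph z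
      rwa [hz1, ← neg_neg (A z), hz2] at this
    have h2 := A.graph.smul_mem μ⁻¹ h1
    rw [hx] at h2
    simpa [smul_smul, inv_mul_cancel₀ hμ.ne'] using h2
  have hscal : ∀ (l s p : ℝ), 0 < l → 0 < s → 0 ≤ p → p ≤ 2 →
      l ^ p * Real.exp (-(l * s)) ≤ 2 * s ^ (-p) := by
    intro l s p hl hs hp hp2
    have h1 := rpow_mul_exp_neg_le (mul_pos hl hs).le hp hp2
    rw [Real.mul_rpow hl.le hs.le] at h1
    have h2 := Real.rpow_pos_of_pos hs p
    rw [Real.rpow_neg hs.le, ← div_eq_mul_inv, le_div_iff₀ h2]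
    linarith
  have hdiff : ∀ s t γ : ℝ, 0 < s → s ≤ t → 0 ≤ γ → γ ≤ 1 →
      ‖S t - S s‖ ≤ 2 * ((t - s) / s) ^ γ := by
    intro s t γ hs hst hγ hγ1
    have h0 : 0 ≤ t - s := sub_nonneg.2 hst
    refine norm_le_of_diagonal hK hKs (by positivity) fun μ x hx hx0 => ?_
    have hl : 0 < μ⁻¹ := inv_pos.2 (hpos μ x hx hx0)
    refine ⟨Real.exp (-(μ⁻¹ * t)) - Real.exp (-(μ⁻¹ * s)), ?_, ?_⟩
    · have e : Real.exp (-(μ⁻¹ * t)) = Real.exp (-(μ⁻¹ * s)) * Real.exp (-(μ⁻¹ * (t - s))) := by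
        rw [← Real.exp_add]; congr 1; ring
      have h1 := one_sub_exp_neg_le_rpow (mul_nonneg hl.le h0) hγ hγ1
      have h2 : Real.exp (-(μ⁻¹ * (t - s))) ≤ 1 :=
        Real.exp_le_one_iff.2 (by linarith [mul_nonneg hl.le h0])
      have h3 := hscal μ⁻¹ s γ hl hs hγ (by linarith)
      have h4 := Real.exp_pos (-(μ⁻¹ * s))
      rw [e, abs_sub_comm, abs_of_nonneg (by nlinarith), Real.div_rpow h0 hs.le,
        div_eq_mul_inv, ← Real.rpow_neg hs.le]
      rw [Real.mul_rpow hl.le h0] at h1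
      have h5 := Real.rpow_nonneg h0 γ
      calc _ = Real.exp (-(μ⁻¹ * s)) * (1 - Real.exp (-(μ⁻¹ * (t - s)))) := by ring
        _ ≤ Real.exp (-(μ⁻¹ * s)) * (μ⁻¹ ^ γ * (t - s) ^ γ) := by gcongr
        _ = (μ⁻¹ ^ γ * Real.exp (-(μ⁻¹ * s))) * (t - s) ^ γ := by ring
        _ ≤ (2 * s ^ (-γ)) * (t - s) ^ γ := by gcongr
        _ = _ := by ring
    · rw [sub_apply, happ μ x hx hx0 t (hs.le.trans hst),
        happ μ x hx hx0 s hs.le, sub_smul]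
  have hone : ∀ t, 0 ≤ t → ‖S t‖ ≤ 1 := by
    intro t ht
    refine norm_le_of_diagonal hK hKs zero_le_one fun μ x hx hx0 => ?_
    have hl : 0 < μ⁻¹ := inv_pos.2 (hpos μ x hx hx0)
    refine ⟨_, ?_, happ μ x hx hx0 t ht⟩
    rw [Real.abs_exp]
    exact Real.exp_le_one_iff.2 (by linarith [mul_nonneg hl.le ht])
  refine ⟨hS, hone, hdiff, ?_, ?_⟩
  · intro s h k γ δ hs hh hk hγ hγ1 hδ hδ1
    refine norm_le_of_diagonal hK hKs (by positivity) fun μ x hx hx0 => ?_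
    have hl : 0 < μ⁻¹ := inv_pos.2 (hpos μ x hx hx0)
    -- The second difference factorises on an eigenvector; each factor $1-e^{-\lambda h}$ gives its
    -- own power, and $e^{-\lambda s}$ absorbs both powers of $\lambda$.
    refine ⟨-(Real.exp (-(μ⁻¹ * s)) * ((1 - Real.exp (-(μ⁻¹ * h)))
      * (1 - Real.exp (-(μ⁻¹ * k))))), ?_, ?_⟩
    · have h1 := one_sub_exp_neg_le_rpow (mul_nonneg hl.le hh) hγ hγ1
      have h2 := one_sub_exp_neg_le_rpow (mul_nonneg hl.le hk) hδ hδ1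
      have h1' : 0 ≤ 1 - Real.exp (-(μ⁻¹ * h)) :=
        sub_nonneg.2 (Real.exp_le_one_iff.2 (by linarith [mul_nonneg hl.le hh]))
      have h2' : 0 ≤ 1 - Real.exp (-(μ⁻¹ * k)) :=
        sub_nonneg.2 (Real.exp_le_one_iff.2 (by linarith [mul_nonneg hl.le hk]))
      have h3 := hscal μ⁻¹ s (γ + δ) hl hs (by positivity) (by linarith)
      rw [Real.mul_rpow hl.le hh] at h1
      rw [Real.mul_rpow hl.le hk] at h2
      rw [Real.rpow_add hl, neg_add, Real.rpow_add hs] at h3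
      rw [abs_neg, abs_of_nonneg (by positivity), Real.div_rpow hh hs.le, Real.div_rpow hk hs.le,
        div_eq_mul_inv, div_eq_mul_inv, ← Real.rpow_neg hs.le, ← Real.rpow_neg hs.le]
      calc _ ≤ Real.exp (-(μ⁻¹ * s)) * ((μ⁻¹ ^ γ * h ^ γ) * (μ⁻¹ ^ δ * k ^ δ)) := by gcongr
        _ = (μ⁻¹ ^ γ * μ⁻¹ ^ δ * Real.exp (-(μ⁻¹ * s))) * (h ^ γ * k ^ δ) := by ring
        _ ≤ (2 * (s ^ (-γ) * s ^ (-δ))) * (h ^ γ * k ^ δ) := by gcongr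
        _ = _ := by ring
    · simp only [sub_apply]
      rw [happ μ x hx hx0 _ hs.le, happ μ x hx hx0 _ (by positivity), happ μ x hx hx0 _ (by positivity),
        happ μ x hx hx0 _ (by positivity), ← sub_smul, ← sub_smul, ← sub_smul]
      congr 1
      have e (u v : ℝ) : Real.exp (-(μ⁻¹ * (u + v)))
          = Real.exp (-(μ⁻¹ * u)) * Real.exp (-(μ⁻¹ * v)) := by
        rw [← Real.exp_add]; congr 1; ring
      rw [e (s + h) k, e s h, e s k]
      ring
  · intro t ht
    -- Formally $S(t)=K(-A)S(t)$. Replacing $-AS(t)$ by difference quotients exhibits $S(t)$ as an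
    -- operator-norm limit of compact operators.
    have hlim : Tendsto (fun ε : ℝ => ε⁻¹ • (K ∘L (S t - S (t + ε)))) (𝓝[>] 0) (𝓝 (S t)) := by
      rw [tendsto_iff_norm_sub_tendsto_zero]
      have h0 : Tendsto (fun ε : ℝ => 2 * (ε / t)) (𝓝[>] 0) (𝓝 0) := by
        have : Tendsto (fun ε : ℝ => 2 * (ε / t)) (𝓝 0) (𝓝 (2 * (0 / t))) :=
          (by fun_prop : Continuous fun ε : ℝ => 2 * (ε / t)).tendsto 0
        simp only [zero_div, mul_zero] at this
        exact this.mono_left nhdsWithin_le_nhds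
      refine squeeze_zero' (.of_forall fun _ => norm_nonneg _) ?_ h0
      filter_upwards [self_mem_nhdsWithin] with ε (hε : 0 < ε)
      refine norm_le_of_diagonal hK hKs (by positivity) fun μ x hx hx0 => ?_
      have hμ := hpos μ x hx hx0
      have hl : 0 < μ⁻¹ := inv_pos.2 hμ
      refine ⟨Real.exp (-(μ⁻¹ * t)) * (ε⁻¹ * μ * (1 - Real.exp (-(μ⁻¹ * ε))) - 1), ?_, ?_⟩
      · have h1 := hscal μ⁻¹ t 1 hl ht zero_le_one one_le_two
        rw [Real.rpow_one, Real.rpow_neg_one] at h1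
        set y := μ⁻¹ * ε with hy
        have hy0 : 0 < y := mul_pos hl hε
        have e1 : ε⁻¹ * μ = y⁻¹ := by rw [hy]; field_simp
        have h2 : 1 - Real.exp (-y) ≤ y := by linarith [Real.add_one_le_exp (-y)]
        have h3 : y - y ^ 2 ≤ 1 - Real.exp (-y) := by
          have := Real.quadratic_le_exp_of_nonneg hy0.le
          have h4 : Real.exp (-y) * Real.exp y = 1 := by rw [← Real.exp_add]; simp
          have h5 := Real.exp_pos (-y)
          have h6 : Real.exp (-y) * (1 + y) ≤ 1 := by nlinarith
          have h7 : 1 ≤ (1 - y + y ^ 2) * (1 + y) := by nlinarith [pow_pos hy0 3]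
          nlinarith
        have h8 : |y⁻¹ * (1 - Real.exp (-y)) - 1| ≤ y := by
          have e2 : y⁻¹ * (1 - Real.exp (-y)) - 1 = (1 - Real.exp (-y) - y) / y := by field_simp
          rw [e2, abs_div, abs_of_pos hy0, div_le_iff₀ hy0, abs_le]
          constructor <;> nlinarith
        rw [abs_mul, Real.abs_exp, e1]
        calc _ ≤ Real.exp (-(μ⁻¹ * t)) * y := by gcongr
          _ = (μ⁻¹ * Real.exp (-(μ⁻¹ * t))) * ε := by rw [hy]; ring
          _ ≤ (2 * t⁻¹) * ε := by gcongr
          _ = _ := by ring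
      · have e : Real.exp (-(μ⁻¹ * (t + ε)))
            = Real.exp (-(μ⁻¹ * t)) * Real.exp (-(μ⁻¹ * ε)) := by
          rw [← Real.exp_add]; congr 1; ring
        simp only [sub_apply, smul_apply,
          ContinuousLinearMap.comp_apply]
        rw [happ μ x hx hx0 _ ht.le, happ μ x hx hx0 _ (by positivity), e, ← sub_smul, map_smul, hx,
          smul_smul, smul_smul, ← sub_smul]
        congr 1
        ring
    refine isClosed_setOfPred_isCompactOperator.mem_of_tendsto hlim (.of_forall fun ε => ?_)
    exact (hK.comp_clm _).smul _

end Semigroup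

/-! ## Exponentially weighted Hölder bounds -/

section Weighted

variable {E : Type*} [NormedAddCommGroup E]

/-- The bound `K` for the norm of `C^{β,∼}([0, T])` with the exponential weight `exp (-ρ t)`. -/
def WeightedHolder (β ρ T K : ℝ) (g : ℝ → E) : Prop :=
  (∀ t ∈ Ioc 0 T, ‖g t‖ ≤ K * Real.exp (ρ * t)) ∧
    ∀ s t, 0 < s → s < t → t ≤ T → ‖g t - g s‖ ≤ K * Real.exp (ρ * t) * ((t - s) / s) ^ β

variable {β δ ρ ρ' T K K' : ℝ} {g g' : ℝ → E}

lemma WeightedHolder.nonneg (h : WeightedHolder β ρ T K g) (hT : 0 < T) : 0 ≤ K :=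
  nonneg_of_mul_nonneg_left ((norm_nonneg _).trans (h.1 T ⟨hT, le_rfl⟩)) (Real.exp_pos _)

lemma WeightedHolder.mono (h : WeightedHolder β ρ T K g) (hK : K ≤ K') :
    WeightedHolder β ρ T K' g := by
  refine ⟨fun t ht => (h.1 t ht).trans (by gcongr), fun s t h1 h2 h3 =>
    (h.2 s t h1 h2 h3).trans ?_⟩
  have := Real.rpow_nonneg (div_pos (sub_pos.2 h2) h1).le β
  gcongr

lemma WeightedHolder.add (h : WeightedHolder β ρ T K g) (h' : WeightedHolder β ρ T K' g') :
    WeightedHolder β ρ T (K + K') (fun t => g t + g' t) := by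
  refine ⟨fun t ht => (norm_add_le _ _).trans ?_, fun s t h1 h2 h3 => ?_⟩
  · rw [add_mul]; exact add_le_add (h.1 t ht) (h'.1 t ht)
  · rw [add_sub_add_comm, add_mul, add_mul]
    exact (norm_add_le _ _).trans (add_le_add (h.2 s t h1 h2 h3) (h'.2 s t h1 h2 h3))

lemma WeightedHolder.neg (h : WeightedHolder β ρ T K g) :
    WeightedHolder β ρ T K (fun t => -g t) := by
  refine ⟨fun t ht => (norm_neg _).trans_le (h.1 t ht), fun s t h1 h2 h3 => ?_⟩
  rw [← neg_sub', norm_neg]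
  exact h.2 s t h1 h2 h3

lemma WeightedHolder.sub (h : WeightedHolder β ρ T K g) (h' : WeightedHolder β ρ T K' g') :
    WeightedHolder β ρ T (K + K') (fun t => g t - g' t) := by
  simpa [sub_eq_add_neg] using h.add h'.neg

lemma WeightedHolder.congr (h : WeightedHolder β ρ T K g) (hg : EqOn g g' (Ioc 0 T)) :
    WeightedHolder β ρ T K g' := by
  refine ⟨fun t ht => (hg ht) ▸ h.1 t ht, fun s t h1 h2 h3 => ?_⟩
  rw [← hg ⟨h1.trans h2, h3⟩, ← hg ⟨h1, h2.le.trans h3⟩]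
  exact h.2 s t h1 h2 h3

lemma WeightedHolder.rate_mono (h : WeightedHolder β ρ T K g) (hρ : ρ ≤ ρ') :
    WeightedHolder β ρ' T K g := by
  rcases le_or_gt T 0 with hT | hT
  · exact ⟨fun t ht => absurd (ht.1.trans_le ht.2) hT.not_gt,
      fun s t h1 h2 h3 => absurd ((h1.trans h2).trans_le h3) hT.not_gt⟩
  have hK := h.nonneg hT
  refine ⟨fun t ht => (h.1 t ht).trans ?_, fun s t h1 h2 h3 => (h.2 s t h1 h2 h3).trans ?_⟩
  · have := ht.1; gcongr
  · have := h1.trans h2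
    have := Real.rpow_nonneg (div_pos (sub_pos.2 h2) h1).le β
    gcongr

lemma WeightedHolder.unweighted (h : WeightedHolder β ρ T K g) (hT : 0 < T) (hρ : 0 ≤ ρ) :
    WeightedHolder β 0 T (K * Real.exp (ρ * T)) g := by
  have hK := h.nonneg hT
  refine ⟨fun t ht => (h.1 t ht).trans ?_, fun s t h1 h2 h3 => (h.2 s t h1 h2 h3).trans ?_⟩
  · have := ht.2
    rw [zero_mul, Real.exp_zero, mul_one]
    gcongr
  · have := Real.rpow_nonneg (div_pos (sub_pos.2 h2) h1).le β
    rw [zero_mul, Real.exp_zero, mul_one]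
    gcongr

/-- The ratio $(t-s)/s$ is unbounded, so lowering the exponent is not automatic. Where it exceeds
$1$ the supremum bound is used at both times, which costs the factor $2$. -/
lemma WeightedHolder.exponent_mono (h : WeightedHolder β ρ T K g) (hρ : 0 ≤ ρ) (hδ : 0 ≤ δ)
    (hδβ : δ ≤ β) : WeightedHolder δ ρ T (2 * K) g := by
  rcases le_or_gt T 0 with hT | hT
  · exact ⟨fun t ht => absurd (ht.1.trans_le ht.2) hT.not_gt,
      fun s t h1 h2 h3 => absurd ((h1.trans h2).trans_le h3) hT.not_gt⟩
  have hK := h.nonneg hT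
  refine ⟨fun t ht => (h.1 t ht).trans (by gcongr; linarith), fun s t h1 h2 h3 => ?_⟩
  have hx : 0 < (t - s) / s := div_pos (sub_pos.2 h2) h1
  have he := Real.exp_pos (ρ * t)
  rcases le_total ((t - s) / s) 1 with hx1 | hx1
  · refine (h.2 s t h1 h2 h3).trans ?_
    have := Real.rpow_le_rpow_of_exponent_ge hx hx1 hδβ
    gcongr
    linarith
  · have e1 := h.1 t ⟨h1.trans h2, h3⟩
    have e2 := h.1 s ⟨h1, h2.le.trans h3⟩
    have e3 : K * Real.exp (ρ * s) ≤ K * Real.exp (ρ * t) := by gcongr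
    have e4 := Real.one_le_rpow hx1 hδ
    calc ‖g t - g s‖ ≤ ‖g t‖ + ‖g s‖ := norm_sub_le _ _
      _ ≤ 2 * K * Real.exp (ρ * t) * 1 := by linarith
      _ ≤ _ := by gcongr

lemma WeightedHolder.of_tendsto {ι : Type*} {l : Filter ι} [l.NeBot] {g : ι → ℝ → E}
    {g₀ : ℝ → E} {K : ι → ℝ} {K₀ : ℝ} (h : ∀ᶠ n in l, WeightedHolder β ρ T (K n) (g n))
    (hK : Tendsto K l (𝓝 K₀)) (hg : ∀ t ∈ Ioc 0 T, Tendsto (fun n => g n t) l (𝓝 (g₀ t))) :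
    WeightedHolder β ρ T K₀ g₀ := by
  refine ⟨fun t ht => ?_, fun s t h1 h2 h3 => ?_⟩
  · exact le_of_tendsto_of_tendsto (hg t ht).norm (hK.mul_const _) (h.mono fun n hn => hn.1 t ht)
  · exact le_of_tendsto_of_tendsto
      ((hg t ⟨h1.trans h2, h3⟩).sub (hg s ⟨h1, h2.le.trans h3⟩)).norm
      ((hK.mul_const _).mul_const _) (h.mono fun n hn => hn.2 s t h1 h2 h3)

/-- A bound that improves itself by the map `K ↦ c + K / 2` improves to `2 c`. -/
lemma WeightedHolder.improve {c : ℝ} (h : WeightedHolder β ρ T K g)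
    (himp : ∀ K, WeightedHolder β ρ T K g → WeightedHolder β ρ T (c + K / 2) g) :
    WeightedHolder β ρ T (2 * c) g := by
  have h1 : ∀ n : ℕ, WeightedHolder β ρ T (2 * c + (K - 2 * c) * (1 / 2) ^ n) g := by
    intro n
    induction n with
    | zero => simpa using h
    | succ n ih =>
      refine (himp _ ih).mono (le_of_eq ?_)
      rw [pow_succ]
      ring
  refine WeightedHolder.of_tendsto (l := atTop) (.of_forall h1) ?_ fun _ _ => tendsto_const_nhds
  have := (tendsto_pow_atTop_nhds_zero_of_lt_one (r := (1 / 2 : ℝ)) (by norm_num)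
    (by norm_num)).const_mul (K - 2 * c)
  simpa using this.const_add (2 * c)

end Weighted

/-! ## The stochastic convolution -/

section Convolution

variable {V : Type*} [NormedAddCommGroup V] [InnerProductSpace ℝ V] [CompleteSpace V]

/-- The convolution `∫_0^t S (t - r) g(r) dw`. -/
noncomputable def mildConv (S : ℝ → V →L[ℝ] V) (α : ℝ) (w : ℝ → V) (g : ℝ → HS V) (t : ℝ) : V :=
  fracIntegral α 0 t (fun r => (g r).compLeft (S (t - r))) w

/-- Exponents for which the convolution is `β`-Hölder continuous. -/
structure MildExponents (α β θ δ η : ℝ) : Prop where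
  α_pos : 0 < α
  α_lt : α < δ
  δ_le : δ ≤ β
  η_pos : 0 < η
  θ_lt : θ < 1
  θ_gt : 1 - α < θ
  add_lt : β + η + δ < θ + α

variable {α β θ δ η H : ℝ}

lemma MildExponents.δ_pos (he : MildExponents α β θ δ η) : 0 < δ := he.α_pos.trans he.α_lt

lemma MildExponents.β_pos (he : MildExponents α β θ δ η) : 0 < β := he.δ_pos.trans_le he.δ_le

lemma MildExponents.add_le (he : MildExponents α β θ δ η) : β + η ≤ θ := by
  linarith [he.add_lt, he.α_lt]

lemma MildExponents.δ_lt_one (he : MildExponents α β θ δ η) : δ < 1 := by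
  linarith [he.add_le, he.δ_le, he.θ_lt, he.η_pos]

/-- The singularity $\eta$ stems from the exponential weight; increments add $\delta$ through the
differences of the semigroup. -/
lemma MildExponents.admissible_left (he : MildExponents α β θ δ η) :
    Admissible α δ θ η (η + δ) := by
  have h1 := he.α_pos; have h2 := he.δ_pos; have h3 := he.β_pos; have h4 := he.η_pos
  have h5 := he.add_lt; have h6 := he.δ_le; have h7 := he.add_le
  exact ⟨h1, he.α_lt, he.δ_lt_one, he.θ_gt, he.θ_lt, h4.le, by linarith, by linarith, by linarith⟩

lemma MildExponents.admissible_right (he : MildExponents α β θ δ η) :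
    Admissible α δ θ (β + η) (β + η + δ) := by
  have h1 := he.α_pos; have h2 := he.δ_pos; have h3 := he.β_pos; have h4 := he.η_pos
  have h5 := he.add_lt; have h6 := he.δ_le; have h7 := he.add_le
  exact ⟨h1, he.α_lt, he.δ_lt_one, he.θ_gt, he.θ_lt, by linarith, by linarith, by linarith,
    by linarith⟩

/-- The source of all smallness: the decay $e^{-\rho(b-r)}$ is traded for the small factor
$\rho^{-\eta}$ at the price of a singularity at $b$. -/
lemma exp_le_rpow_weight {ρ η b r : ℝ} (hρ : 0 < ρ) (hη : 0 ≤ η) (hη1 : η ≤ 1) (hr : r < b) :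
    Real.exp (ρ * r) ≤ Real.exp (ρ * b) * (2 * ρ ^ (-η)) * (b - r) ^ (-η) := by
  have p : 0 < b - r := sub_pos.2 hr
  have h := rpow_mul_exp_neg_le (mul_pos hρ p).le hη (by linarith)
  have e : Real.exp (ρ * r) = Real.exp (ρ * b) * Real.exp (-(ρ * (b - r))) := by
    rw [← Real.exp_add]; congr 1; ring
  rw [e, mul_assoc]
  gcongr
  rw [mul_assoc, ← Real.mul_rpow hρ.le p.le, Real.rpow_neg (mul_pos hρ p).le, ← div_eq_mul_inv,
    le_div_iff₀ (Real.rpow_pos_of_pos (mul_pos hρ p) _)]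
  linarith

variable {S : ℝ → V →L[ℝ] V} {g g' : ℝ → HS V} {w : ℝ → V} {ρ T K : ℝ}

lemma one_le_rpow_mul_rpow_neg {x y δ : ℝ} (hx : 0 < x) (hxy : x ≤ y) (hδ : 0 ≤ δ) :
    1 ≤ y ^ δ * x ^ (-δ) := by
  rw [Real.rpow_neg hx.le, ← div_eq_mul_inv, one_le_div (Real.rpow_pos_of_pos hx _)]
  exact Real.rpow_le_rpow hx.le hxy hδ

lemma WeightedHolder.norm_sub_le_of_le (h : WeightedHolder δ ρ T K g) (hδ : 0 ≤ δ) {a q r : ℝ}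
    (ha : 0 ≤ a) (hq : a < q) (hqr : q < r) (hr : r ≤ T) :
    ‖g r - g q‖ ≤ K * Real.exp (ρ * r) * ((r - q) ^ δ * (q - a) ^ (-δ)) := by
  have hq0 : 0 < q := ha.trans_lt hq
  have hK := h.nonneg ((hq0.trans hqr).trans_le hr)
  refine (h.2 q r hq0 hqr hr).trans ?_
  rw [Real.div_rpow (sub_pos.2 hqr).le hq0.le, div_eq_mul_inv, ← Real.rpow_neg hq0.le]
  have h1 : q ^ (-δ) ≤ (q - a) ^ (-δ) :=
    Real.rpow_le_rpow_of_nonpos (sub_pos.2 hq) (by linarith) (by linarith)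
  have h2 := Real.rpow_nonneg (sub_pos.2 hqr).le δ
  gcongr

/-- An increment is split into $S(t-r)(g(r)-g(q))$ and $(S(t-q)-S(t-r))g(q)$. They contribute $1$
and $2$ to the constant $3$. -/
lemma WeightedHolder.singularHolder_left (h : WeightedHolder δ ρ T K g)
    (hS : IsSmoothingSemigroup S) (he : MildExponents α β θ δ η) (hρ : 0 < ρ) {s t : ℝ}
    (hs : 0 ≤ s) (hst : s < t) (ht : t ≤ T) :
    SingularHolder δ η (η + δ) s t (K * (Real.exp (ρ * t) * (2 * ρ ^ (-η))))
      (3 * (K * (Real.exp (ρ * t) * (2 * ρ ^ (-η)))) * (t - s) ^ δ)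
      (fun r => (g r).compLeft (S (t - r))) := by
  have hK := h.nonneg ((hs.trans_lt hst).trans_le ht)
  have hδ := he.δ_pos.le
  have hη1 : η ≤ 1 := by linarith [he.add_le, he.β_pos, he.θ_lt]
  set N := K * (Real.exp (ρ * t) * (2 * ρ ^ (-η))) with hN
  have hN0 : 0 ≤ N := by positivity
  have hW : ∀ r < t, K * Real.exp (ρ * r) ≤ N * (t - r) ^ (-η) := by
    intro r hr
    rw [hN, mul_assoc]
    exact mul_le_mul_of_nonneg_left (exp_le_rpow_weight hρ he.η_pos.le hη1 hr) hK
  refine ⟨fun r hr => ?_, fun q r hq hqr hr => ?_⟩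
  · refine (HS.norm_compLeft_le _ _).trans ?_
    have h1 := hS.norm_le_one (t - r) (sub_pos.2 hr.2).le
    have h2 := (h.1 r ⟨hs.trans_lt hr.1, hr.2.le.trans ht⟩).trans (hW r hr.2)
    calc _ ≤ 1 * ‖g r‖ := by gcongr
      _ ≤ _ := by rw [one_mul]; exact h2
  · have p1 : 0 < t - r := sub_pos.2 hr
    have p2 : 0 < r - q := sub_pos.2 hqr
    have p3 : 0 < q - s := sub_pos.2 hq
    have e : (g r).compLeft (S (t - r)) - (g q).compLeft (S (t - q))
        = (g r - g q).compLeft (S (t - r)) - (g q).compLeft (S (t - q) - S (t - r)) := by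
      rw [HS.compLeft_sub_right, HS.compLeft_sub_left]; abel
    have n1 := hS.norm_le_one (t - r) p1.le
    have n2 := hS.norm_sub_le (t - r) (t - q) δ p1 (by linarith) hδ he.δ_lt_one.le
    have e2 : t - q - (t - r) = r - q := by ring
    rw [e2, Real.div_rpow p2.le p1.le, div_eq_mul_inv, ← Real.rpow_neg p1.le] at n2
    have n3 := h.norm_sub_le_of_le hδ hs hq hqr (hr.le.trans ht)
    have n4 := h.1 q ⟨hs.trans_lt hq, (hqr.trans hr).le.trans ht⟩
    have n5 : K * Real.exp (ρ * q) ≤ K * Real.exp (ρ * r) := by gcongr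
    have n6 := hW r hr
    -- The two terms are singular at different ends. Each is multiplied by the weight of the other
    -- end, made at least $1$ by $(t-s)^\delta$, to obtain the common product form.
    have o1 := one_le_rpow_mul_rpow_neg p1 (by linarith : t - r ≤ t - s) hδ
    have o2 := one_le_rpow_mul_rpow_neg p3 (by linarith : q - s ≤ t - s) hδ
    have q1 := Real.rpow_pos_of_pos p1 (-δ)
    have q2 := Real.rpow_pos_of_pos p2 δ
    have q3 := Real.rpow_pos_of_pos p3 (-δ)
    have q4 := Real.rpow_pos_of_pos p1 (-η)
    rw [e, neg_add, Real.rpow_add p1]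
    refine (norm_sub_le _ _).trans ((add_le_add (HS.norm_compLeft_le _ _)
      (HS.norm_compLeft_le _ _)).trans ?_)
    set W := N * (t - r) ^ (-η) with hWdef
    have hW0 : 0 ≤ W := by positivity
    calc ‖S (t - r)‖ * ‖g r - g q‖ + ‖S (t - q) - S (t - r)‖ * ‖g q‖
        ≤ 1 * (W * ((r - q) ^ δ * (q - s) ^ (-δ)))
          + 2 * ((r - q) ^ δ * (t - r) ^ (-δ)) * W := by
          gcongr
          · refine n3.trans ?_
            gcongr
          · exact n4.trans (n5.trans n6)
      _ = W * (r - q) ^ δ * ((q - s) ^ (-δ) * 1 + 2 * (t - r) ^ (-δ) * 1) := by ring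
      _ ≤ W * (r - q) ^ δ * ((q - s) ^ (-δ) * ((t - s) ^ δ * (t - r) ^ (-δ))
          + 2 * (t - r) ^ (-δ) * ((t - s) ^ δ * (q - s) ^ (-δ))) := by gcongr
      _ = _ := by rw [hWdef]; ring

/-- The integrand of the increment of the convolution over the common past. The factor $(t-s)^\beta$
is gained from the difference of the semigroup, which adds $\beta$ to the singularity at $s$; the
second difference keeps that factor in the Hölder bound. -/
lemma WeightedHolder.singularHolder_right (h : WeightedHolder δ ρ T K g)
    (hS : IsSmoothingSemigroup S) (he : MildExponents α β θ δ η) (hρ : 0 < ρ) {s t : ℝ}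
    (hs : 0 < s) (hst : s ≤ t) (hsT : s ≤ T) :
    SingularHolder δ (β + η) (β + η + δ) 0 s
      (2 * (K * (Real.exp (ρ * s) * (2 * ρ ^ (-η)))) * (t - s) ^ β)
      (4 * (K * (Real.exp (ρ * s) * (2 * ρ ^ (-η)))) * (t - s) ^ β * s ^ δ)
      (fun r => (g r).compLeft (S (t - r)) - (g r).compLeft (S (s - r))) := by
  have hK := h.nonneg (hs.trans_le hsT)
  have hδ := he.δ_pos.le
  have hβ := he.β_pos.le
  have hβ1 : β ≤ 1 := by linarith [he.add_le, he.η_pos, he.θ_lt]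
  have hη1 : η ≤ 1 := by linarith [he.add_le, he.β_pos, he.θ_lt]
  have p0 : 0 ≤ t - s := sub_nonneg.2 hst
  have q0 := Real.rpow_nonneg p0 β
  set N := K * (Real.exp (ρ * s) * (2 * ρ ^ (-η))) with hN
  have hN0 : 0 ≤ N := by positivity
  have hW : ∀ r < s, K * Real.exp (ρ * r) ≤ N * (s - r) ^ (-η) := by
    intro r hr
    rw [hN, mul_assoc]
    exact mul_le_mul_of_nonneg_left (exp_le_rpow_weight hρ he.η_pos.le hη1 hr) hK
  have hD : ∀ r < s, ‖S (t - r) - S (s - r)‖ ≤ 2 * ((t - s) ^ β * (s - r) ^ (-β)) := by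
    intro r hr
    have p1 : 0 < s - r := sub_pos.2 hr
    have n := hS.norm_sub_le (s - r) (t - r) β p1 (by linarith) hβ hβ1
    have e2 : t - r - (s - r) = t - s := by ring
    rwa [e2, Real.div_rpow p0 p1.le, div_eq_mul_inv, ← Real.rpow_neg p1.le] at n
  simp only [← HS.compLeft_sub_left]
  refine ⟨fun r hr => ?_, fun q r hq hqr hr => ?_⟩
  · refine (HS.norm_compLeft_le _ _).trans ?_
    have p1 : 0 < s - r := sub_pos.2 hr.2
    have q1 := Real.rpow_pos_of_pos p1 (-β)
    have h2 := (h.1 r ⟨hr.1, hr.2.le.trans hsT⟩).trans (hW r hr.2)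
    rw [neg_add, Real.rpow_add p1]
    calc _ ≤ 2 * ((t - s) ^ β * (s - r) ^ (-β)) * (N * (s - r) ^ (-η)) := by
          gcongr
          exact hD r hr.2
      _ = _ := by ring
  · have p1 : 0 < s - r := sub_pos.2 hr
    have p2 : 0 < r - q := sub_pos.2 hqr
    have p3 : 0 < q := hq
    have e : (g r).compLeft (S (t - r) - S (s - r)) - (g q).compLeft (S (t - q) - S (s - q))
        = (g r - g q).compLeft (S (t - r) - S (s - r))
          + (g q).compLeft ((S (t - r) - S (s - r)) - (S (t - q) - S (s - q))) := by
      rw [HS.compLeft_sub_right, HS.compLeft_sub_left _ (S (t - q) - S (s - q))]; abel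
    have n1 := hD r hr
    have n2 := hS.norm_sub_sub_le (s - r) (t - s) (r - q) β δ p1 p0 p2.le hβ hβ1 hδ
      he.δ_lt_one.le
    have e2 : s - r + (t - s) = t - r := by ring
    have e3 : t - r + (r - q) = t - q := by ring
    have e4 : s - r + (r - q) = s - q := by ring
    rw [e2, e3, e4, Real.div_rpow p2.le p1.le, Real.div_rpow p0 p1.le, div_eq_mul_inv,
      div_eq_mul_inv, ← Real.rpow_neg p1.le, ← Real.rpow_neg p1.le] at n2
    have n3 := h.norm_sub_le_of_le hδ le_rfl hq hqr (hr.le.trans hsT)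
    rw [sub_zero] at n3
    have n4 := h.1 q ⟨hq, (hqr.trans hr).le.trans hsT⟩
    have n5 : K * Real.exp (ρ * q) ≤ K * Real.exp (ρ * r) := by gcongr
    have n6 := hW r hr
    have o1 := one_le_rpow_mul_rpow_neg p1 (by linarith : s - r ≤ s) hδ
    have o2 := one_le_rpow_mul_rpow_neg p3 (by linarith : q ≤ s) hδ
    have q1 := Real.rpow_pos_of_pos p1 (-δ)
    have q2 := Real.rpow_pos_of_pos p2 δ
    have q3 := Real.rpow_pos_of_pos p3 (-δ)
    have q4 := Real.rpow_pos_of_pos p1 (-η)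
    have q5 := Real.rpow_pos_of_pos p1 (-β)
    rw [e, sub_zero, neg_add, neg_add, Real.rpow_add p1, Real.rpow_add p1]
    refine (norm_add_le _ _).trans ((add_le_add (HS.norm_compLeft_le _ _)
      (HS.norm_compLeft_le _ _)).trans ?_)
    set W := N * (s - r) ^ (-η) with hWdef
    have hW0 : 0 ≤ W := by positivity
    calc ‖S (t - r) - S (s - r)‖ * ‖g r - g q‖
          + ‖(S (t - r) - S (s - r)) - (S (t - q) - S (s - q))‖ * ‖g q‖
        ≤ 2 * ((t - s) ^ β * (s - r) ^ (-β)) * (W * ((r - q) ^ δ * q ^ (-δ)))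
          + 2 * (((t - s) ^ β * (s - r) ^ (-β)) * ((r - q) ^ δ * (s - r) ^ (-δ))) * W := by
          gcongr
          · refine n3.trans ?_
            gcongr
          · exact n4.trans (n5.trans n6)
      _ = 2 * ((t - s) ^ β * (s - r) ^ (-β)) * W * (r - q) ^ δ
          * (q ^ (-δ) * 1 + (s - r) ^ (-δ) * 1) := by ring
      _ ≤ 2 * ((t - s) ^ β * (s - r) ^ (-β)) * W * (r - q) ^ δ
          * (q ^ (-δ) * (s ^ δ * (s - r) ^ (-δ)) + (s - r) ^ (-δ) * (s ^ δ * q ^ (-δ))) := by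
          gcongr
      _ = _ := by rw [hWdef]; ring

lemma WeightedHolder.hasFracIntegral (h : WeightedHolder δ ρ T K g)
    (hS : IsSmoothingSemigroup S) (he : MildExponents α β θ δ η) (hρ : 0 < ρ)
    (hw : HolderBoundOn θ H 0 T w) {t : ℝ} (ht : t ∈ Icc 0 T) :
    HasFracIntegral α 0 t (fun r => (g r).compLeft (S (t - r))) w := by
  rcases ht.1.eq_or_lt with rfl | h0
  · exact hasFracIntegral_self _ _ _ _
  · exact (h.singularHolder_left hS he hρ le_rfl h0 ht.2).hasFracIntegral
      (hw.mono le_rfl ht.2) he.admissible_left h0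

/-- The integral of the convolution over a short interval. -/
lemma WeightedHolder.norm_fracIntegral_le (h : WeightedHolder δ ρ T K g)
    (hS : IsSmoothingSemigroup S) (he : MildExponents α β θ δ η) (hρ : 0 < ρ)
    (hw : HolderBoundOn θ H 0 T w) {s t : ℝ} (hs : 0 ≤ s) (hst : s < t) (ht : t ≤ T) :
    ‖fracIntegral α s t (fun r => (g r).compLeft (S (t - r))) w‖
      ≤ 8 * fracConst α δ θ η (η + δ) * H * (K * Real.exp (ρ * t) * ρ ^ (-η))
        * (t - s) ^ (θ - η) := by
  have p : 0 < t - s := sub_pos.2 hst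
  refine ((h.singularHolder_left hS he hρ hs hst ht).norm_fracIntegral_le (hw.mono hs ht)
    he.admissible_left hst).trans (le_of_eq ?_)
  have e : θ - η = δ + (θ - (η + δ)) := by ring
  rw [mul_assoc (3 * _), ← Real.rpow_add p, ← e]
  ring

/-- The constant in the Hölder estimate of the convolution. -/
noncomputable def mildConst (α β θ δ η H T : ℝ) : ℝ :=
  (8 * fracConst α δ θ η (η + δ) + 12 * fracConst α δ θ (β + η) (β + η + δ)) * H
    * T ^ (θ - (β + η))

/-- By additivity the increment is an integral over $[0,s]$ with kernel $S(t-r)-S(s-r)$ plus one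
over $[s,t]$. The powers of the interval lengths combine to $(t-s)^\beta$ times a nonnegative power
bounded by means of $T$. -/
theorem WeightedHolder.norm_mildConv_sub_le (h : WeightedHolder δ ρ T K g)
    (hS : IsSmoothingSemigroup S) (he : MildExponents α β θ δ η) (hρ : 0 < ρ)
    (hw : HolderBoundOn θ H 0 T w) {s t : ℝ} (hs : 0 ≤ s) (hst : s ≤ t) (ht : t ≤ T) :
    ‖mildConv S α w g t - mildConv S α w g s‖
      ≤ mildConst α β θ δ η H T * (K * Real.exp (ρ * t) * ρ ^ (-η)) * (t - s) ^ β := by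
  rcases hst.eq_or_lt with rfl | hst
  · simp [Real.zero_rpow he.β_pos.ne']
  have hT : 0 < T := (hs.trans_lt hst).trans_le ht
  have hK := h.nonneg hT
  have hH := hw.nonneg hT
  have p : 0 < t - s := sub_pos.2 hst
  have c1 := fracConst_pos he.admissible_left
  have c2 := fracConst_pos he.admissible_right
  have hexp : 0 ≤ θ - (β + η) := sub_nonneg.2 he.add_le
  set N := K * Real.exp (ρ * t) * ρ ^ (-η) with hN
  have hN0 : 0 ≤ N := by positivity
  have hq := Real.rpow_nonneg p.le β
  have b1 : ‖fracIntegral α s t (fun r => (g r).compLeft (S (t - r))) w‖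
      ≤ 8 * fracConst α δ θ η (η + δ) * H * T ^ (θ - (β + η)) * N * (t - s) ^ β := by
    refine (h.norm_fracIntegral_le hS he hρ hw hs hst ht).trans ?_
    have e : θ - η = (θ - (β + η)) + β := by ring
    rw [e, Real.rpow_add p]
    have : (t - s) ^ (θ - (β + η)) ≤ T ^ (θ - (β + η)) :=
      Real.rpow_le_rpow p.le (by linarith) hexp
    calc _ = 8 * fracConst α δ θ η (η + δ) * H * N * (t - s) ^ β * (t - s) ^ (θ - (β + η)) := by
          ring
      _ ≤ 8 * fracConst α δ θ η (η + δ) * H * N * (t - s) ^ β * T ^ (θ - (β + η)) := by gcongr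
      _ = _ := by ring
  rcases hs.eq_or_lt with rfl | hs
  · have e : mildConv S α w g 0 = 0 := fracIntegral_self _ _ _ _
    rw [e, sub_zero]
    refine b1.trans ?_
    rw [mildConst]
    have : 0 ≤ 12 * fracConst α δ θ (β + η) (β + η + δ) * H * T ^ (θ - (β + η)) * N
      * (t - 0) ^ β := by positivity
    linarith
  have hadd := (h.singularHolder_left hS he hρ le_rfl (hs.trans hst) ht).fracIntegral_add
    (hw.mono le_rfl ht) he.admissible_left hs hst
  have hsing := h.singularHolder_right hS he hρ hs hst.le (hst.le.trans ht)
  have hws : HolderBoundOn θ H 0 s w := hw.mono le_rfl (hst.le.trans ht)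
  have hi1 := ((h.singularHolder_left hS he hρ le_rfl (hs.trans hst) ht).mono_right
    he.admissible_left.γ_nonneg he.admissible_left.κ_nonneg hs hst.le).hasFracIntegral hws
    he.admissible_left hs
  have hi2 := h.hasFracIntegral hS he hρ hw (t := s) ⟨hs.le, hst.le.trans ht⟩
  have hsub := hi1.fracIntegral_sub hi2 hs.le
  have b2 : ‖fracIntegral α 0 s (fun r => (g r).compLeft (S (t - r)) - (g r).compLeft (S (s - r))) w‖
      ≤ 12 * fracConst α δ θ (β + η) (β + η + δ) * H * T ^ (θ - (β + η)) * N * (t - s) ^ β := by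
    refine (hsing.norm_fracIntegral_le hws he.admissible_right hs).trans ?_
    have e : θ - (β + η) = δ + (θ - (β + η + δ)) := by ring
    have h1 : s ^ (θ - (β + η)) ≤ T ^ (θ - (β + η)) :=
      Real.rpow_le_rpow hs.le (hst.le.trans ht) hexp
    have h2 : K * Real.exp (ρ * s) * ρ ^ (-η) ≤ N := by rw [hN]; gcongr
    rw [sub_zero, mul_assoc _ (s ^ δ), ← Real.rpow_add hs, ← e]
    calc _ = 12 * fracConst α δ θ (β + η) (β + η + δ) * H * s ^ (θ - (β + η))
          * (K * Real.exp (ρ * s) * ρ ^ (-η)) * (t - s) ^ β := by ring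
      _ ≤ _ := by gcongr
  have e : mildConv S α w g t - mildConv S α w g s
      = fracIntegral α 0 s (fun r => (g r).compLeft (S (t - r)) - (g r).compLeft (S (s - r))) w
        + fracIntegral α s t (fun r => (g r).compLeft (S (t - r))) w := by
    rw [mildConv, mildConv, hadd, hsub]; abel
  rw [e]
  refine (norm_add_le _ _).trans ((add_le_add b2 b1).trans (le_of_eq ?_))
  rw [mildConst]
  ring

/-- The convolution vanishes at $0$ and is $\beta$-Hölder up to $0$, so it meets the weighted bound
with $T^\beta$ to spare. -/
theorem WeightedHolder.mildConv (h : WeightedHolder δ ρ T K g)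
    (hS : IsSmoothingSemigroup S) (he : MildExponents α β θ δ η) (hρ : 0 < ρ)
    (hw : HolderBoundOn θ H 0 T w) (hT : 0 < T) :
    WeightedHolder β ρ T (mildConst α β θ δ η H T * T ^ β * ρ ^ (-η) * K)
      (mildConv S α w g) := by
  have hK := h.nonneg hT
  have hH := hw.nonneg hT
  have c1 := fracConst_pos he.admissible_left
  have c2 := fracConst_pos he.admissible_right
  have hβ := he.β_pos.le
  have hc : 0 ≤ mildConst α β θ δ η H T := by unfold mildConst; positivity
  refine ⟨fun t ht => ?_, fun s t h1 h2 h3 => ?_⟩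
  · have h0 := h.norm_mildConv_sub_le hS he hρ hw le_rfl ht.1.le ht.2
    have e : PathwiseSPDE.mildConv S α w g 0 = 0 := fracIntegral_self _ _ _ _
    rw [e, sub_zero, sub_zero] at h0
    refine h0.trans ?_
    have : t ^ β ≤ T ^ β := Real.rpow_le_rpow ht.1.le ht.2 hβ
    calc _ ≤ mildConst α β θ δ η H T * (K * Real.exp (ρ * t) * ρ ^ (-η)) * T ^ β := by gcongr
      _ = _ := by ring
  · refine (h.norm_mildConv_sub_le hS he hρ hw h1.le h2.le h3).trans ?_
    have p : 0 < t - s := sub_pos.2 h2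
    have : s ^ β ≤ T ^ β := Real.rpow_le_rpow h1.le (h2.le.trans h3) hβ
    rw [Real.div_rpow p.le h1.le]
    have q := Real.rpow_pos_of_pos h1 β
    have q' := Real.rpow_nonneg p.le β
    calc _ = mildConst α β θ δ η H T * (K * Real.exp (ρ * t) * ρ ^ (-η))
          * (s ^ β * ((t - s) ^ β / s ^ β)) := by field_simp
      _ ≤ mildConst α β θ δ η H T * (K * Real.exp (ρ * t) * ρ ^ (-η))
          * (T ^ β * ((t - s) ^ β / s ^ β)) := by gcongr
      _ = _ := by ring

end Convolution

/-! ## The nonlinearity -/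

section Nonlinearity

variable {V W : Type*} [NormedAddCommGroup V] [NormedAddCommGroup W]

/-- Lipschitz bounds for a function and for its increments. -/
structure LipschitzIncrements (L L₂ : ℝ) (G : V → W) : Prop where
  nonneg : 0 ≤ L
  nonneg₂ : 0 ≤ L₂
  norm_sub_le : ∀ x y, ‖G x - G y‖ ≤ L * ‖x - y‖
  norm_sub_sub_le : ∀ x x' y y', ‖(G x - G y) - (G x' - G y')‖
    ≤ L * ‖(x - y) - (x' - y')‖ + L₂ * ‖x' - y'‖ * (‖x - x'‖ + ‖y - y'‖)

/-- Needed because a Lipschitz bound alone does not control Hölder increments of $G(u)-G(v)$ by the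
size of $u-v$. -/
lemma exists_lipschitzIncrements [NormedSpace ℝ V] [NormedSpace ℝ W] {G : V → W}
    (hG : ContDiff ℝ 2 G) (hG₁ : ∃ c : ℝ, ∀ v, ‖fderiv ℝ G v‖ ≤ c)
    (hG₂ : ∃ c : ℝ, ∀ v, ‖fderiv ℝ (fderiv ℝ G) v‖ ≤ c) :
    ∃ L L₂, LipschitzIncrements L L₂ G := by
  obtain ⟨L, hL⟩ := hG₁
  obtain ⟨L₂, hL₂⟩ := hG₂
  have hL0 : 0 ≤ L := (norm_nonneg _).trans (hL 0)
  have hL20 : 0 ≤ L₂ := le_trans (norm_nonneg (fderiv ℝ (fderiv ℝ G) 0)) (hL₂ 0)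
  have hd : Differentiable ℝ G := hG.differentiable (by norm_num)
  have hd2 : Differentiable ℝ (fderiv ℝ G) :=
    (hG.fderiv_right (m := 1) (by norm_num)).differentiable (by norm_num)
  have hlip2 : ∀ x y, ‖fderiv ℝ G x - fderiv ℝ G y‖ ≤ L₂ * ‖x - y‖ := fun x y =>
    convex_univ.norm_image_sub_le_of_norm_fderiv_le (𝕜 := ℝ) (fun z _ => hd2 z)
      (fun z _ => hL₂ z) (mem_univ y) (mem_univ x)
  refine ⟨L, L₂, hL0, hL20, fun x y => convex_univ.norm_image_sub_le_of_norm_fderiv_le (𝕜 := ℝ)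
    (fun z _ => hd z) (fun z _ => hL z) (mem_univ y) (mem_univ x), fun x x' y y' => ?_⟩
  have hder (a b : V) (t : ℝ) :
      HasDerivAt (fun t : ℝ => G (b + t • (a - b))) (fderiv ℝ G (b + t • (a - b)) (a - b)) t := by
    have h1 : HasDerivAt (fun t : ℝ => b + t • (a - b)) (a - b) t := by
      simpa using ((hasDerivAt_id t).smul_const (a - b)).const_add b
    exact (hd _).hasFDerivAt.comp_hasDerivAt t h1
  -- Both increments are interpolated along their segments at once. The derivative of the difference
  -- splits into $G'(p)$ on the difference of directions and $G'(p)-G'(p')$ on a fixed direction.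
  have key := norm_image_sub_le_of_norm_deriv_le_segment_01'
    (f := fun t : ℝ => G (y + t • (x - y)) - G (y' + t • (x' - y')))
    (C := L * ‖(x - y) - (x' - y')‖ + L₂ * ‖x' - y'‖ * (‖x - x'‖ + ‖y - y'‖))
    (fun t _ => ((hder x y t).sub (hder x' y' t)).hasDerivWithinAt) ?_
  · simp only [one_smul, zero_smul, add_zero, add_sub_cancel] at key
    refine le_trans (le_of_eq ?_) key
    congr 1
    abel
  · intro t ht
    set p := y + t • (x - y)
    set p' := y' + t • (x' - y')
    have e : fderiv ℝ G p (x - y) - fderiv ℝ G p' (x' - y')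
        = fderiv ℝ G p ((x - y) - (x' - y')) + (fderiv ℝ G p - fderiv ℝ G p') (x' - y') := by
      rw [map_sub (fderiv ℝ G p) (x - y), sub_apply]; abel
    have hp : ‖p - p'‖ ≤ ‖x - x'‖ + ‖y - y'‖ := by
      have : p - p' = t • (x - x') + (1 - t) • (y - y') := by
        simp only [p, p', smul_sub, sub_smul, one_smul]; abel
      rw [this]
      refine (norm_add_le _ _).trans (add_le_add ?_ ?_) <;> rw [norm_smul]
      · rw [Real.norm_of_nonneg ht.1]
        exact mul_le_of_le_one_left (norm_nonneg _) ht.2.le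
      · rw [Real.norm_of_nonneg (by linarith [ht.2])]
        exact mul_le_of_le_one_left (norm_nonneg _) (by linarith [ht.1])
    rw [e]
    refine (norm_add_le _ _).trans (add_le_add ?_ ?_)
    · exact (ContinuousLinearMap.le_opNorm _ _).trans (by gcongr; exact hL _)
    · refine (ContinuousLinearMap.le_opNorm _ _).trans ?_
      calc _ ≤ L₂ * (‖x - x'‖ + ‖y - y'‖) * ‖x' - y'‖ := by
            gcongr
            exact (hlip2 p p').trans (by gcongr)
        _ = _ := by ring

variable {L L₂ β δ ρ T K R : ℝ} {G : V → W} {u v : ℝ → V}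

lemma LipschitzIncrements.comp (hG : LipschitzIncrements L L₂ G) (hρ : 0 ≤ ρ) (hδ : 0 ≤ δ)
    (hδβ : δ ≤ β) (hu : WeightedHolder β ρ T K u) :
    WeightedHolder δ ρ T (‖G 0‖ + L * (2 * K)) (fun t => G (u t)) := by
  have hu' := hu.exponent_mono hρ hδ hδβ
  have hL := hG.nonneg
  refine ⟨fun t ht => ?_, fun s t h1 h2 h3 => ?_⟩
  · have h1 : ‖G (u t)‖ ≤ ‖G 0‖ + ‖G (u t) - G 0‖ := norm_le_norm_add_norm_sub' _ _
    have h2 := hG.norm_sub_le (u t) 0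
    rw [sub_zero] at h2
    have h3 : 1 ≤ Real.exp (ρ * t) := Real.one_le_exp (mul_nonneg hρ ht.1.le)
    calc _ ≤ ‖G 0‖ * 1 + L * (2 * K * Real.exp (ρ * t)) := by
          rw [mul_one]
          refine h1.trans (add_le_add le_rfl (h2.trans ?_))
          gcongr
          exact hu'.1 t ht
      _ ≤ ‖G 0‖ * Real.exp (ρ * t) + L * (2 * K * Real.exp (ρ * t)) := by gcongr
      _ = _ := by ring
  · have h5 := Real.rpow_nonneg (div_pos (sub_pos.2 h2) h1).le δ
    have h6 := Real.exp_pos (ρ * t)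
    have h7 : 0 ≤ ‖G 0‖ * Real.exp (ρ * t) * ((t - s) / s) ^ δ := by positivity
    calc _ ≤ L * ‖u t - u s‖ := hG.norm_sub_le _ _
      _ ≤ L * (2 * K * Real.exp (ρ * t) * ((t - s) / s) ^ δ) := by
          gcongr; exact hu'.2 s t h1 h2 h3
      _ ≤ _ := by linarith

/-- In the quadratic term one factor is the difference $u-v$, measured with the weight, and the
other consists of increments of $u$ and $v$, measured without it. The constant is therefore
independent of $\rho$, which may be chosen afterwards. -/
lemma LipschitzIncrements.comp_sub (hG : LipschitzIncrements L L₂ G) (hρ : 0 ≤ ρ)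
    (hu : WeightedHolder δ 0 T R u) (hv : WeightedHolder δ 0 T R v)
    (huv : WeightedHolder δ ρ T K (fun t => u t - v t)) :
    WeightedHolder δ ρ T ((L + 2 * L₂ * R) * K) (fun t => G (u t) - G (v t)) := by
  rcases le_or_gt T 0 with hT | hT
  · exact ⟨fun t ht => absurd (ht.1.trans_le ht.2) hT.not_gt,
      fun s t h1 h2 h3 => absurd ((h1.trans h2).trans_le h3) hT.not_gt⟩
  have hK := huv.nonneg hT
  have hR := hu.nonneg hT
  have hL := hG.nonneg
  have hL2 := hG.nonneg₂
  refine ⟨fun t ht => ?_, fun s t h1 h2 h3 => ?_⟩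
  · have h1 := hG.norm_sub_le (u t) (v t)
    have h2 := huv.1 t ht
    have h3 : 0 ≤ 2 * L₂ * R * K * Real.exp (ρ * t) := by positivity
    calc _ ≤ L * (K * Real.exp (ρ * t)) := h1.trans (by gcongr)
      _ ≤ _ := by linarith
  · have h5 := Real.rpow_nonneg (div_pos (sub_pos.2 h2) h1).le δ
    have a1 := huv.2 s t h1 h2 h3
    have a2 := huv.1 s ⟨h1, h2.le.trans h3⟩
    have a3 := hu.2 s t h1 h2 h3
    have a4 := hv.2 s t h1 h2 h3
    simp only [zero_mul, Real.exp_zero, mul_one] at a3 a4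
    have a5 : K * Real.exp (ρ * s) ≤ K * Real.exp (ρ * t) := by gcongr
    refine (hG.norm_sub_sub_le (u t) (u s) (v t) (v s)).trans ?_
    calc _ ≤ L * (K * Real.exp (ρ * t) * ((t - s) / s) ^ δ) + L₂ * (K * Real.exp (ρ * t))
          * (R * ((t - s) / s) ^ δ + R * ((t - s) / s) ^ δ) := by
          gcongr
          exact a2.trans a5
      _ = _ := by ring

end Nonlinearity

/-! ## The fixed point equation -/

section FixedPoint

variable {V : Type*} [NormedAddCommGroup V] [InnerProductSpace ℝ V]

lemma IsSmoothingSemigroup.weightedHolder {S : ℝ → V →L[ℝ] V} {β ρ T : ℝ} (hS : IsSmoothingSemigroup S) (hβ : 0 ≤ β)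
    (hβ1 : β ≤ 1) (hρ : 0 ≤ ρ) (x : V) : WeightedHolder β ρ T (2 * ‖x‖) (fun t => S t x) := by
  have hexp : ∀ t, 0 < t → 1 ≤ Real.exp (ρ * t) := fun t ht =>
    Real.one_le_exp (mul_nonneg hρ ht.le)
  refine ⟨fun t ht => ?_, fun s t h1 h2 _ => ?_⟩
  · have h1 := (S t).le_of_opNorm_le (hS.norm_le_one t ht.1.le) x
    have h2 := hexp t ht.1
    nlinarith [norm_nonneg x]
  · have h3 := (S t - S s).le_of_opNorm_le (hS.norm_sub_le s t β h1 h2.le hβ hβ1) x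
    rw [sub_apply] at h3
    have h4 := hexp t (h1.trans h2)
    have h5 := Real.rpow_nonneg (div_pos (sub_pos.2 h2) h1).le β
    calc _ ≤ 2 * ‖x‖ * 1 * ((t - s) / s) ^ β := h3.trans_eq (by ring)
      _ ≤ _ := by gcongr

variable [CompleteSpace V]

/-- The standing assumptions on the coefficients and exponents of the equation. -/
structure MildSetting (S : ℝ → V →L[ℝ] V) (G : V → HS V) (α β θ δ η L L₂ : ℝ) : Prop where
  semigroup : IsSmoothingSemigroup S
  nonlinearity : LipschitzIncrements L L₂ G
  exponents : MildExponents α β θ δ η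

variable {S : ℝ → V →L[ℝ] V} {G : V → HS V} {α β θ δ η L L₂ : ℝ} {H T ρ K R : ℝ}
  {w : ℝ → V} {u v : ℝ → V} {u₀ v₀ : V}

lemma mildConst_nonneg (he : MildExponents α β θ δ η) (hH : 0 ≤ H) (hT : 0 ≤ T) :
    0 ≤ mildConst α β θ δ η H T := by
  have c1 := fracConst_pos he.admissible_left
  have c2 := fracConst_pos he.admissible_right
  unfold mildConst
  positivity

lemma exists_rate (c : ℝ) {η : ℝ} (hη : 0 < η) : ∃ ρ : ℝ, 0 < ρ ∧ c * ρ ^ (-η) ≤ 1 / 2 := by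
  have h : Tendsto (fun ρ : ℝ => c * ρ ^ (-η)) atTop (𝓝 0) := by
    simpa using (tendsto_rpow_neg_atTop hη).const_mul c
  obtain ⟨ρ, h1, h2⟩ := ((h.eventually (gt_mem_nhds (by norm_num : (0 : ℝ) < 1 / 2))).and
    (eventually_gt_atTop 0)).exists
  exact ⟨ρ, h2, h1.le⟩

variable (S G α w u₀) in
/-- The right hand side of the equation. -/
noncomputable def mildMap (u : ℝ → V) (t : ℝ) : V :=
  S t u₀ + mildConv S α w (fun r => G (u r)) t

lemma mildMap_zero (hS : IsC0Semigroup S) : mildMap S G α w u₀ u 0 = u₀ := by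
  have e : mildConv S α w (fun r => G (u r)) 0 = 0 := fracIntegral_self _ _ _ _
  rw [mildMap, e, hS.zero, add_zero, ContinuousLinearMap.id_apply]

namespace MildSetting

variable (h : MildSetting S G α β θ δ η L L₂)

include h

lemma β_le_one : β ≤ 1 := by
  linarith [h.exponents.add_le, h.exponents.η_pos, h.exponents.θ_lt]

lemma comp (hρ : 0 ≤ ρ) (hu : WeightedHolder β ρ T K u) :
    WeightedHolder δ ρ T (‖G 0‖ + L * (2 * K)) (fun t => G (u t)) :=
  h.nonlinearity.comp hρ h.exponents.δ_pos.le h.exponents.δ_le hu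

/-- The a priori estimate. -/
lemma exists_apriori (hw : HolderBoundOn θ H 0 T w) (hT : 0 < T) :
    ∃ ρ : ℝ, 0 < ρ ∧ ∃ c : ℝ, ∀ u₀ u K, WeightedHolder β ρ T K u →
      WeightedHolder β ρ T (2 * ‖u₀‖ + c + K / 2) (mildMap S G α w u₀ u) := by
  set c₀ := mildConst α β θ δ η H T * T ^ β
  obtain ⟨ρ, hρ, hρ2⟩ := exists_rate (c₀ * (L * 2)) h.exponents.η_pos
  refine ⟨ρ, hρ, c₀ * ρ ^ (-η) * ‖G 0‖, fun u₀ u K hu => ?_⟩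
  have hK := hu.nonneg hT
  have h1 := (h.comp hρ.le hu).mildConv h.semigroup h.exponents hρ hw hT
  refine ((h.semigroup.weightedHolder h.exponents.β_pos.le h.β_le_one hρ.le u₀).add h1).mono ?_
  have := mul_le_mul_of_nonneg_right hρ2 hK
  calc _ = 2 * ‖u₀‖ + c₀ * ρ ^ (-η) * ‖G 0‖ + c₀ * (L * 2) * ρ ^ (-η) * K := by ring
    _ ≤ _ := by linarith

lemma mildConv_sub (hw : HolderBoundOn θ H 0 T w) (hu : WeightedHolder β 0 T R u)
    (hv : WeightedHolder β 0 T R v) {t : ℝ} (ht : t ∈ Icc 0 T) :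
    mildConv S α w (fun r => G (u r) - G (v r)) t
      = mildConv S α w (fun r => G (u r)) t - mildConv S α w (fun r => G (v r)) t := by
  have h1 := (h.comp le_rfl hu).rate_mono zero_le_one
  have h2 := (h.comp le_rfl hv).rate_mono zero_le_one
  have := (h1.hasFracIntegral h.semigroup h.exponents one_pos hw ht).fracIntegral_sub
    (h2.hasFracIntegral h.semigroup h.exponents one_pos hw ht) ht.1
  simp only [← HS.compLeft_sub_right] at this
  exact this

/-- The contraction estimate. -/
lemma exists_contraction (hw : HolderBoundOn θ H 0 T w) (hT : 0 < T) (R : ℝ) :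
    ∃ ρ : ℝ, 0 < ρ ∧ ∀ u v K, WeightedHolder β 0 T R u → WeightedHolder β 0 T R v →
      WeightedHolder β ρ T K (fun t => u t - v t) →
      WeightedHolder β ρ T (K / 2) (fun t => mildConv S α w (fun r => G (u r)) t
        - mildConv S α w (fun r => G (v r)) t) := by
  set c₀ := mildConst α β θ δ η H T * T ^ β
  -- The inner $2R$ and the last factor $2$ are the losses in passing from exponent $\beta$ to
  -- $\delta$.
  obtain ⟨ρ, hρ, hρ2⟩ := exists_rate (c₀ * ((L + 2 * L₂ * (2 * R)) * 2)) h.exponents.η_pos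
  refine ⟨ρ, hρ, fun u v K hu hv huv => ?_⟩
  have hK := huv.nonneg hT
  have hδ := h.exponents.δ_pos.le
  have h1 := h.nonlinearity.comp_sub hρ.le (hu.exponent_mono le_rfl hδ h.exponents.δ_le)
    (hv.exponent_mono le_rfl hδ h.exponents.δ_le) (huv.exponent_mono hρ.le hδ h.exponents.δ_le)
  have h2 := h1.mildConv h.semigroup h.exponents hρ hw hT
  refine (h2.congr fun t ht => h.mildConv_sub hw hu hv (Ioc_subset_Icc_self ht)).mono ?_
  have := mul_le_mul_of_nonneg_right hρ2 hK
  calc _ = c₀ * ((L + 2 * L₂ * (2 * R)) * 2) * ρ ^ (-η) * K := by ring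
    _ ≤ _ := by linarith

/-- The weighted bound says nothing at time $0$. Continuity there comes from strong continuity of
the semigroup and the unweighted Hölder bound for the convolution; the rate $1$ is an arbitrary
positive choice. -/
lemma continuousOn_mildMap (hw : HolderBoundOn θ H 0 T w) (hT : 0 < T)
    (hu : WeightedHolder β 0 T R u) : ContinuousOn (mildMap S G α w u₀ u) (Icc 0 T) := by
  have h1 := (h.comp le_rfl hu).rate_mono zero_le_one
  have hK := h1.nonneg hT
  have hH := hw.nonneg hT
  have hc := mildConst_nonneg h.exponents hH hT.le
  refine ContinuousOn.add ((h.semigroup.continuousOn u₀).mono Icc_subset_Ici_self) ?_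
  have key : ∀ s ∈ Icc 0 T, ∀ t ∈ Icc 0 T, s ≤ t →
      ‖mildConv S α w (fun r => G (u r)) t - mildConv S α w (fun r => G (u r)) s‖
        ≤ mildConst α β θ δ η H T * ((‖G 0‖ + L * (2 * R)) * Real.exp (1 * T) * 1 ^ (-η))
          * |t - s| ^ β := by
    intro s hs t ht hst
    refine (h1.norm_mildConv_sub_le h.semigroup h.exponents one_pos hw hs.1 hst ht.2).trans ?_
    rw [abs_of_nonneg (sub_nonneg.2 hst)]
    have := Real.rpow_nonneg (sub_nonneg.2 hst) β
    have := ht.2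
    gcongr
  refine HolderBoundOn.continuousOn (θ := β) (H := mildConst α β θ δ η H T
    * ((‖G 0‖ + L * (2 * R)) * Real.exp (1 * T) * 1 ^ (-η))) (fun s hs t ht => ?_)
    h.exponents.β_pos
  rcases le_total s t with hst | hst
  · exact key s hs t ht hst
  · rw [norm_sub_rev, abs_sub_comm]
    exact key t ht s hs hst

/-- A mild solution is a fixed point with a weighted Hölder bound. -/
lemma isMildSolution_iff (hw : HolderBoundOn θ H 0 T w) (hT : 0 < T) :
    IsMildSolution S G α β T w u₀ u ↔
      (∃ R, WeightedHolder β 0 T R u) ∧ EqOn u (mildMap S G α w u₀ u) (Icc 0 T) := by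
  have hβ := h.exponents.β_pos
  constructor
  · intro hu
    refine ⟨?_, hu.eq⟩
    obtain ⟨hc, C, hC⟩ := hu.mem
    obtain ⟨M, hM⟩ := isCompact_Icc.exists_bound_of_continuousOn hc
    refine ⟨max M C, fun t ht => ?_, fun s t h1 h2 h3 => ?_⟩
    · rw [zero_mul, Real.exp_zero, mul_one]
      exact (hM t (Ioc_subset_Icc_self ht)).trans (le_max_left _ _)
    · have h4 := hC s t h1 h2 h3
      have p1 := Real.rpow_pos_of_pos h1 β
      have p2 := Real.rpow_pos_of_pos (sub_pos.2 h2) β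
      rw [sub_zero, ← mul_div_assoc, div_le_iff₀ p2] at h4
      rw [zero_mul, Real.exp_zero, mul_one, Real.div_rpow (sub_pos.2 h2).le h1.le,
        ← mul_div_assoc, le_div_iff₀ p1, mul_comm]
      refine h4.trans ?_
      gcongr
      exact le_max_right _ _
  · rintro ⟨⟨R, hR⟩, heq⟩
    refine ⟨⟨(h.continuousOn_mildMap hw hT hR).congr heq, R, fun s t h1 h2 h3 => ?_⟩, fun t ht => ?_,
      heq⟩
    · have h4 := hR.2 s t h1 h2 h3
      have p1 := Real.rpow_pos_of_pos h1 β
      have p2 := Real.rpow_pos_of_pos (sub_pos.2 h2) β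
      rw [zero_mul, Real.exp_zero, mul_one, Real.div_rpow (sub_pos.2 h2).le h1.le,
        ← mul_div_assoc, le_div_iff₀ p1] at h4
      rw [sub_zero, ← mul_div_assoc, div_le_iff₀ p2]
      linarith
    · exact ((h.comp le_rfl hR).rate_mono zero_le_one).hasFracIntegral h.semigroup h.exponents
        one_pos hw ht

/-- Solutions with bounded initial values are bounded uniformly. -/
lemma exists_uniform_bound (hw : HolderBoundOn θ H 0 T w) (hT : 0 < T) (R₀ : ℝ) :
    ∃ R, ∀ u₀ u, ‖u₀‖ ≤ R₀ → IsMildSolution S G α β T w u₀ u → WeightedHolder β 0 T R u := by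
  obtain ⟨ρ, hρ, c, hc⟩ := h.exists_apriori hw hT
  refine ⟨2 * (2 * R₀ + c) * Real.exp (ρ * T), fun u₀ u hu₀ hu => ?_⟩
  obtain ⟨⟨R, hR⟩, heq⟩ := (h.isMildSolution_iff hw hT).1 hu
  refine WeightedHolder.unweighted ?_ hT hρ.le
  -- The solution has some finite bound; the self-improving estimate replaces it by one that depends
  -- on $R_0$ only.
  refine (hR.rate_mono hρ.le).improve fun K hK => ?_
  refine ((hc u₀ u K hK).congr fun t ht => (heq (Ioc_subset_Icc_self ht)).symm).mono ?_
  linarith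

/-- Solutions depend on their initial values in a locally Lipschitz continuous way. -/
lemma exists_lipschitz (hw : HolderBoundOn θ H 0 T w) (hT : 0 < T) (R₀ : ℝ) :
    ∃ C, ∀ u₀ v₀ u v, ‖u₀‖ ≤ R₀ → ‖v₀‖ ≤ R₀ → IsMildSolution S G α β T w u₀ u →
      IsMildSolution S G α β T w v₀ v → ∀ t ∈ Ioc 0 T, ‖u t - v t‖ ≤ C * ‖u₀ - v₀‖ := by
  obtain ⟨R, hR⟩ := h.exists_uniform_bound hw hT R₀
  obtain ⟨ρ, hρ, hcon⟩ := h.exists_contraction hw hT R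
  refine ⟨2 * 2 * Real.exp (ρ * T), fun u₀ v₀ u v hu₀ hv₀ hu hv t ht => ?_⟩
  have hu1 := hR u₀ u hu₀ hu
  have hv1 := hR v₀ v hv₀ hv
  have hue := ((h.isMildSolution_iff hw hT).1 hu).2
  have hve := ((h.isMildSolution_iff hw hT).1 hv).2
  have key : WeightedHolder β ρ T (2 * (2 * ‖u₀ - v₀‖)) (fun t => u t - v t) := by
    refine ((hu1.sub hv1).rate_mono hρ.le).improve fun K hK => ?_
    refine ((h.semigroup.weightedHolder h.exponents.β_pos.le h.β_le_one hρ.le (u₀ - v₀)).add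
      (hcon u v K hu1 hv1 hK)).congr fun t ht => ?_
    have e1 := hue (Ioc_subset_Icc_self ht)
    have e2 := hve (Ioc_subset_Icc_self ht)
    simp only [mildMap] at e1 e2
    simp only [e1, e2, map_sub]
    abel
  refine (key.1 t ht).trans ?_
  have : Real.exp (ρ * t) ≤ Real.exp (ρ * T) := by have := ht.2; gcongr
  calc _ ≤ 2 * (2 * ‖u₀ - v₀‖) * Real.exp (ρ * T) := by gcongr
    _ = _ := by ring

theorem unique (hw : HolderBoundOn θ H 0 T w) (hT : 0 < T)
    (hu : IsMildSolution S G α β T w u₀ u) (hv : IsMildSolution S G α β T w u₀ v) :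
    EqOn u v (Icc 0 T) := by
  intro t ht
  rcases ht.1.eq_or_lt with rfl | h0
  · have e1 := hu.eq 0 ht
    have e2 := hv.eq 0 ht
    rw [fracIntegral_self] at e1 e2
    rw [e1, e2]
  · obtain ⟨C, hC⟩ := h.exists_lipschitz hw hT ‖u₀‖
    have := hC u₀ u₀ u v le_rfl le_rfl hu hv t ⟨h0, ht.2⟩
    rw [sub_self, norm_zero, mul_zero, norm_le_zero_iff, sub_eq_zero] at this
    exact this

theorem exists_solution (hw : HolderBoundOn θ H 0 T w) (hT : 0 < T) (u₀ : V) :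
    ∃ u, IsMildSolution S G α β T w u₀ u := by
  obtain ⟨ρ₁, hρ₁, c, hc⟩ := h.exists_apriori hw hT
  -- Chosen so that $2\|u_0\|+c+K_1/2\le K_1$, that is, the ball is invariant.
  set K₁ := 2 * (2 * ‖u₀‖ + |c|)
  set U : ℕ → ℝ → V := fun n => (mildMap S G α w u₀)^[n] fun _ => 0
  have hUs (n : ℕ) : U (n + 1) = mildMap S G α w u₀ (U n) := Function.iterate_succ_apply' _ _ _
  have hU (n : ℕ) : WeightedHolder β ρ₁ T K₁ (U n) := by
    induction n with
    | zero =>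
      refine ⟨fun t _ => ?_, fun s t h1 h2 _ => ?_⟩
      · simp only [U, Function.iterate_zero, id, norm_zero]; positivity
      · have := Real.rpow_nonneg (div_pos (sub_pos.2 h2) h1).le β
        simp only [U, Function.iterate_zero, id, sub_self, norm_zero]; positivity
    | succ n ih =>
      rw [hUs]
      refine (hc u₀ _ _ ih).mono ?_
      have := le_abs_self c
      simp only [K₁]
      linarith
  set R := K₁ * Real.exp (ρ₁ * T)
  have hUR (n : ℕ) : WeightedHolder β 0 T R (U n) := (hU n).unweighted hT hρ₁.le
  -- A second rate: the contraction rate depends on the bound $R$ of the iterates, which the first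
  -- rate has to provide beforehand.
  obtain ⟨ρ, hρ, hcon⟩ := h.exists_contraction hw hT R
  have hdiff (n : ℕ) :
      WeightedHolder β ρ T (2 * R * (1 / 2) ^ n) (fun t => U (n + 1) t - U n t) := by
    induction n with
    | zero =>
      refine (((hUR 1).sub (hUR 0)).rate_mono hρ.le).mono (le_of_eq ?_)
      ring
    | succ n ih =>
      have := hcon _ _ _ (hUR (n + 1)) (hUR n) ih
      refine (this.congr fun t _ => ?_).mono (le_of_eq ?_)
      · have e1 := congrFun (hUs (n + 1)) t
        have e2 := congrFun (hUs n) t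
        rw [mildMap] at e1 e2
        simp only [e1, e2]
        abel
      · rw [pow_succ]; ring
  have hR := (hUR 0).nonneg hT
  have htel (n j : ℕ) : WeightedHolder β ρ T (4 * R * (1 / 2) ^ n * (1 - (1 / 2) ^ j))
      (fun t => U (n + j) t - U n t) := by
    induction j with
    | zero =>
      simp only [pow_zero, sub_self, mul_zero, add_zero]
      exact ⟨fun t _ => by simp, fun s t _ _ _ => by simp⟩
    | succ j ih =>
      refine ((ih.add (hdiff (n + j))).congr fun t _ => ?_).mono (le_of_eq ?_)
      · rw [← add_assoc]; abel
      · rw [pow_add, pow_succ]; ring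
  have hlim : ∀ t ∈ Icc 0 T, ∃ l, Tendsto (fun n => U n t) atTop (𝓝 l) := by
    intro t ht
    -- Time $0$ lies outside the weighted bounds, but every iterate except the initial one equals
    -- $u_0$ there.
    rcases ht.1.eq_or_lt with rfl | h0
    · refine ⟨u₀, tendsto_const_nhds.congr' ?_⟩
      filter_upwards [eventually_ge_atTop 1] with n hn
      obtain ⟨m, rfl⟩ := Nat.exists_eq_add_of_le' hn
      rw [hUs, mildMap_zero h.semigroup.toIsC0Semigroup]
    · refine cauchySeq_tendsto_of_complete (cauchySeq_of_le_geometric (1 / 2)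
        (2 * R * Real.exp (ρ * t)) (by norm_num) fun n => ?_)
      rw [dist_comm, dist_eq_norm]
      exact ((hdiff n).1 t ⟨h0, ht.2⟩).trans_eq (by ring)
  choose! u hu using hlim
  have huR : WeightedHolder β 0 T R u := WeightedHolder.of_tendsto (l := atTop) (.of_forall hUR)
    tendsto_const_nhds fun t ht => hu t (Ioc_subset_Icc_self ht)
  refine ⟨u, (h.isMildSolution_iff hw hT).2 ⟨⟨R, huR⟩, fun t ht => ?_⟩⟩
  rcases ht.1.eq_or_lt with rfl | h0
  · rw [mildMap_zero h.semigroup.toIsC0Semigroup]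
    refine tendsto_nhds_unique (hu 0 ht) (tendsto_const_nhds.congr' ?_)
    filter_upwards [eventually_ge_atTop 1] with n hn
    obtain ⟨m, rfl⟩ := Nat.exists_eq_add_of_le' hn
    rw [hUs, mildMap_zero h.semigroup.toIsC0Semigroup]
  have hpow : Tendsto (fun n : ℕ => (1 / 2 : ℝ) ^ n) atTop (𝓝 0) :=
    tendsto_pow_atTop_nhds_zero_of_lt_one (by norm_num) (by norm_num)
  have hrest (n : ℕ) : WeightedHolder β ρ T (4 * R * (1 / 2) ^ n) (fun t => u t - U n t) := by
    refine WeightedHolder.of_tendsto (l := atTop) (.of_forall (htel n)) ?_ fun t ht => ?_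
    · simpa using (hpow.const_sub 1).const_mul (4 * R * (1 / 2) ^ n)
    · have := (hu t (Ioc_subset_Icc_self ht)).comp (tendsto_add_atTop_nat n)
      simp only [Function.comp_def, add_comm _ n] at this
      exact this.sub_const _
  refine tendsto_nhds_unique ((hu t ht).comp (tendsto_add_atTop_nat 1)) ?_
  rw [tendsto_iff_norm_sub_tendsto_zero]
  have hz : Tendsto (fun n : ℕ => 4 * R * (1 / 2) ^ n / 2 * Real.exp (ρ * t)) atTop (𝓝 0) := by
    simpa using ((hpow.const_mul (4 * R)).div_const 2).mul_const (Real.exp (ρ * t))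
  refine squeeze_zero (fun _ => norm_nonneg _) (fun n => ?_) hz
  have := (hcon _ _ _ huR (hUR n) (hrest n)).1 t ⟨h0, ht.2⟩
  rw [Function.comp_apply, hUs, norm_sub_rev, mildMap, mildMap, add_sub_add_left_eq_sub]
  exact this

end MildSetting

end FixedPoint

/-! ## The solution flow -/

section Flow

variable {V : Type*} [NormedAddCommGroup V] [InnerProductSpace ℝ V] [CompleteSpace V]

variable {S : ℝ → V →L[ℝ] V} {G : V → HS V} {α β θ δ η L L₂ : ℝ} {H T T' ρ K : ℝ}
  {w : ℝ → V} {u v : ℝ → V} {u₀ : V}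

/-- On the past $[0,s]$ the semigroup law lets $S(t-s)$ be pulled out of the integral. -/
lemma WeightedHolder.mildConv_eq_add {g : ℝ → HS V} (h : WeightedHolder δ ρ T K g)
    (hS : IsSmoothingSemigroup S) (he : MildExponents α β θ δ η) (hρ : 0 < ρ)
    (hw : HolderBoundOn θ H 0 T w) {s t : ℝ} (hs : 0 ≤ s) (hst : s ≤ t) (ht : t ≤ T) :
    PathwiseSPDE.mildConv S α w g t = S (t - s) (PathwiseSPDE.mildConv S α w g s)
      + fracIntegral α s t (fun r => (g r).compLeft (S (t - r))) w := by
  rcases hst.eq_or_lt with rfl | hst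
  · rw [fracIntegral_self, sub_self, hS.zero, add_zero, ContinuousLinearMap.id_apply]
  rcases hs.eq_or_lt with rfl | hs
  · have e : PathwiseSPDE.mildConv S α w g 0 = 0 := fracIntegral_self _ _ _ _
    rw [e, map_zero, zero_add, PathwiseSPDE.mildConv]
  have hadd := (h.singularHolder_left hS he hρ le_rfl (hs.trans hst) ht).fracIntegral_add
    (hw.mono le_rfl ht) he.admissible_left hs hst
  rw [PathwiseSPDE.mildConv, hadd, PathwiseSPDE.mildConv,
    ← (h.hasFracIntegral hS he hρ hw ⟨hs.le, hst.le.trans ht⟩).fracIntegral_compLeft hs.le]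
  congr 1
  refine fracIntegral_congr hs.le fun r hr => ?_
  simp only [HS.compLeft_compLeft]
  rw [← hS.add _ _ (sub_pos.2 hst).le (sub_pos.2 hr.2).le, sub_add_sub_cancel]

lemma IsMildSolution.mono (hu : IsMildSolution S G α β T w u₀ u) (hT : T' ≤ T) :
    IsMildSolution S G α β T' w u₀ u := by
  have hsub : Icc 0 T' ⊆ Icc 0 T := Icc_subset_Icc_right hT
  obtain ⟨hc, C, hC⟩ := hu.mem
  exact ⟨⟨hc.mono hsub, C, fun s t h1 h2 h3 => hC s t h1 h2 (h3.trans hT)⟩,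
    fun t ht => hu.hasFracIntegral t (hsub ht), fun t ht => hu.eq t (hsub ht)⟩

lemma IsMildSolution.congr (hu : IsMildSolution S G α β T w u₀ u) (huv : EqOn u v (Icc 0 T)) :
    IsMildSolution S G α β T w u₀ v := by
  have hint : ∀ t ∈ Icc 0 T, EqOn (fun r => (G (u r)).compLeft (S (t - r)))
      (fun r => (G (v r)).compLeft (S (t - r))) (Ioo 0 t) := fun t ht r hr => by
    simp only [huv ⟨hr.1.le, hr.2.le.trans ht.2⟩]
  obtain ⟨hc, C, hC⟩ := hu.mem
  refine ⟨⟨hc.congr huv.symm, C, fun s t h1 h2 h3 => ?_⟩,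
    fun t ht => (hu.hasFracIntegral t ht).congr ht.1 (hint t ht), fun t ht => ?_⟩
  · rw [← huv ⟨(h1.trans h2).le, h3⟩, ← huv ⟨h1.le, h2.le.trans h3⟩]
    exact hC s t h1 h2 h3
  · rw [← huv ht, hu.eq t ht, fracIntegral_congr ht.1 (hint t ht)]

namespace MildSetting

variable (h : MildSetting S G α β θ δ η L L₂)

include h

lemma eq_add_fracIntegral (hw : HolderBoundOn θ H 0 T w) (hT : 0 < T)
    (hu : IsMildSolution S G α β T w u₀ u) {s t : ℝ} (hs : 0 ≤ s) (hst : s ≤ t) (ht : t ≤ T) :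
    u t = S (t - s) (u s) + fracIntegral α s t (fun r => (G (u r)).compLeft (S (t - r))) w := by
  obtain ⟨⟨R, hR⟩, heq⟩ := (h.isMildSolution_iff hw hT).1 hu
  have hS := h.semigroup
  have hc := ((h.comp le_rfl hR).rate_mono zero_le_one).mildConv_eq_add hS h.exponents one_pos hw
    hs hst ht
  have e : S (t - s) (S s u₀) = S t u₀ := by
    rw [← ContinuousLinearMap.comp_apply, ← hS.add _ _ (sub_nonneg.2 hst) hs, sub_add_cancel]
  rw [heq ⟨hs.trans hst, ht⟩, heq ⟨hs, hst.trans ht⟩, mildMap, mildMap, hc, map_add, e, add_assoc]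

/-- The time shift of a solution solves the shifted equation. -/
lemma shift {τ : ℝ} (hτ : 0 ≤ τ) (hT : 0 < T) (hw : HolderBoundOn θ H 0 (τ + T) w)
    (hu : IsMildSolution S G α β (τ + T) w u₀ u) :
    IsMildSolution S G α β T (fun r => w (τ + r) - w τ) (u τ) (fun r => u (τ + r)) := by
  have hT' : 0 < τ + T := by linarith
  have hw' : HolderBoundOn θ H 0 T (fun r => w (τ + r) - w τ) := fun s hs t ht => by
    have := hw (τ + s) ⟨by linarith [hs.1], by linarith [hs.2]⟩ (τ + t)
      ⟨by linarith [ht.1], by linarith [ht.2]⟩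
    simpa using this
  obtain ⟨⟨R, hR⟩, -⟩ := (h.isMildSolution_iff hw hT').1 hu
  have hR0 := hR.nonneg hT'
  refine (h.isMildSolution_iff hw' hT).2 ⟨⟨R, fun t ht => ?_, fun s t h1 h2 h3 => ?_⟩,
    fun t ht => ?_⟩
  · simpa using hR.1 (τ + t) ⟨by linarith [ht.1], by linarith [ht.2]⟩
  · have h4 := hR.2 (τ + s) (τ + t) (by linarith) (by linarith) (by linarith)
    rw [zero_mul, Real.exp_zero, add_sub_add_left_eq_sub] at h4
    rw [zero_mul, Real.exp_zero]
    -- Dropping $\tau$ from the denominator $\tau+s$ only enlarges the bound.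
    refine h4.trans ?_
    have := h.exponents.β_pos.le
    have := sub_pos.2 h2
    gcongr
    linarith
  · have e := h.eq_add_fracIntegral hw hT' hu hτ (by linarith [ht.1] : τ ≤ τ + t)
      (by linarith [ht.2])
    have e' := fracIntegral_shift α 0 t τ (fun r => (G (u r)).compLeft (S (τ + t - r))) w (w τ)
    simp only [add_zero, add_sub_add_left_eq_sub] at e'
    rw [add_sub_cancel_left, ← e'] at e
    exact e

/-- The values at a positive time of the solutions with initial values in a ball are totally
bounded. -/
lemma totallyBounded_values (hT : 0 < T) (hw : HolderBoundOn θ H 0 T w) (R₀ : ℝ) :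
    TotallyBounded {x | ∃ u₀ u, ‖u₀‖ ≤ R₀ ∧ IsMildSolution S G α β T w u₀ u ∧ u T = x} := by
  obtain ⟨R, hR⟩ := h.exists_uniform_bound hw hT R₀
  set C := 8 * fracConst α δ θ η (η + δ) * H
    * ((‖G 0‖ + L * (2 * R)) * Real.exp (1 * T) * 1 ^ (-η))
  have hθη : 0 < θ - η := by linarith [h.exponents.add_le, h.exponents.β_pos]
  have hlim : Tendsto (fun d : ℝ => C * d ^ (θ - η)) (𝓝[>] 0) (𝓝 0) := by
    have : ContinuousAt (fun d : ℝ => C * d ^ (θ - η)) 0 :=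
      continuousAt_const.mul (Real.continuousAt_rpow_const 0 _ (Or.inr hθη.le))
    have := this.tendsto
    rw [Real.zero_rpow hθη.ne', mul_zero] at this
    exact this.mono_left nhdsWithin_le_nhds
  rw [Metric.totallyBounded_iff]
  intro ε hε
  -- The integral over the last $d$ units of time is below $\varepsilon/2$ for all solutions at
  -- once; the rest is $S(d)$ applied to a bounded set.
  obtain ⟨d, hd1, hd⟩ := ((hlim.eventually (gt_mem_nhds (half_pos hε))).and
    (Ioo_mem_nhdsGT hT)).exists
  have hK : TotallyBounded (S d '' Metric.closedBall 0 R) :=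
    ((h.semigroup.compact d hd.1).isCompact_closure_image_closedBall R).totallyBounded.subset
      subset_closure
  obtain ⟨F, hF, hcov⟩ := Metric.totallyBounded_iff.1 hK (ε / 2) (half_pos hε)
  refine ⟨F, hF, ?_⟩
  rintro x ⟨u₀, u, hu₀, hu, rfl⟩
  have hRu := hR u₀ u hu₀ hu
  have e := h.eq_add_fracIntegral hw hT hu (sub_pos.2 hd.2).le (by linarith [hd.1]) le_rfl
  have hfr := ((h.comp le_rfl hRu).rate_mono zero_le_one).norm_fracIntegral_le h.semigroup
    h.exponents one_pos hw (sub_pos.2 hd.2).le (by linarith [hd.1]) le_rfl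
  rw [sub_sub_cancel] at e hfr
  have hmem : S d (u (T - d)) ∈ S d '' Metric.closedBall 0 R := by
    refine mem_image_of_mem _ ?_
    have := hRu.1 (T - d) ⟨sub_pos.2 hd.2, by linarith [hd.1]⟩
    simpa using this
  obtain ⟨y, hy, hxy⟩ := mem_iUnion₂.1 (hcov hmem)
  refine mem_iUnion₂.2 ⟨y, hy, ?_⟩
  have h1 : dist (u T) (S d (u (T - d))) < ε / 2 := by
    rw [dist_eq_norm, sub_eq_of_eq_add' e]
    exact hfr.trans_lt hd1
  have h2 : dist (S d (u (T - d))) y < ε / 2 := hxy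
  exact Metric.mem_ball.2 ((dist_triangle _ _ _).trans_lt (by linarith))

/-- The solutions form a cocycle of continuous maps, compact at positive times. -/
theorem exists_cocycle :
    ∃ φ : ℝ≥0 → PathSpace V θ → V → V,
      (∀ (ω : PathSpace V θ) (u₀ : V) (T : ℝ), 0 < T →
        IsMildSolution S G α β T ω u₀ (fun t => φ t.toNNReal ω u₀) ∧
        ∀ u : ℝ → V, IsMildSolution S G α β T ω u₀ u →
          ∀ t ∈ Icc 0 T, u t = φ t.toNNReal ω u₀) ∧
      IsNonautonomousDynamicalSystem wienerShift φ ∧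
      (∀ (t : ℝ≥0) (ω : PathSpace V θ), Continuous (φ t ω)) ∧
      (∀ (t : ℝ≥0) (ω : PathSpace V θ), 0 < t → IsCompactMap (φ t ω)) := by
  have hpath (ω : PathSpace V θ) (T : ℝ) : ∃ H, HolderBoundOn θ H 0 T ω := ω.2.2 0 T
  have hex : ∀ (ω : PathSpace V θ) (u₀ : V) (T : ℝ), 0 < T →
      ∃ u, IsMildSolution S G α β T ω u₀ u := fun ω u₀ T hT =>
    have ⟨_, hw⟩ := hpath ω T
    h.exists_solution hw hT u₀
  choose! U hU using hex
  have huniq : ∀ (ω : PathSpace V θ) (u₀ : V) (T T' : ℝ) (u : ℝ → V), 0 < T → 0 < T' →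
      IsMildSolution S G α β T ω u₀ u → ∀ t ∈ Icc 0 T, t ≤ T' → u t = U ω u₀ T' t := by
    intro ω u₀ T T' u hT hT' hu t ht htT'
    obtain ⟨H, hw⟩ := hpath ω (min T T')
    exact h.unique hw (lt_min hT hT') (hu.mono (min_le_left _ _))
      ((hU ω u₀ T' hT').mono (min_le_right _ _)) ⟨ht.1, le_min ht.2 htT'⟩
  -- The horizon $t+1$ is positive even for $t=0$; by uniqueness its choice is immaterial.
  set φ : ℝ≥0 → PathSpace V θ → V → V := fun t ω u₀ => U ω u₀ (t + 1) t with hφ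
  have hval : ∀ (ω : PathSpace V θ) (u₀ : V) (T : ℝ) (u : ℝ → V), 0 < T →
      IsMildSolution S G α β T ω u₀ u → ∀ t ∈ Icc 0 T, u t = φ t.toNNReal ω u₀ := by
    intro ω u₀ T u hT hu t ht
    simp only [hφ, Real.coe_toNNReal t ht.1]
    exact huniq ω u₀ T (t + 1) u hT (by linarith [ht.1]) hu t ht (by linarith)
  have hsol : ∀ (ω : PathSpace V θ) (u₀ : V) (T : ℝ), 0 < T →
      IsMildSolution S G α β T ω u₀ (fun t => φ t.toNNReal ω u₀) := fun ω u₀ T hT =>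
    (hU ω u₀ T hT).congr (hval ω u₀ T _ hT (hU ω u₀ T hT))
  have hzero : ∀ (ω : PathSpace V θ) (u₀ : V), φ 0 ω u₀ = u₀ := by
    intro ω u₀
    have e := (hsol ω u₀ 1 one_pos).eq 0 ⟨le_rfl, zero_le_one⟩
    rwa [fracIntegral_self, add_zero, h.semigroup.zero, ContinuousLinearMap.id_apply,
      Real.toNNReal_zero] at e
  refine ⟨φ, fun ω u₀ T hT => ⟨hsol ω u₀ T hT, fun u => hval ω u₀ T u hT⟩,
    ⟨fun ω => Subtype.ext (funext fun r => ?_), fun t τ ω => Subtype.ext (funext fun r => ?_),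
      hzero, fun t τ ω u₀ => ?_⟩, fun t ω => ?_, fun t ω ht B hB => ?_⟩
  · simp [wienerShift, ω.2.1]
  · simp [wienerShift, ← add_assoc, add_comm τ t]
  · have hT : (0 : ℝ) < t + 1 := by positivity
    obtain ⟨H, hw⟩ := hpath ω (τ + (t + 1))
    have hs := h.shift τ.coe_nonneg hT hw (hsol ω u₀ (τ + (t + 1)) (by positivity))
    have e := hval (wienerShift τ ω) _ _ _ hT hs t ⟨t.coe_nonneg, by linarith⟩
    rw [← NNReal.coe_add] at e
    simpa [add_comm τ t] using e
  · rcases eq_zero_or_pos t with rfl | ht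
    · rw [show φ 0 ω = id from funext (hzero ω)]
      exact continuous_id
    · have hT : (0 : ℝ) < t := ht
      obtain ⟨H, hw⟩ := hpath ω t
      refine continuous_iff_continuousAt.2 fun x => ?_
      obtain ⟨C, hC⟩ := h.exists_lipschitz hw hT (‖x‖ + 1)
      refine tendsto_iff_norm_sub_tendsto_zero.2 (squeeze_zero' (.of_forall fun _ => norm_nonneg _)
        (g := fun y => C * ‖y - x‖) ?_ ?_)
      · filter_upwards [Metric.ball_mem_nhds x one_pos] with y hy
        have hy1 : ‖y‖ ≤ ‖x‖ + 1 := by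
          have := norm_le_norm_add_norm_sub' y x
          rw [mem_ball_iff_norm] at hy
          linarith
        simpa using hC y x _ _ hy1 (by linarith) (hsol ω y t hT) (hsol ω x t hT) t ⟨hT, le_rfl⟩
      · have : Continuous fun y : V => C * ‖y - x‖ := by fun_prop
        simpa using this.tendsto x
  · have hT : (0 : ℝ) < t := ht
    obtain ⟨H, hw⟩ := hpath ω t
    obtain ⟨R, hR⟩ := hB.exists_norm_le
    have htb := h.totallyBounded_values hT hw R
    refine (htb.subset ?_).closure.isCompact_of_isClosed isClosed_closure
    rintro _ ⟨x, hx, rfl⟩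
    exact ⟨x, _, hR x hx, hsol ω x t hT, by simp⟩

end MildSetting

end Flow

end PathwiseSPDE

theorem theoremt2 {V : Type*} [NormedAddCommGroup V] [InnerProductSpace ℝ V] [CompleteSpace V]
    [TopologicalSpace.SeparableSpace V]
    (A : V →ₗ.[ℝ] V) (hA_symm : A.IsFormalAdjoint A)
    (hA_pos : ∀ x : A.domain, (x : V) ≠ 0 → 0 < ⟪-(A x), (x : V)⟫_ℝ)
    (hA_inv : HasCompactInverse (-A))
    (S : ℝ → V →L[ℝ] V) (hS : IsC0Semigroup S) (hSA : IsGenerator S A)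
    (G : V → HS V) (hG : ContDiff ℝ 2 G)
    (hG₁ : ∃ c : ℝ, ∀ v, ‖fderiv ℝ G v‖ ≤ c)
    (hG₂ : ∃ c : ℝ, ∀ v, ‖fderiv ℝ (fderiv ℝ G) v‖ ≤ c)
    (α β β' : ℝ) (hβ : 1 / 2 < β) (hββ' : β < β') (hβ' : β' < 1)
    (hα : 1 - β' < α) (hαβ : α < β) :
    ∃ φ : ℝ≥0 → PathSpace V β' → V → V,
      (∀ (ω : PathSpace V β') (u₀ : V) (T : ℝ), 0 < T →
        IsMildSolution S G α β T ω u₀ (fun t => φ t.toNNReal ω u₀) ∧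
        ∀ u : ℝ → V, IsMildSolution S G α β T ω u₀ u →
          ∀ t ∈ Icc 0 T, u t = φ t.toNNReal ω u₀) ∧
      IsNonautonomousDynamicalSystem wienerShift φ ∧
      (∀ (t : ℝ≥0) (ω : PathSpace V β'), Continuous (φ t ω)) ∧
      (∀ (t : ℝ≥0) (ω : PathSpace V β'), 0 < t → IsCompactMap (φ t ω)) := by
  obtain ⟨L, L₂, hL⟩ := exists_lipschitzIncrements hG hG₁ hG₂
  have hε : 0 < min (β - α) (β' - β) / 3 :=
    div_pos (lt_min (sub_pos.2 hαβ) (sub_pos.2 hββ')) (by norm_num)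
  have h1 := min_le_left (β - α) (β' - β)
  have h2 := min_le_right (β - α) (β' - β)
  -- With $\varepsilon$ this third, $\delta=\alpha+\varepsilon$ and $\eta=\varepsilon$: then
  -- $\delta\le\beta$, and $\beta+\eta+\delta<\beta'+\alpha$ amounts to $2\varepsilon<\beta'-\beta$.
  have he : MildExponents α β β' (α + min (β - α) (β' - β) / 3) (min (β - α) (β' - β) / 3) :=
    ⟨by linarith, by linarith, by linarith, hε, hβ', by linarith, by linarith⟩
  exact MildSetting.exists_cocycle
    ⟨isSmoothingSemigroup_of_compactInverse A hA_symm hA_pos hA_inv S hS hSA, hL, he⟩
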